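/- Let $k$ be a field, $B$ a finite-dimensional Hopf algebra over $k$ with antipode $S$, and ${}^B_B\mathcal{YD}$ the category of left-left Yetter–Drinfeld modules over $B$ with braiding $C_{M,N}(m\otimes n)=\sum m_{(-1)}\cdot n\otimes m_{(0)}$. All algebras, (co)module algebras and braided Hopf algebras below live in this braided category, and a tensor product of two algebras carries the braided product $(m\otimes m)(\mathrm{id}\otimes C\otimes \mathrm{id})$. Let $H$ be a braided Hopf algebra in ${}^B_B\mathcal{YD}$ with $C_{H,H}=C_{H,H}^{-1}$. The full dual $H^*$ is a Yetter–Drinfeld module by $(b\cdot f)(x)=f(S(b)\cdot x)$ and $\sum f_{(-1)}f_{(0)}(x)=\sum S^{-1}(x_{(-1)})f(x_{(0)})$. Let $H^\circ\subseteq H^*$ be the set of functionals whose kernel contains an ideal of $H$ in ${}^B_B\mathcal{YD}$ of finite codimension; it is a braided Hopf algebra with the structure dual to that of $H$ under evaluation $\langle f,x\rangle_{ev}=f(x)$, i.e. $\langle f,xy\rangle_{ev}=(\langle,\rangle_{ev}\otimes\langle,\rangle_{ev})(\mathrm{id}\otimes C\otimes \mathrm{id})(\Delta f\otimes x\otimes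 y)$, $\langle fg,x\rangle_{ev}=(\langle,\rangle_{ev}\otimes\langle,\rangle_{ev})(\mathrm{id}\otimes C\otimes \mathrm{id})(f\otimes g\otimes \Delta x)$, $\langle f,1\rangle_{ev}=\epsilon(f)$, $\langle 1,x\rangle_{ev}=\epsilon(x)$, $\langle S f,x\rangle_{ev}=\langle f,S x\rangle_{ev}$. Let $U$ be a braided Hopf subalgebra of $H^\circ$ and $V$ a braided Hopf subalgebra of $H$, both with invertible antipodes, and suppose that $U$ is dense in $H^*$ (finite topology: for every $f\in H^*$ and every finite $F\subseteq H$ some $u\in U$ agrees with $f$ on $F$). Put $\langle,\rangle=\langle,\rangle_{ev}\,C_{V,U}:V\otimes U\to k$. Assume the $RL$-condition on $U$ and $V$ under $\langle,\rangle$: for each $v\in V$ the map $\rho(v\#1):x\mapsto\sum\langle v,x_1\rangle x_2$ in $\mathrm{End}_k(U)$ lies in the image of $\lambda:U\otimes V\to \mathrm{End}_k(U)$, where $\lambda(u\# v)(x)=(m\otimes\langle,\rangle)(\mathrm{id}\otimes C_{V,U}\otimes \mathrm{id})(u\otimes v\otimes\Delta x)$. Let $(R,\psi)$ be a right $V$-comodule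 algebra in ${}^B_B\mathcal{YD}$. Let $U$ act on $R$ by $\alpha=(R\otimes\langle,\rangle)(R\otimes C_{U,V})(C_{U,R}\otimes V)(U\otimes\psi)$, let $V$ act on $U$ by $\rightharpoonup\,=(U\otimes\langle,\rangle)(C_{V,U}\otimes U)(V\otimes\Delta)$, and let $V$ act on $R\otimes U$ by $(R\otimes\rightharpoonup)(C_{V,R}\otimes U)$ (trivially on $R$ and via $\rightharpoonup$ on $U$). For an algebra $A$ with an action $\rightharpoonup$ of a braided Hopf algebra $X$, $A\# X$ is $A\otimes X$ with unit $1\otimes 1$ and product $(a\# x)(a'\# x')=\sum a\,(x_1\rightharpoonup a'')\,\#\,x_2'\,x'$, where $\sum a''\otimes x_2'=C_{X,A}(x_2\otimes a')$. Then these actions make $R$ a $U$-module algebra, $U$ a $V$-module algebra and $R\# U$ a $V$-module algebra; $(R\# U)\# V$ and $R\otimes(U\# V)$ are (associative, unital) algebras in ${}^B_B\mathcal{YD}$; and there is an isomorphism of $k$-algebras $$(R\# U)\# V\;\cong\;R\otimes (U\# V).$$ Moreover, if $B$ is commutative and cocommutative, this isomorphism is an isomorphism of algebras in ${}^B_B\mathcal{YD}$.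 -/

import Mathlib

open scoped TensorProduct

noncomputable section

namespace YD

/-- A left-left Yetter-Drinfeld module over the Hopf algebra `B`: a left `B`-module and a left
`B`-comodule with `b₁ m₍₋₁₎ ⊗ b₂ • m₍₀₎ = (b₁ • m)₍₋₁₎ b₂ ⊗ (b₁ • m)₍₀₎`. -/
class YDModule (k B M : Type*) [Field k] [Ring B] [HopfAlgebra k B]
    [AddCommGroup M] [Module k M] where
  /-- the `B`-action `b ↦ (m ↦ b • m)` -/
  act : B →ₐ[k] Module.End k M
  /-- the `B`-coaction `m ↦ m₍₋₁₎ ⊗ m₍₀₎` -/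
  coact : M →ₗ[k] B ⊗[k] M
  coassoc : ∀ m : M, TensorProduct.assoc k B B M
    ((Coalgebra.comul (R := k) (A := B)).rTensor M (coact m)) = coact.lTensor B (coact m)
  counit_coact : ∀ m : M,
    (Coalgebra.counit (R := k) (A := B)).rTensor M (coact m) = 1 ⊗ₜ[k] m
  compat : ∀ (b : B) (m : M),
    TensorProduct.map₂ (LinearMap.mul k B) act.toLinearMap (Coalgebra.comul (R := k) b) (coact m)
    = (LinearMap.mul' k B).rTensor M (TensorProduct.rightComm k B M B
        ((coact ∘ₗ act.toLinearMap.flip m).rTensor B (Coalgebra.comul (R := k) b)))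

variable (k : Type*) [Field k] (B : Type*) [Ring B] [HopfAlgebra k B]

/-- The action of `B`. -/
abbrev act (M : Type*) [AddCommGroup M] [Module k M] [YDModule k B M] : B →ₐ[k] Module.End k M :=
  YDModule.act

/-- The coaction of `B`. -/
abbrev coact (M : Type*) [AddCommGroup M] [Module k M] [YDModule k B M] : M →ₗ[k] B ⊗[k] M :=
  YDModule.coact

variable {k}

section modules
variable {M N : Type*} [AddCommGroup M] [Module k M] [AddCommGroup N] [Module k N]

/-- Morphisms of Yetter-Drinfeld modules. -/
structure IsYDHom [YDModule k B M] [YDModule k B N] (f : M →ₗ[k] N) : Prop where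
  map_act : ∀ (b : B) (m : M), f (act k B M b m) = act k B N b (f m)
  map_coact : ∀ m : M, coact k B N (f m) = f.lTensor B (coact k B M m)

/-- The unit object `k` of the category. -/
instance unitYDModule : YDModule k B k where
  act := (Algebra.lmul k k).comp (Bialgebra.counitAlgHom k B)
  coact := TensorProduct.mk k B k 1
  coassoc m := by simp [Algebra.TensorProduct.one_def]
  counit_coact m := by simp
  compat b m := by
    have key : ∀ z : B ⊗[k] B,
      TensorProduct.map₂ (LinearMap.mul k B)
        ((Algebra.lmul k k).comp (Bialgebra.counitAlgHom k B)).toLinearMap z (1 ⊗ₜ[k] m)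
      = (TensorProduct.rid k B ((Coalgebra.counit (R := k) (A := B)).lTensor B z)) ⊗ₜ[k] m := by
      intro z
      induction z with
      | zero => simp
      | add x y hx hy => simp only [map_add, LinearMap.add_apply, hx, hy, TensorProduct.add_tmul]
      | tmul x y => simp; rw [← smul_eq_mul, TensorProduct.tmul_smul, TensorProduct.smul_tmul']
    have key2 : ∀ z : B ⊗[k] B,
      (LinearMap.mul' k B).rTensor k (TensorProduct.rightComm k B k B
        ((TensorProduct.mk k B k 1 ∘ₗ ((Algebra.lmul k k).comp
          (Bialgebra.counitAlgHom k B)).toLinearMap.flip m).rTensor B z))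
      = (TensorProduct.lid k B ((Coalgebra.counit (R := k) (A := B)).rTensor B z)) ⊗ₜ[k] m := by
      intro z
      induction z with
      | zero => simp
      | add x y hx hy => simp only [map_add, hx, hy, TensorProduct.add_tmul]
      | tmul x y => simp; rw [← smul_eq_mul, TensorProduct.tmul_smul, TensorProduct.smul_tmul']
    rw [TensorProduct.mk_apply, key, key2]
    simp

section tensor
variable [YDModule k B M] [YDModule k B N]

/-- The diagonal action `b • (m ⊗ n) = b₁ • m ⊗ b₂ • n`. -/
def tensorAct (M N : Type*) [AddCommGroup M] [Module k M] [AddCommGroup N] [Module k N]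
    [YDModule k B M] [YDModule k B N] : B →ₐ[k] Module.End k (M ⊗[k] N) :=
  (Module.endTensorEndAlgHom.comp
    (Algebra.TensorProduct.map (act k B M) (act k B N))).comp (Bialgebra.comulAlgHom k B)

/-- The codiagonal coaction `m ⊗ n ↦ m₍₋₁₎ n₍₋₁₎ ⊗ (m₍₀₎ ⊗ n₍₀₎)`. -/
def tensorCoact (M N : Type*) [AddCommGroup M] [Module k M] [AddCommGroup N] [Module k N]
    [YDModule k B M] [YDModule k B N] : M ⊗[k] N →ₗ[k] B ⊗[k] (M ⊗[k] N) :=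
  TensorProduct.lift ((TensorProduct.map₂ (LinearMap.mul k B)
    (TensorProduct.mk k M N)).compl₁₂ (coact k B M) (coact k B N))

lemma tensorAct_tmul (b : B) (m : M) (n : N) : tensorAct B M N b (m ⊗ₜ[k] n) =
    TensorProduct.map ((act k B M).toLinearMap.flip m) ((act k B N).toLinearMap.flip n)
      (Coalgebra.comul (R := k) b) := by
  have : ∀ z : B ⊗[k] B, Module.endTensorEndAlgHom (R := k) (S := k) (A := k)
    (Algebra.TensorProduct.map (act k B M) (act k B N) z) (m ⊗ₜ[k] n) =
     TensorProduct.map ((act k B M).toLinearMap.flip m)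
      ((act k B N).toLinearMap.flip n) z := by
    intro z
    induction z with
    | zero => simp
    | add x y hx hy => simp only [map_add, hx, hy, LinearMap.add_apply]
    | tmul x y => simp [Module.endTensorEndAlgHom_apply]
  exact this _

lemma tensorCoact_tmul (m : M) (n : N) : tensorCoact B M N (m ⊗ₜ[k] n) =
    TensorProduct.map₂ (LinearMap.mul k B) (TensorProduct.mk k M N)
      (coact k B M m) (coact k B N n) := by
  simp [tensorCoact]

lemma tensorCoact_coassoc (t : M ⊗[k] N) : TensorProduct.assoc k B B (M ⊗[k] N)
    ((Coalgebra.comul (R := k) (A := B)).rTensor (M ⊗[k] N) (tensorCoact B M N t))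
    = (tensorCoact B M N).lTensor B (tensorCoact B M N t) := by
  have h1 : ∀ (z : B ⊗[k] M) (w : B ⊗[k] N), TensorProduct.assoc k B B (M ⊗[k] N)
      ((Coalgebra.comul (R := k) (A := B)).rTensor (M ⊗[k] N)
        (TensorProduct.map₂ (LinearMap.mul k B) (TensorProduct.mk k M N) z w))
      = TensorProduct.map₂ (LinearMap.mul k B)
          (TensorProduct.map₂ (LinearMap.mul k B) (TensorProduct.mk k M N))
          (TensorProduct.assoc k B B M ((Coalgebra.comul (R := k) (A := B)).rTensor M z))
          (TensorProduct.assoc k B B N ((Coalgebra.comul (R := k) (A := B)).rTensor N w)) := by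
    intro z w
    induction z with
    | zero => simp
    | add x y hx hy => simp only [map_add, hx, hy, LinearMap.add_apply]
    | tmul a m =>
      induction w with
      | zero => simp
      | add x y hx hy => simp only [map_add, hx, hy]
      | tmul c n =>
        simp only [TensorProduct.map₂_apply_tmul, TensorProduct.map_tmul, LinearMap.mul_apply', TensorProduct.mk_apply,
          LinearMap.rTensor_tmul, Bialgebra.comul_mul]
        generalize Coalgebra.comul (R := k) a = p
        generalize Coalgebra.comul (R := k) c = q
        induction p with
        | zero => simp
        | add x y hx hy =>
          simp only [map_add, hx, hy, LinearMap.add_apply, add_mul, TensorProduct.add_tmul]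
        | tmul a1 a2 =>
          induction q with
          | zero => simp
          | add x y hx hy => simp only [map_add, hx, hy, mul_add, TensorProduct.add_tmul]
          | tmul c1 c2 => simp
  have h2 : ∀ (z : B ⊗[k] M) (w : B ⊗[k] N), (tensorCoact B M N).lTensor B
        (TensorProduct.map₂ (LinearMap.mul k B) (TensorProduct.mk k M N) z w)
      = TensorProduct.map₂ (LinearMap.mul k B)
          (TensorProduct.map₂ (LinearMap.mul k B) (TensorProduct.mk k M N))
          ((coact k B M).lTensor B z) ((coact k B N).lTensor B w) := by
    intro z w
    induction z with
    | zero => simp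
    | add x y hx hy => simp only [map_add, hx, hy, LinearMap.add_apply]
    | tmul a m =>
      induction w with
      | zero => simp
      | add x y hx hy => simp only [map_add, hx, hy]
      | tmul c n => simp [tensorCoact_tmul]
  induction t with
  | zero => simp
  | add x y hx hy => simp only [map_add, hx, hy]
  | tmul m n =>
    rw [tensorCoact_tmul, h1, h2, YDModule.coassoc, YDModule.coassoc]

lemma tensorCoact_counit (t : M ⊗[k] N) :
    (Coalgebra.counit (R := k) (A := B)).rTensor (M ⊗[k] N) (tensorCoact B M N t)
    = 1 ⊗ₜ[k] t := by
  have h1 : ∀ (z : B ⊗[k] M) (w : B ⊗[k] N),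
      (Coalgebra.counit (R := k) (A := B)).rTensor (M ⊗[k] N)
        (TensorProduct.map₂ (LinearMap.mul k B) (TensorProduct.mk k M N) z w)
      = TensorProduct.map₂ (LinearMap.mul k k) (TensorProduct.mk k M N)
          ((Coalgebra.counit (R := k) (A := B)).rTensor M z)
          ((Coalgebra.counit (R := k) (A := B)).rTensor N w) := by
    intro z w
    induction z with
    | zero => simp
    | add x y hx hy => simp only [map_add, hx, hy, LinearMap.add_apply]
    | tmul a m =>
      induction w with
      | zero => simp
      | add x y hx hy => simp only [map_add, hx, hy]
      | tmul c n => simp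
  induction t with
  | zero => simp
  | add x y hx hy => simp only [map_add, hx, hy, TensorProduct.tmul_add]
  | tmul m n =>
    rw [tensorCoact_tmul, h1, YDModule.counit_coact, YDModule.counit_coact]
    simp

/-- Right-hand side of the compatibility condition, as a function of `b₁ ⊗ b₂`. -/
def compatR (P : Type*) [AddCommGroup P] [Module k P] [YDModule k B P] (p : P) :
    B ⊗[k] B →ₗ[k] B ⊗[k] P :=
  (LinearMap.mul' k B).rTensor P ∘ₗ (TensorProduct.rightComm k B P B).toLinearMap ∘ₗ
    ((coact k B P) ∘ₗ (act k B P).toLinearMap.flip p).rTensor B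

/-- Left-hand side of the compatibility condition. -/
abbrev compatL (P : Type*) [AddCommGroup P] [Module k P] [YDModule k B P] :
    B ⊗[k] B →ₗ[k] B ⊗[k] P →ₗ[k] B ⊗[k] P :=
  TensorProduct.map₂ (LinearMap.mul k B) (act k B P).toLinearMap

lemma compat' (P : Type*) [AddCommGroup P] [Module k P] [YDModule k B P] (b : B) (p : P) :
    compatL B P (Coalgebra.comul (R := k) b) (coact k B P p)
      = compatR B P p (Coalgebra.comul (R := k) b) := YDModule.compat b p

lemma compatR_tmul (P : Type*) [AddCommGroup P] [Module k P] [YDModule k B P] (p : P) (x y : B) :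
    compatR B P p (x ⊗ₜ[k] y)
      = (LinearMap.mulRight k y).rTensor P (coact k B P (act k B P x p)) := by
  simp only [compatR, LinearMap.comp_apply, LinearMap.rTensor_tmul, LinearEquiv.coe_coe,
    LinearMap.flip_apply, AlgHom.toLinearMap_apply]
  generalize coact k B P (act k B P x p) = z
  induction z with
  | zero => simp
  | add x y hx hy => simp only [map_add, hx, hy, TensorProduct.add_tmul]
  | tmul a q => simp

lemma tensor_compat (b : B) (t : M ⊗[k] N) :
    TensorProduct.map₂ (LinearMap.mul k B) (tensorAct B M N).toLinearMap
      (Coalgebra.comul (R := k) b) (tensorCoact B M N t)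
    = (LinearMap.mul' k B).rTensor (M ⊗[k] N) (TensorProduct.rightComm k B (M ⊗[k] N) B
        ((tensorCoact B M N ∘ₗ (tensorAct B M N).toLinearMap.flip t).rTensor B
          (Coalgebra.comul (R := k) b))) := by
  induction t with
  | zero => simp
  | add x y hx hy =>
    have e : (tensorCoact B M N ∘ₗ (tensorAct B M N).toLinearMap.flip (x + y))
      = (tensorCoact B M N ∘ₗ (tensorAct B M N).toLinearMap.flip x)
        + (tensorCoact B M N ∘ₗ (tensorAct B M N).toLinearMap.flip y) := by
      ext; simp
    rw [e]
    simp only [map_add, hx, hy, LinearMap.rTensor_add, LinearMap.add_apply]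
  | tmul m n =>
    let G := TensorProduct.map₂ (LinearMap.mul k B) (TensorProduct.mk k M N)
    let F1 : (B ⊗[k] B) ⊗[k] B →ₗ[k] B ⊗[k] (M ⊗[k] N) := TensorProduct.lift
      (G.compl₁₂ ((compatL B M).flip (coact k B M m))
        ((compatL B N).flip (coact k B N n) ∘ₗ TensorProduct.mk k B B 1))
    let F1' : (B ⊗[k] B) ⊗[k] B →ₗ[k] B ⊗[k] (M ⊗[k] N) := TensorProduct.lift
      (G.compl₁₂ (compatR B M m)
        ((compatL B N).flip (coact k B N n) ∘ₗ TensorProduct.mk k B B 1))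
    let F2 : B ⊗[k] (B ⊗[k] B) →ₗ[k] B ⊗[k] (M ⊗[k] N) := TensorProduct.lift
      (G.compl₁₂ (coact k B M ∘ₗ (act k B M).toLinearMap.flip m)
        ((compatL B N).flip (coact k B N n)))
    let F2' : B ⊗[k] (B ⊗[k] B) →ₗ[k] B ⊗[k] (M ⊗[k] N) := TensorProduct.lift
      (G.compl₁₂ (coact k B M ∘ₗ (act k B M).toLinearMap.flip m) (compatR B N n))
    set δ : B →ₗ[k] B ⊗[k] B := Coalgebra.comul (R := k) with hδ
    -- left-hand side
    have hA : ∀ p : B ⊗[k] B, TensorProduct.map₂ (LinearMap.mul k B) (tensorAct B M N).toLinearMap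
        p (tensorCoact B M N (m ⊗ₜ n))
        = F1 ((TensorProduct.assoc k B B B).symm (δ.lTensor B p)) := by
      intro p
      rw [tensorCoact_tmul]
      simp only [F1]
      generalize coact k B M m = z
      generalize coact k B N n = u
      induction p with
      | zero => simp
      | add x y hx hy => simp only [map_add, LinearMap.add_apply, hx, hy]
      | tmul x y =>
        rw [LinearMap.lTensor_tmul]
        induction z with
        | zero =>
          generalize δ y = q
          induction q with
          | zero => simp
          | add q r hq hr =>
            simp only [map_zero, LinearMap.zero_apply, map_add, TensorProduct.tmul_add] at *
            rw [← hq, ← hr, add_zero]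
          | tmul q r => simp
        | add z1 z2 h1 h2 =>
          rw [map_add, LinearMap.add_apply, map_add, h1, h2]
          generalize δ y = q
          induction q with
          | zero => simp
          | add q r hq hr =>
            simp only [map_add, TensorProduct.tmul_add] at *
            rw [← hq, ← hr]; abel
          | tmul q r => simp [G]
        | tmul c m =>
          induction u with
          | zero =>
            generalize δ y = q
            induction q with
            | zero => simp
            | add q r hq hr =>
              simp only [map_zero, map_add, TensorProduct.tmul_add] at *
              rw [← hq, ← hr, add_zero]
            | tmul q r => simp
          | add z1 z2 h1 h2 =>
            rw [map_add, map_add, h1, h2]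
            generalize δ y = q
            induction q with
            | zero => simp
            | add q r hq hr =>
              simp only [map_add, TensorProduct.tmul_add] at *
              rw [← hq, ← hr]; abel
            | tmul q r => simp [G]
          | tmul d n =>
            simp only [TensorProduct.map₂_apply_tmul, TensorProduct.map_tmul,
              AlgHom.toLinearMap_apply, TensorProduct.mk_apply]
            rw [tensorAct_tmul]
            change _ ⊗ₜ TensorProduct.map _ _ (δ y) = _
            generalize δ y = q
            induction q with
            | zero => simp
            | add q r hq hr => simp only [map_add, TensorProduct.tmul_add, hq, hr]
            | tmul q r => simp [G, mul_assoc]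
    have hB : ∀ p : B ⊗[k] B, F1 (δ.rTensor B p) = F1' (δ.rTensor B p) := by
      intro p
      induction p with
      | zero => simp
      | add x y hx hy => simp only [map_add, hx, hy]
      | tmul x y =>
        simp only [F1, F1', LinearMap.rTensor_tmul, TensorProduct.lift.tmul,
          LinearMap.compl₁₂_apply, LinearMap.flip_apply]
        rw [hδ, compat']
    have hC : ∀ q : B ⊗[k] (B ⊗[k] B),
        F1' ((TensorProduct.assoc k B B B).symm q) = F2 q := by
      intro q
      induction q with
      | zero => simp
      | add x y hx hy => simp only [map_add, hx, hy]
      | tmul x q =>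
        induction q with
        | zero => simp
        | add y z hy hz => simp only [map_add, TensorProduct.tmul_add, hy, hz]
        | tmul y w =>
          simp only [F1', F2, TensorProduct.assoc_symm_tmul, TensorProduct.lift.tmul,
            LinearMap.compl₁₂_apply, LinearMap.flip_apply, compatR_tmul, LinearMap.comp_apply,
            TensorProduct.mk_apply, AlgHom.toLinearMap_apply]
          generalize coact k B M _ = z
          generalize coact k B N _ = u
          induction z with
          | zero => simp
          | add x y hx hy => simp only [map_add, LinearMap.add_apply, hx, hy]
          | tmul c m =>
            induction u with
            | zero => simp
            | add x y hx hy => simp only [map_add, hx, hy]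
            | tmul d n => simp [G, mul_assoc]
    have hD : ∀ p : B ⊗[k] B, F2 (δ.lTensor B p) = F2' (δ.lTensor B p) := by
      intro p
      induction p with
      | zero => simp
      | add x y hx hy => simp only [map_add, hx, hy]
      | tmul x y =>
        simp only [F2, F2', LinearMap.lTensor_tmul, TensorProduct.lift.tmul,
          LinearMap.compl₁₂_apply, LinearMap.flip_apply]
        rw [hδ, compat']
    have hE : ∀ p : B ⊗[k] B, F2' (TensorProduct.assoc k B B B (δ.rTensor B p))
        = (LinearMap.mul' k B).rTensor (M ⊗[k] N) (TensorProduct.rightComm k B (M ⊗[k] N) B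
        ((tensorCoact B M N ∘ₗ (tensorAct B M N).toLinearMap.flip (m ⊗ₜ n)).rTensor B p)) := by
      intro p
      induction p with
      | zero => simp
      | add x y hx hy => simp only [map_add, hx, hy]
      | tmul x y =>
        simp only [LinearMap.rTensor_tmul, LinearMap.comp_apply, LinearMap.flip_apply,
          AlgHom.toLinearMap_apply]
        rw [tensorAct_tmul]
        change _ = (LinearMap.mul' k B).rTensor (M ⊗[k] N) (TensorProduct.rightComm k B
          (M ⊗[k] N) B (tensorCoact B M N (TensorProduct.map _ _ (δ x)) ⊗ₜ y))
        generalize δ x = q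
        induction q with
        | zero => simp
        | add q r hq hr => simp only [map_add, TensorProduct.add_tmul, hq, hr]
        | tmul q r =>
          simp only [F2', TensorProduct.assoc_tmul, TensorProduct.lift.tmul,
            LinearMap.compl₁₂_apply, LinearMap.comp_apply, LinearMap.flip_apply, compatR_tmul,
            AlgHom.toLinearMap_apply, TensorProduct.map_tmul, tensorCoact_tmul]
          generalize coact k B M _ = z
          generalize coact k B N _ = u
          induction z with
          | zero => simp
          | add x y hx hy =>
            simp only [map_add, LinearMap.add_apply, TensorProduct.add_tmul, hx, hy]
          | tmul c m =>
            induction u with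
            | zero => simp
            | add x y hx hy => simp only [map_add, TensorProduct.add_tmul, hx, hy]
            | tmul d n => simp [G, mul_assoc]
    rw [hA, hδ, ← Coalgebra.coassoc_apply, LinearEquiv.symm_apply_apply, ← hδ, hB,
      ← (TensorProduct.assoc k B B B).symm_apply_apply (δ.rTensor B (δ b)), hC, hδ,
      Coalgebra.coassoc_apply, ← hδ, hD, hδ, ← Coalgebra.coassoc_apply, ← hδ, hE]

instance tensorYDModule : YDModule k B (M ⊗[k] N) where
  act := tensorAct B M N
  coact := tensorCoact B M N
  coassoc := tensorCoact_coassoc B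
  counit_coact := tensorCoact_counit B
  compat := tensor_compat B

end tensor
end modules

/-- The braiding `C : M ⊗ N → N ⊗ M`, `m ⊗ n ↦ m₍₋₁₎ • n ⊗ m₍₀₎`. -/
def braiding (M N : Type*) [AddCommGroup M] [Module k M] [AddCommGroup N] [Module k N]
    [YDModule k B M] [YDModule k B N] : M ⊗[k] N →ₗ[k] N ⊗[k] M :=
  (TensorProduct.lift (act k B N).toLinearMap).rTensor M
    ∘ₗ (TensorProduct.rightComm k B M N).toLinearMap
    ∘ₗ (coact k B M).rTensor N

/-- `W ⊗ τ ⊗ Z : (W ⊗ X) ⊗ (Y ⊗ Z) → (W ⊗ Y) ⊗ (X ⊗ Z)` for `τ : X ⊗ Y → Y ⊗ X`. -/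
def midMap (W : Type*) {X Y : Type*} (Z : Type*) [AddCommGroup W] [Module k W]
    [AddCommGroup X] [Module k X] [AddCommGroup Y] [Module k Y] [AddCommGroup Z] [Module k Z]
    (τ : X ⊗[k] Y →ₗ[k] Y ⊗[k] X) :
    (W ⊗[k] X) ⊗[k] (Y ⊗[k] Z) →ₗ[k] (W ⊗[k] Y) ⊗[k] (X ⊗[k] Z) :=
  (TensorProduct.assoc k W Y (X ⊗[k] Z)).symm.toLinearMap
    ∘ₗ ((TensorProduct.assoc k Y X Z).toLinearMap ∘ₗ τ.rTensor Z
        ∘ₗ (TensorProduct.assoc k X Y Z).symm.toLinearMap).lTensor W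
    ∘ₗ (TensorProduct.assoc k W X (Y ⊗[k] Z)).toLinearMap

/-! ### Algebras -/

/-- A multiplication and a candidate for the unit on a vector space. -/
structure AlgStr (k A : Type*) [Field k] [AddCommGroup A] [Module k A] where
  /-- multiplication -/
  mul : A ⊗[k] A →ₗ[k] A
  /-- unit -/
  one : A

/-- `X` is an associative unital `k`-algebra structure. -/
structure AlgStr.IsAlgebra {A : Type*} [AddCommGroup A] [Module k A] (X : AlgStr k A) :
    Prop where
  mul_assoc : ∀ a b c : A, X.mul (X.mul (a ⊗ₜ b) ⊗ₜ c) = X.mul (a ⊗ₜ X.mul (b ⊗ₜ c))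
  one_mul : ∀ a : A, X.mul (X.one ⊗ₜ a) = a
  mul_one : ∀ a : A, X.mul (a ⊗ₜ X.one) = a

/-- `X` is an algebra in the category of Yetter-Drinfeld modules over `B`. -/
structure AlgStr.IsYDAlgebra {A : Type*} [AddCommGroup A] [Module k A] [YDModule k B A]
    (X : AlgStr k A) : Prop extends X.IsAlgebra where
  mul_hom : IsYDHom B X.mul
  one_hom : IsYDHom B (LinearMap.toSpanSingleton k A X.one)

/-- The product `(a ⊗ x)(a' ⊗ x') = a τ(x ⊗ a') x'` on `A ⊗ A'` given by `τ : A' ⊗ A → A ⊗ A'`. -/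
def AlgStr.twisted {A A' : Type*} [AddCommGroup A] [Module k A] [AddCommGroup A'] [Module k A']
    (X : AlgStr k A) (Y : AlgStr k A') (τ : A' ⊗[k] A →ₗ[k] A ⊗[k] A') :
    AlgStr k (A ⊗[k] A') where
  mul := TensorProduct.map X.mul Y.mul ∘ₗ midMap A A' τ
  one := X.one ⊗ₜ Y.one

/-- The braided tensor product of two algebras in the category of Yetter-Drinfeld modules. -/
def AlgStr.tensor {A A' : Type*} [AddCommGroup A] [Module k A] [AddCommGroup A'] [Module k A']
    [YDModule k B A] [YDModule k B A'] (X : AlgStr k A) (Y : AlgStr k A') :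
    AlgStr k (A ⊗[k] A') :=
  X.twisted Y (braiding B A' A)

/-! ### Braided Hopf algebras -/

/-- A braided Hopf algebra, i.e. a Hopf algebra in the category of Yetter-Drinfeld modules. -/
structure BraidedHopfAlgebra (k B H : Type*) [Field k] [Ring B] [HopfAlgebra k B]
    [AddCommGroup H] [Module k H] [YDModule k B H] extends AlgStr k H where
  isYDAlgebra : toAlgStr.IsYDAlgebra B
  /-- comultiplication -/
  comul : H →ₗ[k] H ⊗[k] H
  /-- counit -/
  counit : H →ₗ[k] k
  /-- antipode -/
  antipode : H →ₗ[k] H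
  comul_hom : IsYDHom B comul
  counit_hom : IsYDHom B counit
  antipode_hom : IsYDHom B antipode
  coassoc : ∀ x : H,
    TensorProduct.assoc k H H H (comul.rTensor H (comul x)) = comul.lTensor H (comul x)
  counit_comul : ∀ x : H, counit.rTensor H (comul x) = 1 ⊗ₜ x
  comul_counit : ∀ x : H, counit.lTensor H (comul x) = x ⊗ₜ 1
  comul_mul : ∀ t : H ⊗[k] H,
    comul (mul t) = (toAlgStr.tensor B toAlgStr).mul (TensorProduct.map comul comul t)
  comul_one : comul one = one ⊗ₜ one
  counit_mul : ∀ x y : H, counit (mul (x ⊗ₜ y)) = counit x * counit y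
  counit_one : counit one = 1
  antipode_comul : ∀ x : H, mul (antipode.rTensor H (comul x)) = counit x • one
  comul_antipode : ∀ x : H, mul (antipode.lTensor H (comul x)) = counit x • one

section hopf
variable {B}
variable {D H : Type*} [AddCommGroup D] [Module k D] [YDModule k B D]
  [AddCommGroup H] [Module k H] [YDModule k B H]
variable (𝓓 : BraidedHopfAlgebra k B D) (𝓗 : BraidedHopfAlgebra k B H)

/-- `(⟨,⟩ ⊗ ⟨,⟩)(D ⊗ C ⊗ H) : (D ⊗ D) ⊗ (H ⊗ H) → k` for a pairing `⟨,⟩ : D ⊗ H → k`. -/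
def pairing₂ (p : D ⊗[k] H →ₗ[k] k) : (D ⊗[k] D) ⊗[k] (H ⊗[k] H) →ₗ[k] k :=
  (TensorProduct.lid k k).toLinearMap ∘ₗ TensorProduct.map p p ∘ₗ midMap D H (braiding B D H)

/-- The duality equations between the Hopf structures of `D` and `H` under a pairing
`⟨,⟩ : D ⊗ H → k`. -/
structure IsHopfPairing (p : D ⊗[k] H →ₗ[k] k) : Prop where
  pair_mul : ∀ (f : D) (x y : H),
    p (f ⊗ₜ 𝓗.mul (x ⊗ₜ y)) = pairing₂ (B := B) p (𝓓.comul f ⊗ₜ (x ⊗ₜ y))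
  pair_one : ∀ f : D, p (f ⊗ₜ 𝓗.one) = 𝓓.counit f
  mul_pair : ∀ (f g : D) (x : H),
    p (𝓓.mul (f ⊗ₜ g) ⊗ₜ x) = pairing₂ (B := B) p ((f ⊗ₜ g) ⊗ₜ 𝓗.comul x)
  one_pair : ∀ x : H, p (𝓓.one ⊗ₜ x) = 𝓗.counit x
  antipode_pair : ∀ (f : D) (x : H), p (𝓓.antipode f ⊗ₜ x) = p (f ⊗ₜ 𝓗.antipode x)

/-- The action `⇀ = (H ⊗ ⟨,⟩)(C ⊗ H)(D ⊗ Δ)` of `D` on `H`. -/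
def hit (p : D ⊗[k] H →ₗ[k] k) : D ⊗[k] H →ₗ[k] H :=
  (TensorProduct.rid k H).toLinearMap ∘ₗ p.lTensor H
    ∘ₗ (TensorProduct.assoc k H D H).toLinearMap
    ∘ₗ (braiding B D H).rTensor H
    ∘ₗ (TensorProduct.assoc k D H H).symm.toLinearMap
    ∘ₗ 𝓗.comul.lTensor D

/-- `λ(h # f)(x) = (m ⊗ ⟨,⟩)(H ⊗ C ⊗ H)(H ⊗ D ⊗ Δ)(h ⊗ f ⊗ x)`, as a map `(H ⊗ D) ⊗ H → H`. -/
def lam (p : D ⊗[k] H →ₗ[k] k) : (H ⊗[k] D) ⊗[k] H →ₗ[k] H :=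
  (TensorProduct.rid k H).toLinearMap ∘ₗ TensorProduct.map 𝓗.mul p
    ∘ₗ midMap H H (braiding B D H) ∘ₗ 𝓗.comul.lTensor (H ⊗[k] D)

/-- `ρ(f # h)(x) = (⟨,⟩ ⊗ m)(D ⊗ H ⊗ C)(D ⊗ C ⊗ H)(D ⊗ H ⊗ Δ)(f ⊗ h ⊗ x)`, as a map
`(D ⊗ H) ⊗ H → H`. -/
def rho (p : D ⊗[k] H →ₗ[k] k) : (D ⊗[k] H) ⊗[k] H →ₗ[k] H :=
  (TensorProduct.lid k H).toLinearMap ∘ₗ TensorProduct.map p (𝓗.mul ∘ₗ braiding B H H)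
    ∘ₗ midMap D H (braiding B H H) ∘ₗ 𝓗.comul.lTensor (D ⊗[k] H)

/-- The `RL`-condition `ρ(D # 1) ⊆ λ(H # D)` inside `End_k H`. -/
def RLCondition (p : D ⊗[k] H →ₗ[k] k) : Prop :=
  ∀ f : D, ∃ t : H ⊗[k] D, ∀ x : H, rho 𝓗 p ((f ⊗ₜ 𝓗.one) ⊗ₜ x) = lam 𝓗 p (t ⊗ₜ x)

/-! ### Comodule algebras, module algebras and smash products -/

variable {R : Type*} [AddCommGroup R] [Module k R] [YDModule k B R]

/-- `(X, ψ)` is a right `D`-comodule algebra in the category of Yetter-Drinfeld modules. -/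
structure IsComoduleAlgebra (X : AlgStr k R) (ψ : R →ₗ[k] R ⊗[k] D) : Prop where
  isYDAlgebra : X.IsYDAlgebra B
  hom : IsYDHom B ψ
  coassoc : ∀ r : R, TensorProduct.assoc k R D D (ψ.rTensor D (ψ r)) = 𝓓.comul.lTensor R (ψ r)
  counit : ∀ r : R, 𝓓.counit.lTensor R (ψ r) = r ⊗ₜ 1
  map_mul : ∀ t : R ⊗[k] R,
    ψ (X.mul t) = (X.tensor B 𝓓.toAlgStr).mul (TensorProduct.map ψ ψ t)
  map_one : ψ X.one = X.one ⊗ₜ 𝓓.one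

/-- `(X, α)` is a left `H`-module algebra in the category of Yetter-Drinfeld modules. -/
structure IsModuleAlgebra (X : AlgStr k R) (α : H ⊗[k] R →ₗ[k] R) : Prop where
  isYDAlgebra : X.IsYDAlgebra B
  hom : IsYDHom B α
  one_act : ∀ r : R, α (𝓗.one ⊗ₜ r) = r
  mul_act : ∀ (x y : H) (r : R), α (𝓗.mul (x ⊗ₜ y) ⊗ₜ r) = α (x ⊗ₜ α (y ⊗ₜ r))
  act_mul : ∀ (x : H) (t : R ⊗[k] R), α (x ⊗ₜ X.mul t)
    = X.mul (TensorProduct.map α α (midMap H R (braiding B H R) (𝓗.comul x ⊗ₜ t)))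
  act_one : ∀ x : H, α (x ⊗ₜ X.one) = 𝓗.counit x • X.one

/-- The smash product `R # H` of `R` with `H` acting by `α`: the vector space `R ⊗ H` with product
`(r # x)(s # y) = r (x₁ ⇀ s') # x₂' y`, where `s' ⊗ x₂' = C(x₂ ⊗ s)`. -/
def smash (X : AlgStr k R) (α : H ⊗[k] R →ₗ[k] R) : AlgStr k (R ⊗[k] H) :=
  X.twisted 𝓗.toAlgStr
    (α.rTensor H ∘ₗ (TensorProduct.assoc k H R H).symm.toLinearMap
      ∘ₗ (braiding B H R).lTensor H ∘ₗ (TensorProduct.assoc k H H R).toLinearMap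
      ∘ₗ 𝓗.comul.rTensor R)

/-- The action `(R ⊗ ⟨,⟩)(R ⊗ C_{H,D})(C_{H,R} ⊗ D)(H ⊗ ψ)` of `H` on a right `D`-comodule. -/
def coactionToAction (p : D ⊗[k] H →ₗ[k] k) (ψ : R →ₗ[k] R ⊗[k] D) : H ⊗[k] R →ₗ[k] R :=
  (TensorProduct.rid k R).toLinearMap ∘ₗ (p ∘ₗ braiding B H D).lTensor R
    ∘ₗ (TensorProduct.assoc k R H D).toLinearMap
    ∘ₗ (braiding B H R).rTensor D
    ∘ₗ (TensorProduct.assoc k H R D).symm.toLinearMap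
    ∘ₗ ψ.lTensor H

/-- The action `(R ⊗ β)(C_{D,R} ⊗ H)` of `D` on `R ⊗ H`, trivial on `R` and by `β` on `H`. -/
def actRight (R : Type*) [AddCommGroup R] [Module k R] [YDModule k B R]
    (β : D ⊗[k] H →ₗ[k] H) : D ⊗[k] (R ⊗[k] H) →ₗ[k] R ⊗[k] H :=
  β.lTensor R ∘ₗ (TensorProduct.assoc k R D H).toLinearMap
    ∘ₗ (braiding B D R).rTensor H ∘ₗ (TensorProduct.assoc k D R H).symm.toLinearMap

/-! ### Finite duals and braided Hopf subalgebras -/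

/-- `I` is an ideal of `H` in the category of Yetter-Drinfeld modules: a two-sided ideal which is
a `B`-submodule and a `B`-subcomodule. -/
structure IsYDIdeal (I : Submodule k H) : Prop where
  mul_mem_left : ∀ x : H, ∀ y ∈ I, 𝓗.mul (x ⊗ₜ y) ∈ I
  mul_mem_right : ∀ x : H, ∀ y ∈ I, 𝓗.mul (y ⊗ₜ x) ∈ I
  act_mem : ∀ b : B, ∀ y ∈ I, act k B H b y ∈ I
  coact_mem : ∀ y ∈ I, coact k B H y ∈ LinearMap.range (I.subtype.lTensor B)

/-- The finite dual `H°`: functionals whose kernel contains an ideal of `H`, in the category of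
Yetter-Drinfeld modules, of finite codimension. -/
def finiteDual : Set (Module.Dual k H) :=
  {f | ∃ I : Submodule k H, IsYDIdeal 𝓗 I ∧ FiniteDimensional k (H ⧸ I) ∧ I ≤ LinearMap.ker f}

variable {U V : Type*} [AddCommGroup U] [Module k U] [AddCommGroup V] [Module k V]

/-- The embedding `ι : U → H*` identifies `𝓤` with a braided Hopf subalgebra of `H°`.
The Yetter-Drinfeld structure is the one of `H*`, given by `(b • f)(x) = f (S(b) • x)` and
`f₍₋₁₎ f₍₀₎(x) = S⁻¹(x₍₋₁₎) f(x₍₀₎)` (to which `S` is applied on both sides below), and the Hopf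
structure is the one dual to that of `H` under the evaluation pairing `U ⊗ H → k`. -/
structure IsHopfSubalgebraOfFiniteDual [YDModule k B U] (𝓤 : BraidedHopfAlgebra k B U)
    (ι : U →ₗ[k] Module.Dual k H) : Prop where
  injective : Function.Injective ι
  mem_finiteDual : ∀ u : U, ι u ∈ finiteDual 𝓗
  act_apply : ∀ (b : B) (u : U) (x : H),
    ι (act k B U b u) x = ι u (act k B H (HopfAlgebra.antipode k b) x)
  coact_apply : ∀ (u : U) (x : H),
    TensorProduct.rid k B (TensorProduct.map (HopfAlgebra.antipode k (A := B))
      (Module.Dual.eval k H x ∘ₗ ι) (coact k B U u))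
    = TensorProduct.rid k B ((ι u).lTensor B (coact k B H x))
  pairing : IsHopfPairing 𝓤 𝓗 (TensorProduct.lift ι)

/-- The embedding `j : V → H` identifies `𝓥` with a braided Hopf subalgebra of `H`. -/
structure IsHopfSubalgebra [YDModule k B V] (𝓥 : BraidedHopfAlgebra k B V)
    (j : V →ₗ[k] H) : Prop where
  injective : Function.Injective j
  hom : IsYDHom B j
  map_mul : ∀ v w : V, j (𝓥.mul (v ⊗ₜ w)) = 𝓗.mul (j v ⊗ₜ j w)
  map_one : j 𝓥.one = 𝓗.one
  map_comul : ∀ v : V, TensorProduct.map j j (𝓥.comul v) = 𝓗.comul (j v)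
  map_counit : ∀ v : V, 𝓥.counit v = 𝓗.counit (j v)
  map_antipode : ∀ v : V, j (𝓥.antipode v) = 𝓗.antipode (j v)

/-- The image of `ι : U → H*` is dense in `H*` for the finite topology, in which `f` has the
neighbourhood basis `{g | g = f on F}`, `F ⊆ H` finite. -/
def IsDenseInDual (ι : U →ₗ[k] Module.Dual k H) : Prop :=
  ∀ (f : Module.Dual k H) (F : Finset H), ∃ u : U, ∀ x ∈ F, ι u x = f x

/-- The pairing `⟨,⟩ = ⟨,⟩_ev C_{V,U} : V ⊗ U → k`. -/
def evalBraidPairing (B : Type*) [Ring B] [HopfAlgebra k B] [YDModule k B U] [YDModule k B V]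
    (ι : U →ₗ[k] Module.Dual k H) (j : V →ₗ[k] H) : V ⊗[k] U →ₗ[k] k :=
  TensorProduct.lift ι ∘ₗ j.lTensor U ∘ₗ braiding B V U

end hopf

end YD

end

/-! In `(R # U) # V` the algebra `R` can be replaced by a copy of itself that commutes, up to the
braiding, with `U # V`; this untwists the product.

After reassociation, `(R # U) # V` is `R ⊗ (U # V)` with a twisted product: to multiply, `R` is
moved past `V` by the braiding and past `U` by the smash product twist (`assoc_smash_smash_mul`).
The correction comes from the `RL`-condition. The algebra `U # V` acts on `U` by `λ`, and the
operator `x ↦ ⟨v, x₁⟩ x₂` is `λ(w(v))` for some `w(v)` in `U # V`. The action is faithful: the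
inverse antipode of `U` recovers `u⟨v, x⟩` from `λ(u # v)`, and density of `U` makes the pairing
nondegenerate on `V` (`eq_zero_of_lam`). Hence `w` is a well-defined linear map, it is a morphism of
Yetter-Drinfeld modules because `λ` and the operators are (`exists_lift_of_RLCondition`), and
identities in `U # V` can be tested on `U`. Up to braidings this gives `w(v) w(v') = w(v' v)`, `(1 #
v) w(v') = w(v') (1 # v)`, `w(v) (u # 1) = ⟨v₁, u₁⟩ (u₂ # 1) w(v₂)` (`op12_lift_mul`,
`opMul_one_lift`, `opMul_lift_left`).

The last two identities say that every `t` in `U # V` braided-commutes with `r₀ w(r₁)`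
(`opMul_smashTwist_lift`); with the first, `r ↦ r₀ w(r₁)` is multiplicative. So the shear `r ⊗ c ↦
r₀ ⊗ w(r₁) c` carries the braided tensor product to the twisted product (`opTwist_op22_shear`).
Since `w` reverses products, its inverse is the shear by `w ∘ S⁻¹`. The isomorphism is this inverse
composed with the associator, and every ingredient is a morphism.

The module algebra statements are three instances of one fact (`isModuleAlgebra_actionOfCoaction`):
a comodule algebra over `H` is a module algebra over anything paired with `H`. It is applied to `ψ`,
to the comultiplication of `U`, and to the coaction of `U` on `R # U`.

Two facts support this. The antipode of the finite-dimensional `B` is bijective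
(`HopfAlgebra.antipode_bijective`), proved with a nonzero integral obtained as a trace. And `C² =
id` on `H ⊗ H` spreads to all pairs formed from `U` and `V`, by naturality along `j` and by
nondegenerate evaluation (`Symmetric.of_injective`, `Symmetric.of_pairing`).

Computations are made with string diagrams written as words of operations on right-bracketed tensor
products with an arbitrary tail. The classes `Rw` and `Rw₃` orient the diagrammatic moves, so that
simplification with `Rw.eq` brings diagrams to a normal form. -/

open scoped TensorProduct

noncomputable section

namespace YD

attribute [local instance 1100] AddCommGroup.toAddCommMonoid
attribute [local instance 1200] TensorProduct.addCommMonoid LinearMap.addCommMonoid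

/-- A shortcut for instance search. -/
local instance (priority := 1200) fieldAddCommMonoid {k : Type*} [Field k] : AddCommMonoid k :=
  NonUnitalNonAssocSemiring.toAddCommMonoid

/-! ### Morphisms of Yetter-Drinfeld modules and the braiding -/

section homs
variable {k : Type*} [Field k] {B : Type*} [Ring B] [HopfAlgebra k B]
variable {M N P Q : Type*} [AddCommGroup M] [Module k M] [YDModule k B M]
  [AddCommGroup N] [Module k N] [YDModule k B N] [AddCommGroup P] [Module k P] [YDModule k B P]
  [AddCommGroup Q] [Module k Q] [YDModule k B Q]

lemma act_tmul (b : B) (m : M) (n : N) : act k B (M ⊗[k] N) b (m ⊗ₜ n) =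
    TensorProduct.map ((act k B M).toLinearMap.flip m) ((act k B N).toLinearMap.flip n)
      (Coalgebra.comul (R := k) b) := tensorAct_tmul B b m n

lemma coact_tmul (m : M) (n : N) : coact k B (M ⊗[k] N) (m ⊗ₜ n) =
    TensorProduct.map₂ (LinearMap.mul k B) (TensorProduct.mk k M N)
      (coact k B M m) (coact k B N n) := tensorCoact_tmul B m n

lemma act_unit (b : B) (a : k) : act k B k b a = Coalgebra.counit (R := k) b * a := rfl

lemma coact_unit (a : k) : coact k B k a = 1 ⊗ₜ a := rfl

lemma coact_coassoc (m : M) : TensorProduct.assoc k B B M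
    ((Coalgebra.comul (R := k) (A := B)).rTensor M (coact k B M m))
    = (coact k B M).lTensor B (coact k B M m) := YDModule.coassoc m

lemma braiding_tmul (m : M) (n : N) : braiding B M N (m ⊗ₜ[k] n) =
    ((act k B N).toLinearMap.flip n).rTensor M (coact k B M m) := by
  simp only [braiding, LinearMap.comp_apply, LinearMap.rTensor_tmul, LinearEquiv.coe_coe]
  generalize coact k B M m = z
  induction z with
  | zero => simp
  | add x y hx hy => simp only [map_add, TensorProduct.add_tmul, hx, hy]
  | tmul b m => simp

namespace IsYDHom

lemma id : IsYDHom B (LinearMap.id : M →ₗ[k] M) := ⟨fun _ _ => rfl, fun _ => by simp⟩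

lemma comp {g : N →ₗ[k] P} {f : M →ₗ[k] N} (hg : IsYDHom B g) (hf : IsYDHom B f) :
    IsYDHom B (g ∘ₗ f) :=
  ⟨fun b m => by simp [hf.map_act, hg.map_act],
   fun m => by simp [hf.map_coact, hg.map_coact, LinearMap.lTensor_comp]⟩

lemma symm {e : M ≃ₗ[k] N} (he : IsYDHom B e.toLinearMap) : IsYDHom B e.symm.toLinearMap := by
  constructor
  · intro b m
    apply e.injective
    have := he.map_act b (e.symm m)
    simp only [LinearEquiv.coe_coe, LinearEquiv.apply_symm_apply] at this ⊢
    rw [this]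
  · intro m
    have := he.map_coact (e.symm m)
    simp only [LinearEquiv.coe_coe, LinearEquiv.apply_symm_apply] at this ⊢
    rw [this, ← LinearMap.comp_apply, ← LinearMap.lTensor_comp]
    simp

lemma map {f : M →ₗ[k] N} {g : P →ₗ[k] Q} (hf : IsYDHom B f) (hg : IsYDHom B g) :
    IsYDHom B (TensorProduct.map f g) := by
  constructor
  · intro b t
    induction t with
    | zero => simp
    | add x y hx hy => simp only [map_add, hx, hy]
    | tmul m p =>
      rw [act_tmul, TensorProduct.map_tmul, act_tmul]
      generalize Coalgebra.comul (R := k) b = z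
      induction z with
      | zero => simp
      | add x y hx hy => simp only [map_add, hx, hy]
      | tmul x y => simp [hf.map_act, hg.map_act]
  · intro t
    induction t with
    | zero => simp
    | add x y hx hy => simp only [map_add, hx, hy]
    | tmul m p =>
      rw [TensorProduct.map_tmul, coact_tmul, coact_tmul, hf.map_coact, hg.map_coact]
      generalize coact k B M m = z
      generalize coact k B P p = w
      induction z with
      | zero => simp
      | add x y hx hy => simp only [map_add, hx, hy, LinearMap.add_apply]
      | tmul a m =>
        induction w with
        | zero => simp
        | add x y hx hy => simp only [map_add, hx, hy]
        | tmul c n => simp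

lemma rTensor {f : M →ₗ[k] N} (hf : IsYDHom B f) : IsYDHom B (f.rTensor P) := hf.map .id

lemma lTensor {f : M →ₗ[k] N} (hf : IsYDHom B f) : IsYDHom B (f.lTensor P) :=
  (IsYDHom.id (M := P)).map hf

/-- Compatibility with the action is coassociativity of `B`; compatibility with the coaction is
associativity of `B`. -/
lemma assoc : IsYDHom B (TensorProduct.assoc k M N P).toLinearMap := by
  constructor
  · intro b t
    induction t with
    | zero => simp
    | add x y hx hy => simp only [map_add, hx, hy]
    | tmul t p =>
      induction t with
      | zero => simp
      | add x y hx hy => simp only [map_add, TensorProduct.add_tmul, hx, hy]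
      | tmul m n =>
        let F : B ⊗[k] (B ⊗[k] B) →ₗ[k] M ⊗[k] (N ⊗[k] P) :=
          TensorProduct.map ((act k B M).toLinearMap.flip m)
            (TensorProduct.map ((act k B N).toLinearMap.flip n) ((act k B P).toLinearMap.flip p))
        have h1 : ∀ z : B ⊗[k] B, TensorProduct.assoc k M N P
            (TensorProduct.map ((act k B (M ⊗[k] N)).toLinearMap.flip (m ⊗ₜ n))
              ((act k B P).toLinearMap.flip p) z)
            = F (TensorProduct.assoc k B B B ((Coalgebra.comul (R := k)).rTensor B z)) := by
          intro z
          induction z with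
          | zero => simp
          | add x y hx hy => simp only [map_add, hx, hy]
          | tmul x y =>
            simp only [TensorProduct.map_tmul, LinearMap.flip_apply, AlgHom.toLinearMap_apply,
              act_tmul, LinearMap.rTensor_tmul]
            generalize Coalgebra.comul (R := k) x = z
            induction z with
            | zero => simp
            | add x y hx hy => simp only [map_add, TensorProduct.add_tmul, hx, hy]
            | tmul x y => simp [F]
        have h2 : ∀ z : B ⊗[k] B,
            (TensorProduct.map ((act k B M).toLinearMap.flip m)
              ((act k B (N ⊗[k] P)).toLinearMap.flip (n ⊗ₜ p)) z)
            = F ((Coalgebra.comul (R := k)).lTensor B z) := by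
          intro z
          induction z with
          | zero => simp
          | add x y hx hy => simp only [map_add, hx, hy]
          | tmul x y =>
            simp only [TensorProduct.map_tmul, LinearMap.flip_apply, AlgHom.toLinearMap_apply,
              act_tmul, LinearMap.lTensor_tmul, F]
        simp only [LinearEquiv.coe_coe, TensorProduct.assoc_tmul]
        rw [act_tmul, act_tmul, h1, h2, Coalgebra.coassoc_apply]
  · intro t
    induction t with
    | zero => simp
    | add x y hx hy => simp only [map_add, hx, hy]
    | tmul t p =>
      induction t with
      | zero => simp
      | add x y hx hy => simp only [map_add, TensorProduct.add_tmul, hx, hy]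
      | tmul m n =>
        simp only [LinearEquiv.coe_coe, TensorProduct.assoc_tmul, coact_tmul]
        generalize coact k B M m = z
        generalize coact k B N n = w
        generalize coact k B P p = u
        induction z with
        | zero => simp
        | add x y hx hy => simp only [map_add, hx, hy, LinearMap.add_apply]
        | tmul a m =>
          induction w with
          | zero => simp
          | add x y hx hy => simp only [map_add, hx, hy, LinearMap.add_apply]
          | tmul c n =>
            induction u with
            | zero => simp
            | add x y hx hy => simp only [map_add, hx, hy]
            | tmul d p => simp [mul_assoc]

lemma assoc_symm : IsYDHom B (TensorProduct.assoc k M N P).symm.toLinearMap := assoc.symm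

lemma lid : IsYDHom B (TensorProduct.lid k M).toLinearMap := by
  constructor
  · intro b t
    induction t with
    | zero => simp
    | add x y hx hy => simp only [map_add, hx, hy]
    | tmul a m =>
      rw [act_tmul]
      have : ∀ z : B ⊗[k] B, TensorProduct.lid k M (TensorProduct.map
          ((act k B k).toLinearMap.flip a) ((act k B M).toLinearMap.flip m) z)
          = a • act k B M (TensorProduct.lid k B
              ((Coalgebra.counit (R := k) (A := B)).rTensor B z)) m := by
        intro z
        induction z with
        | zero => simp
        | add x y hx hy => simp only [map_add, hx, hy, LinearMap.add_apply, smul_add]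
        | tmul x y => simp [act_unit, mul_smul, smul_comm a]
      simp [this]
  · intro t
    induction t with
    | zero => simp
    | add x y hx hy => simp only [map_add, hx, hy]
    | tmul a m =>
      simp only [LinearEquiv.coe_coe, TensorProduct.lid_tmul, coact_tmul, coact_unit, map_smul]
      generalize coact k B M m = z
      induction z with
      | zero => simp
      | add x y hx hy => simp only [map_add, hx, hy, smul_add]
      | tmul d p => simp

lemma rid : IsYDHom B (TensorProduct.rid k M).toLinearMap := by
  constructor
  · intro b t
    induction t with
    | zero => simp
    | add x y hx hy => simp only [map_add, hx, hy]
    | tmul m a =>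
      rw [act_tmul]
      have : ∀ z : B ⊗[k] B, TensorProduct.rid k M (TensorProduct.map
          ((act k B M).toLinearMap.flip m) ((act k B k).toLinearMap.flip a) z)
          = a • act k B M (TensorProduct.rid k B
              ((Coalgebra.counit (R := k) (A := B)).lTensor B z)) m := by
        intro z
        induction z with
        | zero => simp
        | add x y hx hy => simp only [map_add, hx, hy, LinearMap.add_apply, smul_add]
        | tmul x y => simp [act_unit, mul_smul, smul_comm a]
      simp [this]
  · intro t
    induction t with
    | zero => simp
    | add x y hx hy => simp only [map_add, hx, hy]
    | tmul m a =>
      simp only [LinearEquiv.coe_coe, TensorProduct.rid_tmul, coact_tmul, coact_unit, map_smul]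
      generalize coact k B M m = z
      induction z with
      | zero => simp
      | add x y hx hy => simp only [map_add, hx, hy, smul_add, LinearMap.add_apply]
      | tmul d p => simp [TensorProduct.tmul_smul]

end IsYDHom

/-- Naturality on the left needs only that `f` is colinear; on the right, only that it is linear
over `B`. -/
lemma braiding_nat_left {f : M →ₗ[k] N} (hf : IsYDHom B f) (t : M ⊗[k] P) :
    braiding B N P (f.rTensor P t) = f.lTensor P (braiding B M P t) := by
  induction t with
  | zero => simp
  | add x y hx hy => simp only [map_add, hx, hy]
  | tmul m p =>
    simp only [LinearMap.rTensor_tmul, braiding_tmul, hf.map_coact]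
    generalize coact k B M m = z
    induction z with
    | zero => simp
    | add x y hx hy => simp only [map_add, hx, hy]
    | tmul d p => simp

lemma braiding_nat_right {f : M →ₗ[k] N} (hf : IsYDHom B f) (t : P ⊗[k] M) :
    braiding B P N (f.lTensor P t) = f.rTensor P (braiding B P M t) := by
  induction t with
  | zero => simp
  | add x y hx hy => simp only [map_add, hx, hy]
  | tmul p m =>
    simp only [LinearMap.lTensor_tmul, braiding_tmul]
    generalize coact k B P p = z
    induction z with
    | zero => simp
    | add x y hx hy => simp only [map_add, hx, hy]
    | tmul d p => simp [hf.map_act]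

/-- First hexagon: `m ⊗ n` coacts through the product `m₍₋₁₎ n₍₋₁₎`, and acting by a product is
acting twice. -/
lemma braiding_tensor_left (t : (M ⊗[k] N) ⊗[k] P) :
    (TensorProduct.assoc k P M N).symm (braiding B (M ⊗[k] N) P t)
    = (braiding B M P).rTensor N ((TensorProduct.assoc k M P N).symm
        ((braiding B N P).lTensor M (TensorProduct.assoc k M N P t))) := by
  induction t with
  | zero => simp
  | add x y hx hy => simp only [map_add, hx, hy]
  | tmul t p =>
    induction t with
    | zero => simp
    | add x y hx hy => simp only [map_add, TensorProduct.add_tmul, hx, hy]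
    | tmul m n =>
      simp only [TensorProduct.assoc_tmul, LinearMap.lTensor_tmul, braiding_tmul, coact_tmul]
      generalize coact k B N n = w
      induction w with
      | zero => simp
      | add x y hx hy => simp only [map_add, TensorProduct.tmul_add, hx, hy]
      | tmul d n =>
        simp only [LinearMap.rTensor_tmul, TensorProduct.assoc_symm_tmul, braiding_tmul]
        generalize coact k B M m = z
        induction z with
        | zero => simp
        | add x y hx hy =>
          simp only [map_add, LinearMap.add_apply, TensorProduct.add_tmul, hx, hy]
        | tmul c m => simp

/-- Second hexagon: `m₍₋₁₎` acts on `n ⊗ p` through its coproduct, and coassociativity of the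
coaction turns the two legs into two successive coactions of `m`. -/
lemma braiding_tensor_right (t : M ⊗[k] (N ⊗[k] P)) :
    TensorProduct.assoc k N P M (braiding B M (N ⊗[k] P) t)
    = (braiding B M P).lTensor N (TensorProduct.assoc k N M P
        ((braiding B M N).rTensor P ((TensorProduct.assoc k M N P).symm t))) := by
  induction t with
  | zero => simp
  | add x y hx hy => simp only [map_add, hx, hy]
  | tmul m t =>
    induction t with
    | zero => simp
    | add x y hx hy => simp only [map_add, TensorProduct.tmul_add, hx, hy]
    | tmul n p =>
      simp only [TensorProduct.assoc_symm_tmul, LinearMap.rTensor_tmul, braiding_tmul]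
      let F : B ⊗[k] (B ⊗[k] M) →ₗ[k] N ⊗[k] (P ⊗[k] M) :=
        TensorProduct.map ((act k B N).toLinearMap.flip n)
          (((act k B P).toLinearMap.flip p).rTensor M)
      have h1 : ∀ z : B ⊗[k] M, TensorProduct.assoc k N P M
          (((act k B (N ⊗[k] P)).toLinearMap.flip (n ⊗ₜ p)).rTensor M z)
          = F (TensorProduct.assoc k B B M
              ((Coalgebra.comul (R := k) (A := B)).rTensor M z)) := by
        intro z
        induction z with
        | zero => simp
        | add x y hx hy => simp only [map_add, hx, hy]
        | tmul x y =>
          simp only [LinearMap.rTensor_tmul, LinearMap.flip_apply, AlgHom.toLinearMap_apply,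
            act_tmul]
          generalize Coalgebra.comul (R := k) x = z
          induction z with
          | zero => simp
          | add x y hx hy => simp only [map_add, TensorProduct.add_tmul, hx, hy]
          | tmul x y => simp [F]
      have h2 : ∀ z : B ⊗[k] M, (braiding B M P).lTensor N (TensorProduct.assoc k N M P
          ((((act k B N).toLinearMap.flip n).rTensor M z) ⊗ₜ p))
          = F ((coact k B M).lTensor B z) := by
        intro z
        induction z with
        | zero => simp
        | add x y hx hy => simp only [map_add, TensorProduct.add_tmul, hx, hy]
        | tmul x y => simp [F, braiding_tmul]
      rw [h1, h2, coact_coassoc]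

lemma braiding_unit_left (a : k) (m : M) : braiding B k M (a ⊗ₜ[k] m) = m ⊗ₜ a := by
  simp [braiding_tmul, coact_unit]

lemma braiding_unit_right (a : k) (m : M) : braiding B M k (m ⊗ₜ[k] a) = a ⊗ₜ m := by
  have h : ∀ z : B ⊗[k] M, ((act k B k).toLinearMap.flip a).rTensor M z
      = a • (Coalgebra.counit (R := k) (A := B)).rTensor M z := by
    intro z
    induction z with
    | zero => simp
    | add x y hx hy => simp only [map_add, smul_add, hx, hy]
    | tmul x y => simp [act_unit, TensorProduct.smul_tmul', mul_comm]
  rw [braiding_tmul, h, YDModule.counit_coact, TensorProduct.smul_tmul', smul_eq_mul, mul_one]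

-- Both halves are the Yetter-Drinfeld compatibility condition: that of `M` gives linearity, and
-- that of `N`, with coassociativity of the coaction of `M`, gives colinearity.
variable (B M N) in
lemma IsYDHom.braiding : IsYDHom B (braiding (k := k) B M N) := by
  constructor
  · intro b t
    induction t with
    | zero => simp
    | add x y hx hy => simp only [map_add, hx, hy]
    | tmul m n =>
      let G := ((act k B N).toLinearMap.flip n).rTensor M
      have h1 : ∀ z : B ⊗[k] B, YD.braiding B M N (TensorProduct.map
          ((act k B M).toLinearMap.flip m) ((act k B N).toLinearMap.flip n) z)
          = G (compatR B M m z) := by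
        intro z
        induction z with
        | zero => simp
        | add x y hx hy => simp only [map_add, hx, hy]
        | tmul x y =>
          simp only [TensorProduct.map_tmul, LinearMap.flip_apply, AlgHom.toLinearMap_apply,
            braiding_tmul, compatR_tmul, G]
          generalize coact k B M _ = w
          induction w with
          | zero => simp
          | add x y hx hy => simp only [map_add, hx, hy]
          | tmul x y => simp
      have h2 : ∀ w : B ⊗[k] M, act k B (N ⊗[k] M) b
          (((act k B N).toLinearMap.flip n).rTensor M w)
          = G (compatL B M (Coalgebra.comul (R := k) b) w) := by
        intro w
        induction w with
        | zero => simp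
        | add x y hx hy => simp only [map_add, hx, hy]
        | tmul c m =>
          simp only [LinearMap.rTensor_tmul, act_tmul]
          generalize Coalgebra.comul (R := k) b = z
          induction z with
          | zero => simp
          | add x y hx hy => simp only [map_add, hx, hy, LinearMap.add_apply]
          | tmul x y => simp [G]
      rw [act_tmul, h1, braiding_tmul, h2, compat']
  · intro t
    induction t with
    | zero => simp
    | add x y hx hy => simp only [map_add, hx, hy]
    | tmul m n =>
      let J : B ⊗[k] (B ⊗[k] M) →ₗ[k] B ⊗[k] (N ⊗[k] M) :=
        TensorProduct.lift ((TensorProduct.map₂ (LinearMap.mul k B) (TensorProduct.mk k N M)) ∘ₗ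
          coact k B N ∘ₗ (act k B N).toLinearMap.flip n)
      let K : B ⊗[k] N → B ⊗[k] (B ⊗[k] M) →ₗ[k] B ⊗[k] (N ⊗[k] M) := fun w =>
        TensorProduct.assoc k B N M ∘ₗ ((compatL B N).flip w).rTensor M ∘ₗ
          (TensorProduct.assoc k B B M).symm.toLinearMap
      have hJ : ∀ z : B ⊗[k] M, coact k B (N ⊗[k] M)
          (((act k B N).toLinearMap.flip n).rTensor M z)
          = J ((coact k B M).lTensor B z) := by
        intro z
        induction z with
        | zero => simp
        | add x y hx hy => simp only [map_add, hx, hy]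
        | tmul c m => simp [J, coact_tmul]
      have hJK : ∀ z : B ⊗[k] M, J (TensorProduct.assoc k B B M
          ((Coalgebra.comul (R := k) (A := B)).rTensor M z))
          = K (coact k B N n) (TensorProduct.assoc k B B M
          ((Coalgebra.comul (R := k) (A := B)).rTensor M z)) := by
        have h : ∀ (p : B ⊗[k] B) (m : M), J (TensorProduct.assoc k B B M (p ⊗ₜ m))
            = TensorProduct.assoc k B N M (compatR B N n p ⊗ₜ m) := by
          intro p m
          induction p with
          | zero => simp
          | add x y hx hy => simp only [map_add, TensorProduct.add_tmul, hx, hy]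
          | tmul x y =>
            simp only [TensorProduct.assoc_tmul, J, TensorProduct.lift.tmul, LinearMap.comp_apply,
              LinearMap.flip_apply, AlgHom.toLinearMap_apply, compatR_tmul]
            generalize coact k B N _ = w
            induction w with
            | zero => simp
            | add x y hx hy =>
              simp only [map_add, TensorProduct.add_tmul, hx, hy, LinearMap.add_apply]
            | tmul x y => simp
        intro z
        induction z with
        | zero => simp
        | add x y hx hy => simp only [map_add, hx, hy]
        | tmul c m =>
          rw [LinearMap.rTensor_tmul, h, ← compat']
          simp [K]
      have hK : ∀ (z : B ⊗[k] M) (w : B ⊗[k] N), (YD.braiding B M N).lTensor B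
          (TensorProduct.map₂ (LinearMap.mul k B) (TensorProduct.mk k M N) z w)
          = K w ((coact k B M).lTensor B z) := by
        intro z w
        induction w with
        | zero => simp [K]
        | add x y hx hy =>
          simp only [map_add, LinearMap.rTensor_add, LinearMap.add_comp, LinearMap.comp_add,
            LinearMap.add_apply, hx, hy, K]
        | tmul d n =>
          induction z with
          | zero => simp
          | add x y hx hy => simp only [map_add, hx, hy, LinearMap.add_apply]
          | tmul c m =>
            simp only [TensorProduct.map₂_apply_tmul, TensorProduct.map_tmul,
              TensorProduct.mk_apply, LinearMap.mul_apply', LinearMap.lTensor_tmul, braiding_tmul]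
            generalize coact k B M m = w
            induction w with
            | zero => simp
            | add x y hx hy => simp only [map_add, TensorProduct.tmul_add, hx, hy]
            | tmul x y => simp [K]
      rw [braiding_tmul, hJ, ← coact_coassoc, hJK, coact_tmul, hK, coact_coassoc]

end homs

/-! ### String calculus on right-bracketed tensor products -/

section strings
variable {k : Type*} [Field k]
variable {W X Y Z S T : Type*} [AddCommGroup W] [Module k W] [AddCommGroup X] [Module k X]
  [AddCommGroup Y] [Module k Y] [AddCommGroup Z] [Module k Z] [AddCommGroup S] [Module k S]
  [AddCommGroup T] [Module k T]

/-- `f ⊗ T`, with tensor products bracketed to the right, for `f` with two inputs and one output. -/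
def op21 (f : X ⊗[k] Y →ₗ[k] Z) : X ⊗[k] (Y ⊗[k] T) →ₗ[k] Z ⊗[k] T :=
  f.rTensor T ∘ₗ (TensorProduct.assoc k X Y T).symm.toLinearMap

/-- `f ⊗ T`, with tensor products bracketed to the right, for `f` with two inputs and outputs. -/
def op22 (f : X ⊗[k] Y →ₗ[k] Z ⊗[k] W) : X ⊗[k] (Y ⊗[k] T) →ₗ[k] Z ⊗[k] (W ⊗[k] T) :=
  (TensorProduct.assoc k Z W T).toLinearMap ∘ₗ f.rTensor T
    ∘ₗ (TensorProduct.assoc k X Y T).symm.toLinearMap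

/-- `f ⊗ T`, with tensor products bracketed to the right, for `f` with one input and two outputs. -/
def op12 (f : X →ₗ[k] Z ⊗[k] W) : X ⊗[k] T →ₗ[k] Z ⊗[k] (W ⊗[k] T) :=
  (TensorProduct.assoc k Z W T).toLinearMap ∘ₗ f.rTensor T

/-- `f ⊗ T`, for `f` with one input and one output. -/
def op11 (f : X →ₗ[k] Z) : X ⊗[k] T →ₗ[k] Z ⊗[k] T := f.rTensor T

/-- `f ⊗ T`, with tensor products bracketed to the right, for a pairing `f`. -/
def op20 (f : X ⊗[k] Y →ₗ[k] k) : X ⊗[k] (Y ⊗[k] T) →ₗ[k] T :=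
  (TensorProduct.lid k T).toLinearMap ∘ₗ f.rTensor T
    ∘ₗ (TensorProduct.assoc k X Y T).symm.toLinearMap

/-- `f ⊗ T` for a functional `f`. -/
def op10 (f : X →ₗ[k] k) : X ⊗[k] T →ₗ[k] T :=
  (TensorProduct.lid k T).toLinearMap ∘ₗ f.rTensor T

/-- `t ↦ a ⊗ t`. -/
def op01 (a : X) : T →ₗ[k] X ⊗[k] T := TensorProduct.mk k X T a

local prefix:max "▹" => LinearMap.lTensor _

lemma op21_tmul (f : X ⊗[k] Y →ₗ[k] Z) (x : X) (y : Y) (t : T) :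
    op21 f (x ⊗ₜ (y ⊗ₜ t)) = f (x ⊗ₜ y) ⊗ₜ t := rfl

lemma op22_tmul (f : X ⊗[k] Y →ₗ[k] Z ⊗[k] W) (x : X) (y : Y) (t : T) :
    op22 f (x ⊗ₜ (y ⊗ₜ t)) = TensorProduct.assoc k Z W T (f (x ⊗ₜ y) ⊗ₜ t) := rfl

lemma op12_tmul (f : X →ₗ[k] Z ⊗[k] W) (x : X) (t : T) :
    op12 f (x ⊗ₜ t) = TensorProduct.assoc k Z W T (f x ⊗ₜ t) := rfl

lemma op11_tmul (f : X →ₗ[k] Z) (x : X) (t : T) : op11 f (x ⊗ₜ t) = f x ⊗ₜ t := rfl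

lemma op20_tmul (f : X ⊗[k] Y →ₗ[k] k) (x : X) (y : Y) (t : T) :
    op20 f (x ⊗ₜ (y ⊗ₜ t)) = f (x ⊗ₜ y) • t := rfl

lemma op10_tmul (f : X →ₗ[k] k) (x : X) (t : T) : op10 f (x ⊗ₜ t) = f x • t := rfl

lemma op01_apply (x : X) (t : T) : op01 (k := k) x t = x ⊗ₜ t := rfl

/-- Linear maps on `X ⊗ (Y ⊗ T)` agree if they agree on `x ⊗ (y ⊗ t)`. -/
lemma ext_three {f g : X ⊗[k] (Y ⊗[k] T) →ₗ[k] S}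
    (h : ∀ x y t, f (x ⊗ₜ (y ⊗ₜ t)) = g (x ⊗ₜ (y ⊗ₜ t))) : f = g := by
  ext x y t
  exact h x y t

/-- The interchange law: operations at the head and in the tail of a string touch different tensor
factors. One version is needed for each shape of head. -/
lemma op21_nat (g : X ⊗[k] Y →ₗ[k] Z) (f : S →ₗ[k] T) (x : X ⊗[k] (Y ⊗[k] S)) :
    ▹f (op21 g x) = op21 g (▹(▹f) x) := by
  refine LinearMap.congr_fun (f := ▹f ∘ₗ op21 g) (g := op21 g ∘ₗ ▹(▹f)) (ext_three ?_) x
  intro x y t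
  simp [op21_tmul]

lemma op20_nat (g : X ⊗[k] Y →ₗ[k] k) (f : S →ₗ[k] T) (x : X ⊗[k] (Y ⊗[k] S)) :
    f (op20 g x) = op20 g (▹(▹f) x) := by
  refine LinearMap.congr_fun (f := f ∘ₗ op20 g) (g := op20 g ∘ₗ ▹(▹f)) (ext_three ?_) x
  intro x y t
  simp [op20_tmul]

lemma op22_nat (g : X ⊗[k] Y →ₗ[k] Z ⊗[k] W) (f : S →ₗ[k] T) (x : X ⊗[k] (Y ⊗[k] S)) :
    op22 g (▹(▹f) x) = ▹(▹f) (op22 g x) := by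
  refine LinearMap.congr_fun (f := op22 g ∘ₗ ▹(▹f)) (g := ▹(▹f) ∘ₗ op22 g) (ext_three ?_) x
  intro x y t
  simp only [LinearMap.comp_apply, op22_tmul, LinearMap.lTensor_tmul]
  generalize g _ = z
  induction z with
  | zero => simp
  | add x y hx hy => simp only [map_add, TensorProduct.add_tmul, hx, hy]
  | tmul x y => simp

lemma op12_nat (g : X →ₗ[k] Z ⊗[k] W) (f : S →ₗ[k] T) (x : X ⊗[k] S) :
    op12 g (▹f x) = ▹(▹f) (op12 g x) := by
  refine LinearMap.congr_fun (f := op12 g ∘ₗ ▹f) (g := ▹(▹f) ∘ₗ op12 g)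
    (TensorProduct.ext' ?_) x
  intro x t
  simp only [LinearMap.comp_apply, op12_tmul, LinearMap.lTensor_tmul]
  generalize g _ = z
  induction z with
  | zero => simp
  | add x y hx hy => simp only [map_add, TensorProduct.add_tmul, hx, hy]
  | tmul x y => simp

lemma op11_nat (g : X →ₗ[k] Z) (f : S →ₗ[k] T) (x : X ⊗[k] S) :
    op11 g (▹f x) = ▹f (op11 g x) := by
  refine LinearMap.congr_fun (f := op11 g ∘ₗ ▹f) (g := ▹f ∘ₗ op11 g) (TensorProduct.ext' ?_) x
  intro x t
  simp [op11_tmul]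

lemma op10_nat (g : X →ₗ[k] k) (f : S →ₗ[k] T) (x : X ⊗[k] S) :
    f (op10 g x) = op10 g (▹f x) := by
  refine LinearMap.congr_fun (f := f ∘ₗ op10 g) (g := op10 g ∘ₗ ▹f) (TensorProduct.ext' ?_) x
  intro x t
  simp [op10_tmul]

lemma op01_nat (a : X) (f : S →ₗ[k] T) (x : S) : op01 a (f x) = ▹f (op01 (k := k) a x) := rfl

/-! ### Rewriting of composites -/

/-- `f ∘ g` is to be rewritten to `h`. -/
class Rw (f : Y →ₗ[k] Z) (g : X →ₗ[k] Y) (h : outParam (X →ₗ[k] Z)) : Prop where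
  eq : ∀ x, f (g x) = h x

/-- `f ∘ g ∘ l` is to be rewritten to `h`. -/
class Rw₃ (f : Y →ₗ[k] Z) (g : X →ₗ[k] Y) (l : W →ₗ[k] X) (h : outParam (W →ₗ[k] Z)) :
    Prop where
  eq : ∀ x, f (g (l x)) = h x

/-- Operations (`f ⊗ id` for a coproduct or a unit `f`) to be carried out before others. -/
class Early (f : X →ₗ[k] Y) : Prop

/-- Operations to be carried out after others. -/
class Late (f : X →ₗ[k] Y) : Prop

instance (f : X →ₗ[k] Z ⊗[k] W) : Early (op12 (T := T) f) := ⟨⟩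
instance (f : X →ₗ[k] Z) [Early f] : Early (f.lTensor T) := ⟨⟩
instance (f : X ⊗[k] Y →ₗ[k] Z ⊗[k] W) : Late (op22 (T := T) f) := ⟨⟩
instance (f : X ⊗[k] Y →ₗ[k] Z) : Late (op21 (T := T) f) := ⟨⟩
instance (f : X ⊗[k] Y →ₗ[k] k) : Late (op20 (T := T) f) := ⟨⟩
instance (f : X →ₗ[k] Z) : Late (op11 (T := T) f) := ⟨⟩
instance (f : X →ₗ[k] Z) [Late f] : Late (f.lTensor T) := ⟨⟩

instance (f : Y →ₗ[k] Z) (g : X →ₗ[k] Y) (h : X →ₗ[k] Z) [H : Rw f g h] :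
    Rw (f.lTensor T) (g.lTensor T) (h.lTensor T) := ⟨fun x => by
  rw [← LinearMap.lTensor_comp_apply, show f ∘ₗ g = h from LinearMap.ext H.eq]⟩

instance (f : Y →ₗ[k] Z) (g : X →ₗ[k] Y) (l : W →ₗ[k] X) (h : W →ₗ[k] Z) [H : Rw₃ f g l h] :
    Rw₃ (f.lTensor T) (g.lTensor T) (l.lTensor T) (h.lTensor T) := ⟨fun x => by
  rw [← LinearMap.lTensor_comp_apply, ← LinearMap.lTensor_comp_apply,
    show (f ∘ₗ g) ∘ₗ l = h from LinearMap.ext H.eq]⟩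

/-- These instances orient the interchange law: units and coproducts move to the start of a
composite, products, pairings and counits to its end, and between remaining operations the one
nearer the head is carried out first. The orientation is what makes the normal form of a diagram
usable for comparison. -/
instance (g : X ⊗[k] Y →ₗ[k] Z) (f : S →ₗ[k] T) : Rw ▹f (op21 g) (op21 g ∘ₗ ▹(▹f)) :=
  ⟨op21_nat g f⟩
instance (g : X ⊗[k] Y →ₗ[k] k) (f : S →ₗ[k] T) : Rw f (op20 g) (op20 g ∘ₗ ▹(▹f)) :=
  ⟨op20_nat g f⟩
instance (g : X →ₗ[k] k) (f : S →ₗ[k] T) : Rw f (op10 g) (op10 g ∘ₗ ▹f) := ⟨op10_nat g f⟩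
instance (g : X →ₗ[k] Z ⊗[k] W) (f : S →ₗ[k] T) : Rw (op12 g) ▹f (▹(▹f) ∘ₗ op12 g) :=
  ⟨op12_nat g f⟩
instance (a : X) (f : S →ₗ[k] T) : Rw (op01 (k := k) a) f (▹f ∘ₗ op01 a) := ⟨op01_nat a f⟩
instance (g : X ⊗[k] Y →ₗ[k] Z ⊗[k] W) (f : S →ₗ[k] T) [Late f] :
    Rw (op22 g) ▹(▹f) (▹(▹f) ∘ₗ op22 g) := ⟨op22_nat g f⟩
instance (g : X ⊗[k] Y →ₗ[k] Z ⊗[k] W) (f : S →ₗ[k] T) [Early f] :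
    Rw ▹(▹f) (op22 g) (op22 g ∘ₗ ▹(▹f)) := ⟨fun x => (op22_nat g f x).symm⟩
instance (g : X →ₗ[k] Z) (f : S →ₗ[k] T) [Late f] : Rw (op11 g) ▹f (▹f ∘ₗ op11 g) :=
  ⟨op11_nat g f⟩
instance (g : X →ₗ[k] Z) (f : S →ₗ[k] T) [Early f] : Rw ▹f (op11 g) (op11 g ∘ₗ ▹f) :=
  ⟨fun x => (op11_nat g f x).symm⟩

end strings

/-! ### Naturality, hexagons and the Yang–Baxter equation on strings -/

section braid
variable {k : Type*} [Field k] {B : Type*} [Ring B] [HopfAlgebra k B]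
variable {M N P Q T : Type*} [AddCommGroup M] [Module k M] [YDModule k B M]
  [AddCommGroup N] [Module k N] [YDModule k B N] [AddCommGroup P] [Module k P] [YDModule k B P]
  [AddCommGroup Q] [Module k Q] [YDModule k B Q] [AddCommGroup T] [Module k T]

local prefix:max "▹" => LinearMap.lTensor _

lemma op22_braiding_assoc_left (w : (M ⊗[k] N) ⊗[k] (P ⊗[k] T)) :
    ▹(TensorProduct.assoc k M N T).toLinearMap (op22 (braiding B (M ⊗[k] N) P) w)
      = op22 (braiding B M P) (▹(op22 (braiding B N P)) (TensorProduct.assoc k M N _ w)) := by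
  induction w with
  | zero => simp
  | add x y hx hy => simp only [map_add, hx, hy]
  | tmul s w =>
  induction w with
  | zero => simp
  | add x y hx hy => simp only [map_add, TensorProduct.tmul_add, hx, hy]
  | tmul p t =>
  induction s with
  | zero => simp
  | add x y hx hy => simp only [map_add, TensorProduct.add_tmul, hx, hy]
  | tmul m n =>
    rw [op22_tmul, ← (TensorProduct.assoc k P M N).apply_symm_apply (braiding B (M ⊗[k] N) P _),
      braiding_tensor_left]
    simp only [TensorProduct.assoc_tmul, LinearMap.lTensor_tmul, op22_tmul]
    generalize braiding (k := k) B N P _ = z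
    induction z with
    | zero => simp
    | add x y hx hy => simp only [map_add, TensorProduct.add_tmul, TensorProduct.tmul_add, hx, hy]
    | tmul p n =>
      simp only [TensorProduct.assoc_tmul, TensorProduct.assoc_symm_tmul, LinearMap.rTensor_tmul,
        op22_tmul]
      generalize braiding (k := k) B M P _ = z
      induction z with
      | zero => simp
      | add x y hx hy => simp only [map_add, TensorProduct.add_tmul, hx, hy]
      | tmul p n => simp

lemma op22_braiding_assoc_right (w : P ⊗[k] ((M ⊗[k] N) ⊗[k] T)) :
    TensorProduct.assoc k M N _ (op22 (braiding B P (M ⊗[k] N)) w)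
      = ▹(op22 (braiding B P N)) (op22 (braiding B P M)
          (▹(TensorProduct.assoc k M N T).toLinearMap w)) := by
  induction w with
  | zero => simp
  | add x y hx hy => simp only [map_add, hx, hy]
  | tmul p w =>
  induction w with
  | zero => simp
  | add x y hx hy => simp only [map_add, TensorProduct.tmul_add, hx, hy]
  | tmul s t =>
  induction s with
  | zero => simp
  | add x y hx hy =>
    simp only [map_add, TensorProduct.add_tmul, TensorProduct.tmul_add, hx, hy]
  | tmul m n =>
    rw [op22_tmul, ← (TensorProduct.assoc k M N P).symm_apply_apply (braiding B P (M ⊗[k] N) _),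
      braiding_tensor_right]
    simp only [TensorProduct.assoc_tmul, TensorProduct.assoc_symm_tmul, LinearMap.lTensor_tmul,
      LinearMap.rTensor_tmul, op22_tmul, LinearEquiv.coe_coe]
    generalize braiding (k := k) B P M _ = z
    induction z with
    | zero => simp
    | add x y hx hy => simp only [map_add, TensorProduct.add_tmul, hx, hy]
    | tmul m p =>
      simp only [TensorProduct.assoc_tmul, LinearMap.lTensor_tmul, op22_tmul]
      generalize braiding (k := k) B P N _ = z
      induction z with
      | zero => simp
      | add x y hx hy =>
        simp only [map_add, TensorProduct.add_tmul, TensorProduct.tmul_add, hx, hy]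
      | tmul p n => simp

lemma op22_braiding_op11_left {f : M →ₗ[k] N} (hf : IsYDHom B f) (x : M ⊗[k] (P ⊗[k] T)) :
    op22 (braiding B N P) (op11 f x) = ▹(op11 f) (op22 (braiding B M P) x) := by
  refine LinearMap.congr_fun (f := op22 (braiding B N P) ∘ₗ op11 f)
    (g := ▹(op11 f) ∘ₗ op22 (braiding B M P)) (ext_three fun m p t => ?_) x
  simp only [LinearMap.comp_apply, op11_tmul, op22_tmul]
  rw [← LinearMap.rTensor_tmul P f, braiding_nat_left hf]
  generalize braiding (k := k) B M P _ = z
  induction z with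
  | zero => simp
  | add x y hx hy => simp only [map_add, TensorProduct.add_tmul, hx, hy]
  | tmul p n => simp [op11_tmul]

lemma op22_braiding_op11_right {f : M →ₗ[k] N} (hf : IsYDHom B f) (x : P ⊗[k] (M ⊗[k] T)) :
    op22 (braiding B P N) (▹(op11 f) x) = op11 f (op22 (braiding B P M) x) := by
  refine LinearMap.congr_fun (f := op22 (braiding B P N) ∘ₗ ▹(op11 f))
    (g := op11 f ∘ₗ op22 (braiding B P M)) (ext_three fun m p t => ?_) x
  simp only [LinearMap.comp_apply, op11_tmul, op22_tmul, LinearMap.lTensor_tmul]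
  rw [← LinearMap.lTensor_tmul P f, braiding_nat_right hf]
  generalize braiding (k := k) B P M _ = z
  induction z with
  | zero => simp
  | add x y hx hy => simp only [map_add, TensorProduct.add_tmul, hx, hy]
  | tmul p n => simp [op11_tmul]

/-- Treat `M ⊗ N` as one strand, use naturality of the braiding for `f`, and split the strand by the
hexagon. The versions below, for products and coproducts on either side, arise in the same way. -/
lemma op22_braiding_op21_left {f : M ⊗[k] N →ₗ[k] Q} (hf : IsYDHom B f)
    (x : M ⊗[k] (N ⊗[k] (P ⊗[k] T))) : op22 (braiding B Q P) (op21 f x)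
      = ▹(op21 f) (op22 (braiding B M P) (▹(op22 (braiding B N P)) x)) := by
  obtain ⟨w, rfl⟩ := (TensorProduct.assoc k M N _).surjective x
  rw [← op22_braiding_assoc_left, ← LinearMap.lTensor_comp_apply]
  simp only [op21, LinearMap.comp_apply, LinearEquiv.coe_coe, LinearEquiv.symm_apply_apply,
    LinearMap.comp_assoc, LinearEquiv.symm_comp, LinearMap.comp_id]
  exact op22_braiding_op11_left hf w

lemma op22_braiding_op21_right {f : M ⊗[k] N →ₗ[k] Q} (hf : IsYDHom B f)
    (x : P ⊗[k] (M ⊗[k] (N ⊗[k] T))) : op22 (braiding B P Q) (▹(op21 f) x)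
      = op21 f (▹(op22 (braiding B P N)) (op22 (braiding B P M) x)) := by
  obtain ⟨w, rfl⟩ := (TensorProduct.assoc k M N T).lTensor P |>.surjective x
  rw [← LinearEquiv.coe_coe, LinearEquiv.coe_lTensor, ← op22_braiding_assoc_right,
    ← LinearMap.lTensor_comp_apply]
  simp only [op21, LinearMap.comp_apply, LinearEquiv.coe_coe, LinearEquiv.symm_apply_apply,
    LinearMap.comp_assoc, LinearEquiv.symm_comp, LinearMap.comp_id]
  exact op22_braiding_op11_right hf w

lemma op22_braiding_op12_left {f : Q →ₗ[k] M ⊗[k] N} (hf : IsYDHom B f)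
    (x : Q ⊗[k] (P ⊗[k] T)) : ▹(op12 f) (op22 (braiding B Q P) x)
      = op22 (braiding B M P) (▹(op22 (braiding B N P)) (op12 f x)) := by
  simp only [op12, LinearMap.comp_apply, LinearEquiv.coe_coe]
  rw [← op22_braiding_assoc_left, LinearMap.lTensor_comp, LinearMap.comp_apply]
  congr 1
  exact (op22_braiding_op11_left hf x).symm

lemma op22_braiding_op12_right {f : Q →ₗ[k] M ⊗[k] N} (hf : IsYDHom B f)
    (x : P ⊗[k] (Q ⊗[k] T)) : op12 f (op22 (braiding B P Q) x)
      = ▹(op22 (braiding B P N)) (op22 (braiding B P M) (▹(op12 f) x)) := by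
  simp only [op12, LinearMap.comp_apply, LinearMap.lTensor_comp]
  rw [← op22_braiding_assoc_right]
  simp only [LinearEquiv.coe_coe]
  congr 1
  exact (op22_braiding_op11_right hf x).symm

/-- A strand that ends in the unit object can be pulled off any crossing, because the braiding with
`k` is the flip. -/
lemma op22_braiding_op10_left {f : M →ₗ[k] k} (hf : IsYDHom B f) (x : M ⊗[k] (P ⊗[k] T)) :
    ▹(op10 f) (op22 (braiding B M P) x) = op10 f x := by
  refine LinearMap.congr_fun (f := ▹(op10 f) ∘ₗ op22 (braiding B M P))
    (g := op10 f) (ext_three fun m p t => ?_) x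
  have h := braiding_nat_left (P := P) hf (m ⊗ₜ p)
  have h2 : ∀ z : P ⊗[k] M, ▹(op10 f) (TensorProduct.assoc k P M T (z ⊗ₜ t))
      = TensorProduct.rid k P (f.lTensor P z) ⊗ₜ t := by
    intro z
    induction z with
    | zero => simp
    | add x y hx hy => simp only [map_add, TensorProduct.add_tmul, hx, hy]
    | tmul p n => simp [op10_tmul, TensorProduct.smul_tmul']
  rw [LinearMap.comp_apply, op22_tmul, h2, ← h, LinearMap.rTensor_tmul, braiding_unit_left,
    op10_tmul]
  simp [TensorProduct.smul_tmul']

lemma op22_braiding_op10_right {f : M →ₗ[k] k} (hf : IsYDHom B f) (x : P ⊗[k] (M ⊗[k] T)) :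
    op10 f (op22 (braiding B P M) x) = ▹(op10 f) x := by
  refine LinearMap.congr_fun (f := op10 f ∘ₗ op22 (braiding B P M))
    (g := ▹(op10 f)) (ext_three fun p m t => ?_) x
  have h := braiding_nat_right (P := P) hf (p ⊗ₜ m)
  have h2 : ∀ z : M ⊗[k] P, op10 f (TensorProduct.assoc k M P T (z ⊗ₜ t))
      = TensorProduct.lid k P (f.rTensor P z) ⊗ₜ t := by
    intro z
    induction z with
    | zero => simp
    | add x y hx hy => simp only [map_add, TensorProduct.add_tmul, hx, hy]
    | tmul p n => simp [op10_tmul, TensorProduct.smul_tmul']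
  rw [LinearMap.comp_apply, op22_tmul, h2, ← h, LinearMap.lTensor_tmul, braiding_unit_right]
  simp [op10_tmul, TensorProduct.smul_tmul']

lemma op20_eq (f : M ⊗[k] N →ₗ[k] k) (x : M ⊗[k] (N ⊗[k] T)) :
    op20 f x = op10 f ((TensorProduct.assoc k M N T).symm x) := rfl

lemma op22_braiding_op20_left {f : M ⊗[k] N →ₗ[k] k} (hf : IsYDHom B f)
    (x : M ⊗[k] (N ⊗[k] (P ⊗[k] T))) :
    ▹(op20 f) (op22 (braiding B M P) (▹(op22 (braiding B N P)) x)) = op20 f x := by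
  obtain ⟨w, rfl⟩ := (TensorProduct.assoc k M N _).surjective x
  rw [← op22_braiding_assoc_left, ← LinearMap.lTensor_comp_apply, op20_eq,
    LinearEquiv.symm_apply_apply, ← op22_braiding_op10_left hf]
  congr 2
  ext
  simp [op20_eq]

lemma op22_braiding_op20_right {f : M ⊗[k] N →ₗ[k] k} (hf : IsYDHom B f)
    (x : P ⊗[k] (M ⊗[k] (N ⊗[k] T))) :
    op20 f (▹(op22 (braiding B P N)) (op22 (braiding B P M) x)) = ▹(op20 f) x := by
  obtain ⟨w, rfl⟩ := (TensorProduct.assoc k M N T).lTensor P |>.surjective x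
  rw [← LinearEquiv.coe_coe, LinearEquiv.coe_lTensor, ← op22_braiding_assoc_right, op20_eq,
    LinearEquiv.symm_apply_apply, op22_braiding_op10_right hf,
    ← LinearMap.lTensor_comp_apply]
  congr 2
  ext
  simp [op20_eq]

lemma op22_braiding_op01_left {a : M} (ha : IsYDHom B (LinearMap.toSpanSingleton k M a))
    (x : P ⊗[k] T) : op22 (braiding B M P) (op01 a x) = ▹(op01 a) x := by
  induction x with
  | zero => simp
  | add x y hx hy => simp only [map_add, hx, hy]
  | tmul p t =>
    have h := braiding_nat_left (P := P) ha (1 ⊗ₜ p)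
    rw [LinearMap.rTensor_tmul, braiding_unit_left, LinearMap.lTensor_tmul,
      LinearMap.toSpanSingleton_apply, one_smul] at h
    simp [op22_tmul, op01_apply, h]

lemma op22_braiding_op01_right {a : M} (ha : IsYDHom B (LinearMap.toSpanSingleton k M a))
    (x : P ⊗[k] T) : op22 (braiding B P M) (▹(op01 a) x) = op01 a x := by
  induction x with
  | zero => simp
  | add x y hx hy => simp only [map_add, hx, hy]
  | tmul p t =>
    have h := braiding_nat_right (P := P) ha (p ⊗ₜ 1)
    rw [LinearMap.lTensor_tmul, braiding_unit_right, LinearMap.rTensor_tmul,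
      LinearMap.toSpanSingleton_apply, one_smul] at h
    simp [op22_tmul, op01_apply, h]

/-- Naturality of the braiding with `P` for the morphism `C_{M,N}`, with both sides split by the
hexagon. -/
lemma yang_baxter (x : M ⊗[k] (N ⊗[k] (P ⊗[k] T))) :
    ▹(op22 (braiding B M N)) (op22 (braiding B M P) (▹(op22 (braiding B N P)) x))
    = op22 (braiding B N P) (▹(op22 (braiding B M P)) (op22 (braiding B M N) x)) := by
  obtain ⟨w, rfl⟩ := (TensorProduct.assoc k M N _).surjective x
  rw [← op22_braiding_assoc_left]
  have h := op22_braiding_op11_left (T := T) (P := P) (IsYDHom.braiding B M N) w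
  have h2 : op22 (braiding B M N) (TensorProduct.assoc k M N (P ⊗[k] T) w)
      = TensorProduct.assoc k N M _ (op11 (braiding B M N) w) := by
    simp [op22, op11]
  rw [h2, ← op22_braiding_assoc_left, h, ← LinearMap.lTensor_comp_apply,
    ← LinearMap.lTensor_comp_apply]
  congr 2
  ext
  simp [op22, op11]

lemma op22_op22_of_comp_eq_id (h : braiding (k := k) B N M ∘ₗ braiding B M N = LinearMap.id)
    (x : M ⊗[k] (N ⊗[k] T)) : op22 (braiding B N M) (op22 (braiding B M N) x) = x := by
  refine LinearMap.congr_fun (f := op22 (braiding B N M) ∘ₗ op22 (braiding B M N))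
    (g := LinearMap.id) (ext_three fun m n t => ?_) x
  have h2 : ∀ z : N ⊗[k] M, op22 (braiding B N M) (TensorProduct.assoc k N M T (z ⊗ₜ t))
      = TensorProduct.assoc k M N T (braiding B N M z ⊗ₜ t) := by
    intro z
    simp [op22]
  rw [LinearMap.comp_apply, op22_tmul, h2, ← LinearMap.comp_apply (braiding B N M), h]
  simp

end braid

/-! ### Braiding moves as rewrite rules -/

section rules
variable {k : Type*} [Field k] {B : Type*} [Ring B] [HopfAlgebra k B]
variable {M N P Q T : Type*} [AddCommGroup M] [Module k M] [YDModule k B M]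
  [AddCommGroup N] [Module k N] [YDModule k B N] [AddCommGroup P] [Module k P] [YDModule k B P]
  [AddCommGroup Q] [Module k Q] [YDModule k B Q] [AddCommGroup T] [Module k T]

local prefix:max "▹" => LinearMap.lTensor _

instance (f : M ⊗[k] N →ₗ[k] Q) [hf : Fact (IsYDHom B f)] :
    Rw (op22 (T := T) (braiding B Q P)) (op21 f)
      (▹(op21 f) ∘ₗ op22 (braiding B M P) ∘ₗ ▹(op22 (braiding B N P))) :=
  ⟨op22_braiding_op21_left hf.out⟩
instance (f : M ⊗[k] N →ₗ[k] Q) [hf : Fact (IsYDHom B f)] :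
    Rw (op22 (T := T) (braiding B P Q)) ▹(op21 f)
      (op21 f ∘ₗ ▹(op22 (braiding B P N)) ∘ₗ op22 (braiding B P M)) :=
  ⟨op22_braiding_op21_right hf.out⟩
instance (f : M →ₗ[k] Q) [hf : Fact (IsYDHom B f)] :
    Rw (op22 (T := T) (braiding B Q P)) (op11 f) (▹(op11 f) ∘ₗ op22 (braiding B M P)) :=
  ⟨op22_braiding_op11_left hf.out⟩
instance (f : M →ₗ[k] Q) [hf : Fact (IsYDHom B f)] :
    Rw (op22 (T := T) (braiding B P Q)) ▹(op11 f) (op11 f ∘ₗ op22 (braiding B P M)) :=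
  ⟨op22_braiding_op11_right hf.out⟩
instance (f : Q →ₗ[k] M ⊗[k] N) [hf : Fact (IsYDHom B f)] :
    Rw ▹(op12 f) (op22 (T := T) (braiding B Q P))
      (op22 (braiding B M P) ∘ₗ ▹(op22 (braiding B N P)) ∘ₗ op12 f) :=
  ⟨op22_braiding_op12_left hf.out⟩
instance (f : Q →ₗ[k] M ⊗[k] N) [hf : Fact (IsYDHom B f)] :
    Rw (op12 f) (op22 (T := T) (braiding B P Q))
      (▹(op22 (braiding B P N)) ∘ₗ op22 (braiding B P M) ∘ₗ ▹(op12 f)) :=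
  ⟨op22_braiding_op12_right hf.out⟩
instance (f : M →ₗ[k] k) [hf : Fact (IsYDHom B f)] :
    Rw ▹(op10 f) (op22 (T := T) (braiding B M P)) (op10 f) := ⟨op22_braiding_op10_left hf.out⟩
instance (f : M →ₗ[k] k) [hf : Fact (IsYDHom B f)] :
    Rw (op10 f) (op22 (T := T) (braiding (k := k) B P M)) ▹(op10 f) := ⟨op22_braiding_op10_right hf.out⟩
instance (a : M) [ha : Fact (IsYDHom B (LinearMap.toSpanSingleton k M a))] :
    Rw (op22 (T := T) (braiding (k := k) B M P)) (op01 a) ▹(op01 a) := ⟨op22_braiding_op01_left ha.out⟩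
instance (a : M) [ha : Fact (IsYDHom B (LinearMap.toSpanSingleton k M a))] :
    Rw (op22 (T := T) (braiding (k := k) B P M)) ▹(op01 a) (op01 a) := ⟨op22_braiding_op01_right ha.out⟩
instance : Rw₃ ▹(op22 (T := T) (braiding (k := k) B M N)) (op22 (braiding B M P)) ▹(op22 (braiding B N P))
    (op22 (braiding B N P) ∘ₗ ▹(op22 (braiding B M P)) ∘ₗ op22 (braiding B M N)) :=
  ⟨yang_baxter (k := k)⟩

end rules

/-! ### Passing between elements and strings -/

section tails
variable {k : Type*} [Field k]
variable {W X Y Z S T : Type*} [AddCommGroup W] [Module k W] [AddCommGroup X] [Module k X]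
  [AddCommGroup Y] [Module k Y] [AddCommGroup Z] [Module k Z] [AddCommGroup S] [Module k S]
  [AddCommGroup T] [Module k T]

local prefix:max "▹" => LinearMap.lTensor _

/-- Linear maps on `X ⊗ (Y ⊗ (Z ⊗ T))` agree if they agree on `x ⊗ (y ⊗ (z ⊗ t))`. -/
lemma ext_four {f g : X ⊗[k] (Y ⊗[k] (Z ⊗[k] T)) →ₗ[k] S}
    (h : ∀ x y z t, f (x ⊗ₜ (y ⊗ₜ (z ⊗ₜ t))) = g (x ⊗ₜ (y ⊗ₜ (z ⊗ₜ t)))) : f = g := by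
  ext x y z t
  exact h x y z t

lemma op21_assoc (f : X ⊗[k] Y →ₗ[k] Z) (z : X ⊗[k] Y) (t : T) :
    op21 f (TensorProduct.assoc k X Y T (z ⊗ₜ t)) = f z ⊗ₜ t := by simp [op21]

lemma op22_assoc (f : X ⊗[k] Y →ₗ[k] Z ⊗[k] W) (z : X ⊗[k] Y) (t : T) :
    op22 f (TensorProduct.assoc k X Y T (z ⊗ₜ t)) = TensorProduct.assoc k Z W T (f z ⊗ₜ t) := by
  simp [op22]

lemma op10_assoc (f : X →ₗ[k] k) (z : X ⊗[k] Y) (t : T) :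
    op10 f (TensorProduct.assoc k X Y T (z ⊗ₜ t)) = TensorProduct.lid k Y (f.rTensor Y z) ⊗ₜ t := by
  induction z with
  | zero => simp
  | add x y hx hy => simp only [map_add, TensorProduct.add_tmul, hx, hy]
  | tmul x y => simp [op10_tmul, TensorProduct.smul_tmul']

lemma lTensor_op10_assoc (f : Y →ₗ[k] k) (z : X ⊗[k] Y) (t : T) :
    ▹(op10 f) (TensorProduct.assoc k X Y T (z ⊗ₜ t))
      = TensorProduct.rid k X (f.lTensor X z) ⊗ₜ t := by
  induction z with
  | zero => simp
  | add x y hx hy => simp only [map_add, TensorProduct.add_tmul, hx, hy]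
  | tmul x y => simp [op10_tmul, TensorProduct.smul_tmul']

lemma op11_assoc (f : X →ₗ[k] Z) (z : X ⊗[k] Y) (t : T) :
    op11 f (TensorProduct.assoc k X Y T (z ⊗ₜ t))
      = TensorProduct.assoc k Z Y T (f.rTensor Y z ⊗ₜ t) := by
  induction z with
  | zero => simp
  | add x y hx hy => simp only [map_add, TensorProduct.add_tmul, hx, hy]
  | tmul x y => simp [op11_tmul]

lemma lTensor_op11_assoc (f : Y →ₗ[k] Z) (z : X ⊗[k] Y) (t : T) :
    ▹(op11 f) (TensorProduct.assoc k X Y T (z ⊗ₜ t))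
      = TensorProduct.assoc k X Z T (f.lTensor X z ⊗ₜ t) := by
  induction z with
  | zero => simp
  | add x y hx hy => simp only [map_add, TensorProduct.add_tmul, hx, hy]
  | tmul x y => simp [op11_tmul]

lemma op12_assoc (f : X →ₗ[k] Z ⊗[k] W) (z : X ⊗[k] Y) (t : T) :
    op12 f (TensorProduct.assoc k X Y T (z ⊗ₜ t))
      = ▹(TensorProduct.assoc k W Y T).toLinearMap (TensorProduct.assoc k Z (W ⊗[k] Y) T
        (TensorProduct.assoc k Z W Y (f.rTensor Y z) ⊗ₜ t)) := by
  induction z with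
  | zero => simp
  | add x y hx hy => simp only [map_add, TensorProduct.add_tmul, hx, hy]
  | tmul x y =>
    simp only [TensorProduct.assoc_tmul, LinearMap.rTensor_tmul, op12_tmul]
    generalize f x = z
    induction z with
    | zero => simp
    | add x y hx hy => simp only [map_add, TensorProduct.add_tmul, hx, hy]
    | tmul x y => simp

lemma lTensor_op12_assoc (f : Y →ₗ[k] Z ⊗[k] W) (z : X ⊗[k] Y) (t : T) :
    ▹(op12 f) (TensorProduct.assoc k X Y T (z ⊗ₜ t))
      = ▹(TensorProduct.assoc k Z W T).toLinearMap (TensorProduct.assoc k X (Z ⊗[k] W) T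
        (f.lTensor X z ⊗ₜ t)) := by
  induction z with
  | zero => simp
  | add x y hx hy => simp only [map_add, TensorProduct.add_tmul, hx, hy]
  | tmul x y => simp [op12_tmul]

variable (W X Y Z T) in
/-- The rebracketing `((W ⊗ X) ⊗ (Y ⊗ Z)) ⊗ T → W ⊗ (X ⊗ (Y ⊗ (Z ⊗ T)))`. -/
def flatten : ((W ⊗[k] X) ⊗[k] (Y ⊗[k] Z)) ⊗[k] T →ₗ[k] W ⊗[k] (X ⊗[k] (Y ⊗[k] (Z ⊗[k] T))) :=
  (TensorProduct.assoc k W X _).toLinearMap ∘ₗ ▹(TensorProduct.assoc k Y Z T).toLinearMap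
    ∘ₗ (TensorProduct.assoc k (W ⊗[k] X) (Y ⊗[k] Z) T).toLinearMap

lemma flatten_tmul (w : W) (x : X) (y : Y) (z : Z) (t : T) :
    flatten W X Y Z T (((w ⊗ₜ x) ⊗ₜ (y ⊗ₜ z)) ⊗ₜ t) = w ⊗ₜ (x ⊗ₜ (y ⊗ₜ[k] (z ⊗ₜ t))) := rfl

lemma op12_op12_tmul {S' : Type*} [AddCommGroup S'] [Module k S'] (f : S →ₗ[k] W ⊗[k] X)
    (g : S' →ₗ[k] Y ⊗[k] Z) (s : S) (s' : S') (t : T) :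
    ▹(▹(op12 g)) (op12 f (s ⊗ₜ (s' ⊗ₜ t))) = flatten W X Y Z T ((f s ⊗ₜ g s') ⊗ₜ t) := by
  rw [op12_tmul]
  generalize f s = z
  induction z with
  | zero => simp
  | add x y hx hy => simp only [map_add, TensorProduct.add_tmul, hx, hy]
  | tmul x y =>
    simp only [TensorProduct.assoc_tmul, LinearMap.lTensor_tmul, op12_tmul]
    generalize g s' = z
    induction z with
    | zero => simp
    | add x y hx hy => simp only [map_add, TensorProduct.add_tmul, TensorProduct.tmul_add, hx, hy]
    | tmul x y => simp [flatten_tmul]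

lemma op12_flatten (f : S →ₗ[k] W ⊗[k] X) (s : S) (y : Y) (z : Z) (t : T) :
    op12 f (s ⊗ₜ (y ⊗ₜ (z ⊗ₜ t))) = flatten W X Y Z T ((f s ⊗ₜ (y ⊗ₜ z)) ⊗ₜ t) := by
  rw [op12_tmul]
  generalize f s = z
  induction z with
  | zero => simp
  | add x y hx hy => simp only [map_add, TensorProduct.add_tmul, hx, hy]
  | tmul x y => simp [flatten_tmul]

lemma lTensor_lTensor_op12_flatten (f : S →ₗ[k] Y ⊗[k] Z) (s : S) (w : W) (x : X) (t : T) :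
    ▹(▹(op12 f)) (w ⊗ₜ (x ⊗ₜ (s ⊗ₜ t))) = flatten W X Y Z T (((w ⊗ₜ x) ⊗ₜ f s) ⊗ₜ t) := by
  simp only [LinearMap.lTensor_tmul, op12_tmul]
  generalize f s = z
  induction z with
  | zero => simp
  | add x y hx hy => simp only [map_add, TensorProduct.add_tmul, TensorProduct.tmul_add, hx, hy]
  | tmul x y => simp [flatten_tmul]

/-- An induction principle for `(W ⊗ X) ⊗ (Y ⊗ Z)`. -/
lemma induction_four {P : (W ⊗[k] X) ⊗[k] (Y ⊗[k] Z) → Prop} (v : (W ⊗[k] X) ⊗[k] (Y ⊗[k] Z))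
    (zero : P 0) (tmul : ∀ w x y z, P ((w ⊗ₜ x) ⊗ₜ (y ⊗ₜ z)))
    (add : ∀ a b, P a → P b → P (a + b)) : P v := by
  induction v with
  | zero => exact zero
  | add x y hx hy => exact add x y hx hy
  | tmul a b =>
  induction a with
  | zero => simpa
  | add x y hx hy => rw [TensorProduct.add_tmul]; exact add _ _ hx hy
  | tmul w x =>
  induction b with
  | zero => simpa
  | add x y hx hy => rw [TensorProduct.tmul_add]; exact add _ _ hx hy
  | tmul y z => exact tmul w x y z

lemma lTensor_op22_flatten (τ : X ⊗[k] Y →ₗ[k] Y ⊗[k] X) (v : (W ⊗[k] X) ⊗[k] (Y ⊗[k] Z)) (t : T) :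
    ▹(op22 τ) (flatten W X Y Z T (v ⊗ₜ t)) = flatten W Y X Z T (midMap W Z τ v ⊗ₜ t) := by
  induction v using induction_four with
  | zero => simp
  | add x y hx hy => simp only [map_add, TensorProduct.add_tmul, hx, hy]
  | tmul w x y z =>
    simp only [flatten_tmul, LinearMap.lTensor_tmul, op22_tmul, midMap, LinearMap.comp_apply,
      LinearEquiv.coe_coe, TensorProduct.assoc_tmul, TensorProduct.assoc_symm_tmul,
      LinearMap.rTensor_tmul]
    generalize τ _ = u
    induction u with
    | zero => simp
    | add x y hx hy => simp only [map_add, TensorProduct.add_tmul, TensorProduct.tmul_add, hx, hy]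
    | tmul x y => simp [flatten_tmul]

lemma op21_op21_flatten {S' : Type*} [AddCommGroup S'] [Module k S'] (f : W ⊗[k] X →ₗ[k] S)
    (g : Y ⊗[k] Z →ₗ[k] S') (v : (W ⊗[k] X) ⊗[k] (Y ⊗[k] Z)) (t : T) :
    op21 f (▹(▹(op21 g)) (flatten W X Y Z T (v ⊗ₜ t)))
      = TensorProduct.assoc k S S' T (TensorProduct.map f g v ⊗ₜ t) := by
  induction v using induction_four with
  | zero => simp
  | add x y hx hy => simp only [map_add, TensorProduct.add_tmul, hx, hy]
  | tmul w x y z => simp [flatten_tmul, op21_tmul]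

lemma op20_op20_flatten (f : W ⊗[k] X →ₗ[k] k) (g : Y ⊗[k] Z →ₗ[k] k)
    (v : (W ⊗[k] X) ⊗[k] (Y ⊗[k] Z)) (t : T) :
    op20 g (op20 f (flatten W X Y Z T (v ⊗ₜ t)))
      = TensorProduct.lid k k (TensorProduct.map f g v) • t := by
  induction v using induction_four with
  | zero => simp
  | add x y hx hy => simp only [map_add, TensorProduct.add_tmul, hx, hy, add_smul]
  | tmul w x y z => simp [flatten_tmul, op20_tmul, mul_smul]

/-- With tail `k`, an identity between strings becomes an identity between elements. -/
lemma tmul_one_injective {x y : X} (h : x ⊗ₜ[k] (1 : k) = y ⊗ₜ 1) : x = y := by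
  simpa using congrArg (TensorProduct.rid k X) h

end tails

/-! ### Twisted tensor products of algebras -/

section alg
variable {k : Type*} [Field k]
variable {A A' T W X Y Z X' Y' Z' : Type*} [AddCommGroup A] [Module k A] [AddCommGroup A']
  [Module k A'] [AddCommGroup T] [Module k T] [AddCommGroup W] [Module k W] [AddCommGroup X]
  [Module k X] [AddCommGroup Y] [Module k Y] [AddCommGroup Z] [Module k Z]
  [AddCommGroup X'] [Module k X'] [AddCommGroup Y'] [Module k Y']

local prefix:max "▹" => LinearMap.lTensor _

lemma lTensor_congr₂ {f : Y →ₗ[k] Z} {g : X →ₗ[k] Y} {f' : Y' →ₗ[k] Z} {g' : X →ₗ[k] Y'}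
    (h : ∀ x, f (g x) = f' (g' x)) (x : W ⊗[k] X) : ▹f (▹g x) = ▹f' (▹g' x) := by
  rw [← LinearMap.lTensor_comp_apply, ← LinearMap.lTensor_comp_apply,
    show f ∘ₗ g = f' ∘ₗ g' from LinearMap.ext h]

section
variable (X : AlgStr k A) [hX : Fact X.IsAlgebra]

instance : Rw (op21 (T := T) X.mul) ▹(op21 X.mul) (op21 X.mul ∘ₗ op21 X.mul) := ⟨fun x => by
  refine LinearMap.congr_fun (f := op21 X.mul ∘ₗ ▹(op21 X.mul)) (ext_four fun x y z t => ?_) x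
  simp [op21_tmul, hX.out.mul_assoc]⟩

instance : Rw (op21 (T := T) X.mul) (op01 X.one) LinearMap.id := ⟨fun x => by
  refine LinearMap.congr_fun (f := op21 X.mul ∘ₗ op01 X.one) (TensorProduct.ext' fun x t => ?_) x
  simp [op21_tmul, op01_apply, hX.out.one_mul]⟩

instance : Rw (op21 (T := T) X.mul) ▹(op01 X.one) LinearMap.id := ⟨fun x => by
  refine LinearMap.congr_fun (f := op21 X.mul ∘ₗ ▹(op01 X.one))
    (TensorProduct.ext' fun x t => ?_) x
  simp [op21_tmul, op01_apply, hX.out.mul_one]⟩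

end

/-- The relations under which `τ : A' ⊗ A → A ⊗ A'` defines an algebra structure on `A ⊗ A'`. -/
class IsTwist (X : outParam (AlgStr k A)) (Y : outParam (AlgStr k A'))
    (τ : A' ⊗[k] A →ₗ[k] A ⊗[k] A') : Prop where
  mul_right : ∀ x : A' ⊗[k] (A ⊗[k] (A ⊗[k] k)), op22 τ (▹(op21 X.mul) x)
    = op21 X.mul (▹(op22 τ) (op22 τ x))
  mul_left : ∀ x : A' ⊗[k] (A' ⊗[k] (A ⊗[k] k)), op22 τ (op21 Y.mul x)
    = ▹(op21 Y.mul) (op22 τ (▹(op22 τ) x))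
  one_right : ∀ x : A' ⊗[k] k, op22 τ (▹(op01 X.one) x) = op01 X.one x
  one_left : ∀ x : A ⊗[k] k, op22 τ (op01 Y.one x) = ▹(op01 Y.one) x

section
variable (X : AlgStr k A) (Y : AlgStr k A') (τ : A' ⊗[k] A →ₗ[k] A ⊗[k] A') [h : IsTwist X Y τ]

instance : Rw (op22 (T := T) τ) ▹(op21 X.mul) (op21 X.mul ∘ₗ ▹(op22 τ) ∘ₗ op22 τ) := ⟨fun x => by
  refine LinearMap.congr_fun (f := op22 τ ∘ₗ ▹(op21 X.mul)) (ext_four fun x y z t => ?_) x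
  -- An element of the tail `T` is a linear map `k → T`, so by interchange an identity with tail `k`
  -- holds for every tail.
  let s := LinearMap.toSpanSingleton k T t
  have e : x ⊗ₜ[k] (y ⊗ₜ[k] (z ⊗ₜ[k] t)) = ▹(▹(▹s)) (x ⊗ₜ (y ⊗ₜ (z ⊗ₜ (1 : k)))) := by simp [s]
  have h1 := fun x => (op21_nat X.mul s x).symm
  simp only [e, LinearMap.comp_apply, lTensor_congr₂ h1, op22_nat τ s, op22_nat τ (s.lTensor A),
    lTensor_congr₂ (op22_nat τ s), ← op21_nat X.mul (s.lTensor A'), h.mul_right]⟩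

instance : Rw (op22 (T := T) τ) (op21 Y.mul) (▹(op21 Y.mul) ∘ₗ op22 τ ∘ₗ ▹(op22 τ)) :=
  ⟨fun x => by
  refine LinearMap.congr_fun (f := op22 τ ∘ₗ op21 Y.mul) (ext_four fun x y z t => ?_) x
  let s := LinearMap.toSpanSingleton k T t
  have e : x ⊗ₜ[k] (y ⊗ₜ[k] (z ⊗ₜ[k] t)) = ▹(▹(▹s)) (x ⊗ₜ (y ⊗ₜ (z ⊗ₜ (1 : k)))) := by simp [s]
  have h1 := fun x => (op21_nat Y.mul s x).symm
  simp only [e, LinearMap.comp_apply, lTensor_congr₂ h1, op22_nat τ s, op22_nat τ (s.lTensor A'),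
    lTensor_congr₂ (op22_nat τ s), ← op21_nat Y.mul (s.lTensor A), h.mul_left]⟩

instance : Rw (op22 (T := T) τ) ▹(op01 X.one) (op01 X.one) := ⟨fun x => by
  refine LinearMap.congr_fun (f := op22 τ ∘ₗ ▹(op01 X.one)) (TensorProduct.ext' fun x t => ?_) x
  have h1 := h.one_right (x ⊗ₜ 1)
  simp only [LinearMap.lTensor_tmul, op01_apply, op22_tmul] at h1
  replace h1 := (TensorProduct.assoc k A A' k).injective (h1.trans
    (TensorProduct.assoc_tmul X.one x (1 : k)).symm)
  simp [op01_apply, op22_tmul, tmul_one_injective h1]⟩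

instance : Rw (op22 (T := T) τ) (op01 Y.one) ▹(op01 Y.one) := ⟨fun x => by
  refine LinearMap.congr_fun (f := op22 τ ∘ₗ op01 Y.one) (TensorProduct.ext' fun x t => ?_) x
  have h1 := h.one_left (x ⊗ₜ 1)
  simp only [LinearMap.lTensor_tmul, op01_apply, op22_tmul] at h1
  replace h1 := (TensorProduct.assoc k A A' k).injective (h1.trans
    (TensorProduct.assoc_tmul x Y.one (1 : k)).symm)
  simp [op01_apply, op22_tmul, tmul_one_injective h1]⟩

end

section
variable (X : AlgStr k A) (Y : AlgStr k A') (τ : A' ⊗[k] A →ₗ[k] A ⊗[k] A')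

/-- The product of `X.twisted Y τ` on strings. -/
def opTwist : A ⊗[k] (A' ⊗[k] (A ⊗[k] (A' ⊗[k] T))) →ₗ[k] A ⊗[k] (A' ⊗[k] T) :=
  op21 X.mul ∘ₗ ▹(▹(op21 Y.mul)) ∘ₗ ▹(op22 τ)

lemma assoc_op21_twisted (x : (A ⊗[k] A') ⊗[k] ((A ⊗[k] A') ⊗[k] T)) :
    TensorProduct.assoc k A A' T (op21 (X.twisted Y τ).mul x)
      = opTwist X Y τ (TensorProduct.assoc k A A' _
          (▹(TensorProduct.assoc k A A' T).toLinearMap x)) := by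
  obtain ⟨x, rfl⟩ := (TensorProduct.assoc k _ _ _).surjective x
  induction x with
  | zero => simp
  | add x y hx hy => simp only [map_add, hx, hy]
  | tmul x t =>
    have := op21_op21_flatten X.mul Y.mul (midMap A A' τ x) t
    rw [← lTensor_op22_flatten] at this
    simp only [flatten, LinearMap.comp_apply, LinearEquiv.coe_coe] at this
    simp [this, AlgStr.twisted, op21_assoc, opTwist]

lemma assoc_op01_twisted (x : T) : TensorProduct.assoc k A A' T (op01 (X.twisted Y τ).one x)
    = op01 X.one (op01 (k := k) Y.one x) := by
  simp [op01_apply, AlgStr.twisted]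

lemma assoc_lTensor (f : Z →ₗ[k] T) (x : (A ⊗[k] A') ⊗[k] Z) :
    TensorProduct.assoc k A A' T (▹f x) = ▹(▹f) (TensorProduct.assoc k A A' Z x) := by
  induction x with
  | zero => simp
  | add x y hx hy => simp only [map_add, hx, hy]
  | tmul x t =>
    induction x with
    | zero => simp
    | add x y hx hy => simp only [map_add, TensorProduct.add_tmul, hx, hy]
    | tmul x y => simp

/-- Since `τ` passes through products and units, both bracketings reduce to one normal form, in
which only associativity of the two factors remains. The rest of the proof is rebracketing. -/
theorem isAlgebra_twisted [IsTwist X Y τ] [Fact X.IsAlgebra] [Fact Y.IsAlgebra] :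
    (X.twisted Y τ).IsAlgebra := by
  set Q := X.twisted Y τ with hQ
  have key (x : A ⊗[k] (A' ⊗[k] (A ⊗[k] (A' ⊗[k] (A ⊗[k] (A' ⊗[k] k)))))) :
      opTwist X Y τ (opTwist X Y τ x) = opTwist X Y τ (▹(▹(opTwist X Y τ)) x) := by
    simp only [opTwist, Rw.eq, LinearMap.lTensor_comp, LinearMap.comp_apply]
  have h1 := assoc_op21_twisted X Y τ (T := k)
  refine ⟨fun a b c => ?_, fun a => ?_, fun a => ?_⟩
  · have : op21 Q.mul (op21 Q.mul (a ⊗ₜ (b ⊗ₜ (c ⊗ₜ (1 : k)))))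
        = op21 Q.mul (▹(op21 Q.mul) (a ⊗ₜ (b ⊗ₜ (c ⊗ₜ (1 : k))))) := by
      generalize a ⊗ₜ[k] (b ⊗ₜ[k] (c ⊗ₜ[k] (1 : k))) = x
      apply (TensorProduct.assoc k A A' k).injective
      have h2 : (TensorProduct.assoc k A A' k).toLinearMap ∘ₗ op21 Q.mul
        = opTwist X Y τ ∘ₗ (TensorProduct.assoc k A A' _).toLinearMap
          ∘ₗ ▹(TensorProduct.assoc k A A' k).toLinearMap := LinearMap.ext h1
      rw [h1, h1, op21_nat, assoc_op21_twisted, key,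
        ← LinearMap.lTensor_comp_apply _ _ (op21 Q.mul) x, h2]
      simp only [LinearMap.lTensor_comp, LinearMap.comp_apply, assoc_lTensor]
    simpa [op21_tmul] using tmul_one_injective this
  · have : op21 Q.mul (op01 Q.one (a ⊗ₜ (1 : k))) = a ⊗ₜ 1 := by
      generalize a ⊗ₜ[k] (1 : k) = x
      apply (TensorProduct.assoc k A A' k).injective
      rw [h1, ← op01_nat, assoc_op01_twisted]
      simp only [opTwist, LinearMap.comp_apply, LinearEquiv.coe_coe]
      generalize TensorProduct.assoc k A A' k x = y
      rw [← op01_nat, Rw.eq (f := op22 τ) (g := op01 Y.one), ← op01_nat,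
        lTensor_congr₂ (f' := LinearMap.id) (g' := LinearMap.id) (fun _ => Rw.eq _)]
      simp [Rw.eq]
    simpa [op21_tmul] using tmul_one_injective this
  · have : op21 Q.mul (▹(op01 Q.one) (a ⊗ₜ (1 : k))) = a ⊗ₜ 1 := by
      generalize a ⊗ₜ[k] (1 : k) = x
      apply (TensorProduct.assoc k A A' k).injective
      have h2 : (TensorProduct.assoc k A A' k).toLinearMap ∘ₗ op01 Q.one
        = op01 X.one ∘ₗ op01 Y.one := LinearMap.ext (assoc_op01_twisted X Y τ)
      rw [h1, ← LinearMap.lTensor_comp_apply, h2, assoc_lTensor]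
      generalize TensorProduct.assoc k A A' k x = y
      simp only [opTwist, LinearMap.comp_apply, LinearMap.lTensor_comp]
      rw [lTensor_congr₂ (f' := op01 X.one) (g' := LinearMap.id) (fun _ => Rw.eq _),
        lTensor_congr₂ (fun x => (op01_nat X.one (op21 Y.mul) x).symm)]
      simp [Rw.eq]
    simpa [op21_tmul, op01_apply] using tmul_one_injective this

end
end alg

/-! ### Hopf algebras, comodule algebras and pairings as rewrite rules -/

section rules
variable {k : Type*} [Field k] {B : Type*} [Ring B] [HopfAlgebra k B]
variable {D H R S T M N : Type*} [AddCommGroup D] [Module k D] [YDModule k B D]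
  [AddCommGroup H] [Module k H] [YDModule k B H] [AddCommGroup R] [Module k R] [YDModule k B R]
  [AddCommGroup T] [Module k T] [AddCommGroup M] [Module k M] [YDModule k B M]
  [AddCommGroup N] [Module k N] [YDModule k B N]

local prefix:max "▹" => LinearMap.lTensor _

section hopf
variable (𝓗 : BraidedHopfAlgebra k B H)

instance : Fact 𝓗.toAlgStr.IsAlgebra := ⟨𝓗.isYDAlgebra.toIsAlgebra⟩
instance : Fact (𝓗.toAlgStr.IsYDAlgebra B) := ⟨𝓗.isYDAlgebra⟩
instance (X : AlgStr k R) [h : Fact (X.IsYDAlgebra B)] : Fact (IsYDHom B X.mul) := ⟨h.out.mul_hom⟩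
instance (X : AlgStr k R) [h : Fact (X.IsYDAlgebra B)] :
    Fact (IsYDHom B (LinearMap.toSpanSingleton k R X.one)) := ⟨h.out.one_hom⟩
instance : Fact (IsYDHom B 𝓗.comul) := ⟨𝓗.comul_hom⟩
instance : Fact (IsYDHom B 𝓗.counit) := ⟨𝓗.counit_hom⟩
instance : Fact (IsYDHom B 𝓗.antipode) := ⟨𝓗.antipode_hom⟩

instance : Rw ▹(op12 (T := T) 𝓗.comul) (op12 𝓗.comul) (op12 𝓗.comul ∘ₗ op12 𝓗.comul) :=
  ⟨fun x => by
  refine LinearMap.congr_fun (f := ▹(op12 𝓗.comul) ∘ₗ op12 𝓗.comul)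
    (TensorProduct.ext' fun x t => ?_) x
  simp only [LinearMap.comp_apply, op12_tmul, op12_assoc, lTensor_op12_assoc, 𝓗.coassoc]⟩

instance : Rw (op10 (T := H ⊗[k] T) 𝓗.counit) (op12 𝓗.comul) LinearMap.id := ⟨fun x => by
  refine LinearMap.congr_fun (f := op10 𝓗.counit ∘ₗ op12 𝓗.comul)
    (TensorProduct.ext' fun x t => ?_) x
  simp [op12_tmul, op10_assoc, 𝓗.counit_comul]⟩

instance : Rw ▹(op10 (T := T) 𝓗.counit) (op12 𝓗.comul) LinearMap.id := ⟨fun x => by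
  refine LinearMap.congr_fun (f := ▹(op10 𝓗.counit) ∘ₗ op12 𝓗.comul)
    (TensorProduct.ext' fun x t => ?_) x
  simp [op12_tmul, lTensor_op10_assoc, 𝓗.comul_counit]⟩

instance : Rw (op12 (T := T) 𝓗.comul) (op21 𝓗.mul) (op21 𝓗.mul ∘ₗ ▹(▹(op21 𝓗.mul)) ∘ₗ
    ▹(op22 (braiding B H H)) ∘ₗ ▹(▹(op12 𝓗.comul)) ∘ₗ op12 𝓗.comul) := ⟨fun x => by
  refine LinearMap.congr_fun (f := op12 𝓗.comul ∘ₗ op21 𝓗.mul) (ext_three fun x y t => ?_) x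
  simp only [LinearMap.comp_apply, op21_tmul, op12_tmul 𝓗.comul (𝓗.mul _), 𝓗.comul_mul,
    op12_op12_tmul, lTensor_op22_flatten, op21_op21_flatten, AlgStr.tensor, AlgStr.twisted,
    TensorProduct.map_tmul]⟩

instance : Rw (op12 (T := T) 𝓗.comul) (op01 𝓗.one) (op01 𝓗.one ∘ₗ op01 𝓗.one) := ⟨fun x => by
  simp [op01_apply, op12_tmul, 𝓗.comul_one]⟩

instance : Rw (op10 (T := T) 𝓗.counit) (op21 𝓗.mul) (op10 𝓗.counit ∘ₗ op10 𝓗.counit) :=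
  ⟨fun x => by
  refine LinearMap.congr_fun (f := op10 𝓗.counit ∘ₗ op21 𝓗.mul) (ext_three fun x y t => ?_) x
  simp [op21_tmul, op10_tmul, 𝓗.counit_mul, mul_smul, smul_comm (𝓗.counit x)]⟩

instance : Rw₃ (op21 (T := T) 𝓗.mul) (op11 𝓗.antipode) (op12 𝓗.comul)
    (op01 𝓗.one ∘ₗ op10 𝓗.counit) := ⟨fun x => by
  refine LinearMap.congr_fun (f := op21 𝓗.mul ∘ₗ op11 𝓗.antipode ∘ₗ op12 𝓗.comul)
    (TensorProduct.ext' fun x t => ?_) x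
  simp [op12_tmul, op11_assoc, op21_assoc, 𝓗.antipode_comul, op10_tmul, op01_apply,
    TensorProduct.smul_tmul']⟩

instance : Rw₃ (op21 (T := T) 𝓗.mul) ▹(op11 𝓗.antipode) (op12 𝓗.comul)
    (op01 𝓗.one ∘ₗ op10 𝓗.counit) := ⟨fun x => by
  refine LinearMap.congr_fun (f := op21 𝓗.mul ∘ₗ ▹(op11 𝓗.antipode) ∘ₗ op12 𝓗.comul)
    (TensorProduct.ext' fun x t => ?_) x
  simp [op12_tmul, lTensor_op11_assoc, op21_assoc, 𝓗.comul_antipode, op10_tmul, op01_apply,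
    TensorProduct.smul_tmul']⟩

end hopf

section comodule
variable {𝓓 : BraidedHopfAlgebra k B D} {𝓗 : BraidedHopfAlgebra k B H} {X : AlgStr k R}

/-- `IsComoduleAlgebra`, as a class determined by the coaction. -/
class ComoduleAlgebra {k : Type*} [Field k] {B : outParam (Type*)} {_ : outParam (Ring B)}
    {_ : outParam (HopfAlgebra k B)} {H R : Type*} [AddCommGroup H] [Module k H]
    [iH : outParam (YDModule k B H)] [AddCommGroup R] [Module k R] [iR : outParam (YDModule k B R)]
    (𝓗 : outParam (BraidedHopfAlgebra k B H)) (X : outParam (AlgStr k R))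
    (ψ : R →ₗ[k] R ⊗[k] H) : Prop where
  out : IsComoduleAlgebra 𝓗 X ψ

variable (ψ : R →ₗ[k] R ⊗[k] H) [h : ComoduleAlgebra 𝓗 X ψ]

instance : Fact (IsYDHom B ψ) := ⟨h.out.hom⟩

instance : Rw ▹(op12 (T := T) 𝓗.comul) (op12 ψ) (op12 ψ ∘ₗ op12 ψ) :=
  ⟨fun x => by
  refine LinearMap.congr_fun (f := ▹(op12 𝓗.comul) ∘ₗ op12 ψ)
    (TensorProduct.ext' fun x t => ?_) x
  simp only [LinearMap.comp_apply, op12_tmul, op12_assoc, lTensor_op12_assoc, h.out.coassoc]⟩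

instance : Rw ▹(op10 (T := T) 𝓗.counit) (op12 ψ) LinearMap.id := ⟨fun x => by
  refine LinearMap.congr_fun (f := ▹(op10 𝓗.counit) ∘ₗ op12 ψ)
    (TensorProduct.ext' fun x t => ?_) x
  simp [op12_tmul, lTensor_op10_assoc, h.out.counit]⟩

instance : Rw (op12 (T := T) ψ) (op21 X.mul) (op21 X.mul ∘ₗ ▹(▹(op21 𝓗.mul)) ∘ₗ
    ▹(op22 (braiding B H R)) ∘ₗ ▹(▹(op12 ψ)) ∘ₗ op12 ψ) := ⟨fun x => by
  refine LinearMap.congr_fun (f := op12 ψ ∘ₗ op21 X.mul) (ext_three fun x y t => ?_) x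
  simp only [LinearMap.comp_apply, op21_tmul, op12_tmul ψ (X.mul _), h.out.map_mul,
    op12_op12_tmul, lTensor_op22_flatten, op21_op21_flatten, AlgStr.tensor, AlgStr.twisted,
    TensorProduct.map_tmul]⟩

instance : Rw (op12 (T := T) ψ) (op01 X.one) (op01 X.one ∘ₗ op01 𝓗.one) := ⟨fun x => by
  simp [op01_apply, op12_tmul, h.out.map_one]⟩

end comodule

section pairing
variable {𝓓 : BraidedHopfAlgebra k B D} {𝓗 : BraidedHopfAlgebra k B H}

/-- A morphism `q : D ⊗ H → k` in the category of Yetter-Drinfeld modules under which the algebra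
and coalgebra structures of `D` and `H` are dual to each other. -/
class BialgebraPairing (𝓓 : outParam (BraidedHopfAlgebra k B D))
    (𝓗 : outParam (BraidedHopfAlgebra k B H)) (q : D ⊗[k] H →ₗ[k] k) : Prop where
  hom : IsYDHom B q
  pair_mul : ∀ x : D ⊗[k] (H ⊗[k] (H ⊗[k] k)), op20 q (▹(op21 𝓗.mul) x)
    = op20 q (op20 q (▹(op22 (braiding B D H)) (op12 𝓓.comul x)))
  mul_pair : ∀ x : D ⊗[k] (D ⊗[k] (H ⊗[k] k)), op20 q (op21 𝓓.mul x)
    = op20 q (op20 q (▹(op22 (braiding B D H)) (▹(▹(op12 𝓗.comul)) x)))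
  pair_one : ∀ f : D, q (f ⊗ₜ 𝓗.one) = 𝓓.counit f
  one_pair : ∀ x : H, q (𝓓.one ⊗ₜ x) = 𝓗.counit x

lemma IsHopfPairing.bialgebraPairing {q : D ⊗[k] H →ₗ[k] k} (hq : IsYDHom B q)
    (h : IsHopfPairing 𝓓 𝓗 q) : BialgebraPairing 𝓓 𝓗 q where
  hom := hq
  pair_mul x := by
    refine LinearMap.congr_fun (f := op20 q ∘ₗ ▹(op21 𝓗.mul))
      (g := op20 q ∘ₗ op20 q ∘ₗ ▹(op22 (braiding B D H)) ∘ₗ op12 𝓓.comul)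
      (ext_four fun x y z t => ?_) x
    simp only [LinearMap.comp_apply, LinearMap.lTensor_tmul, op21_tmul, op20_tmul, h.pair_mul,
      op12_flatten, lTensor_op22_flatten, op20_op20_flatten]
    simp [pairing₂]
  mul_pair x := by
    refine LinearMap.congr_fun (f := op20 q ∘ₗ op21 𝓓.mul)
      (g := op20 q ∘ₗ op20 q ∘ₗ ▹(op22 (braiding B D H)) ∘ₗ ▹(▹(op12 𝓗.comul)))
      (ext_four fun x y z t => ?_) x
    simp only [LinearMap.comp_apply, lTensor_lTensor_op12_flatten, op21_tmul, op20_tmul,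
      h.mul_pair, lTensor_op22_flatten, op20_op20_flatten]
    simp [pairing₂]
  pair_one := h.pair_one
  one_pair := h.one_pair

variable (q : D ⊗[k] H →ₗ[k] k) [h : BialgebraPairing 𝓓 𝓗 q]

instance : Fact (IsYDHom B q) := ⟨h.hom⟩

instance : Rw (op20 (T := T) q) ▹(op21 𝓗.mul)
    (op20 q ∘ₗ op20 q ∘ₗ ▹(op22 (braiding B D H)) ∘ₗ op12 𝓓.comul) := ⟨fun x => by
  refine LinearMap.congr_fun (f := op20 q ∘ₗ ▹(op21 𝓗.mul)) (ext_four fun x y z t => ?_) x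
  let s := LinearMap.toSpanSingleton k T t
  have e : x ⊗ₜ[k] (y ⊗ₜ[k] (z ⊗ₜ[k] t)) = ▹(▹(▹s)) (x ⊗ₜ (y ⊗ₜ (z ⊗ₜ (1 : k)))) := by simp [s]
  have h1 := fun x => (op21_nat 𝓗.mul s x).symm
  simp only [e, LinearMap.comp_apply, lTensor_congr₂ h1, op12_nat,
    lTensor_congr₂ (op22_nat (braiding B D H) (s.lTensor H)), ← op20_nat, h.pair_mul]⟩

instance : Rw (op20 (T := T) q) (op21 𝓓.mul)
    (op20 q ∘ₗ op20 q ∘ₗ ▹(op22 (braiding B D H)) ∘ₗ ▹(▹(op12 𝓗.comul))) := ⟨fun x => by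
  refine LinearMap.congr_fun (f := op20 q ∘ₗ op21 𝓓.mul) (ext_four fun x y z t => ?_) x
  let s := LinearMap.toSpanSingleton k T t
  have e : x ⊗ₜ[k] (y ⊗ₜ[k] (z ⊗ₜ[k] t)) = ▹(▹(▹s)) (x ⊗ₜ (y ⊗ₜ (z ⊗ₜ (1 : k)))) := by simp [s]
  simp only [e, LinearMap.comp_apply, ← op21_nat 𝓓.mul (s.lTensor H),
    lTensor_congr₂ (lTensor_congr₂ (op12_nat 𝓗.comul s)),
    lTensor_congr₂ (op22_nat (braiding B D H) (s.lTensor H)), ← op20_nat, h.mul_pair]⟩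

instance : Rw (op20 (T := T) q) ▹(op01 𝓗.one) (op10 𝓓.counit) := ⟨fun x => by
  refine LinearMap.congr_fun (f := op20 q ∘ₗ ▹(op01 𝓗.one)) (TensorProduct.ext' fun x t => ?_) x
  simp [op20_tmul, op01_apply, op10_tmul, h.pair_one]⟩

instance : Rw (op20 (T := T) q) (op01 𝓓.one) (op10 𝓗.counit) := ⟨fun x => by
  refine LinearMap.congr_fun (f := op20 q ∘ₗ op01 𝓓.one) (TensorProduct.ext' fun x t => ?_) x
  simp [op20_tmul, op01_apply, op10_tmul, h.one_pair]⟩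

end pairing

/-! ### From coactions to actions along a pairing -/

section action

/-- The action `(R ⊗ q)(C_{D,R} ⊗ H)(D ⊗ ψ)`. -/
def actionOfCoaction (q : D ⊗[k] H →ₗ[k] k) (ψ : R →ₗ[k] R ⊗[k] H) : D ⊗[k] R →ₗ[k] R :=
  (TensorProduct.rid k R).toLinearMap ∘ₗ q.lTensor R
    ∘ₗ (TensorProduct.assoc k R D H).toLinearMap ∘ₗ (braiding B D R).rTensor H
    ∘ₗ (TensorProduct.assoc k D R H).symm.toLinearMap ∘ₗ ψ.lTensor D

variable (q : D ⊗[k] H →ₗ[k] k) (ψ : R →ₗ[k] R ⊗[k] H)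

omit [YDModule k B H] in
lemma op21_actionOfCoaction : op21 (T := T) (actionOfCoaction (B := B) q ψ)
    = ▹(op20 q) ∘ₗ op22 (braiding B D R) ∘ₗ ▹(op12 ψ) := by
  refine ext_three fun d r t => ?_
  simp only [LinearMap.comp_apply, LinearMap.lTensor_tmul, op12_tmul, op21_tmul, actionOfCoaction,
    LinearEquiv.coe_coe]
  generalize ψ r = z
  induction z with
  | zero => simp
  | add x y hx hy => simp only [map_add, TensorProduct.add_tmul, TensorProduct.tmul_add, hx, hy]
  | tmul r h =>
    simp only [TensorProduct.assoc_tmul, TensorProduct.assoc_symm_tmul, op22_tmul,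
      LinearMap.rTensor_tmul]
    generalize braiding (k := k) B D R _ = z
    induction z with
    | zero => simp
    | add x y hx hy => simp only [map_add, TensorProduct.add_tmul, hx, hy]
    | tmul r d => simp [op20_tmul, TensorProduct.smul_tmul']

lemma IsYDHom.actionOfCoaction {q : D ⊗[k] H →ₗ[k] k} {ψ : R →ₗ[k] R ⊗[k] H}
    (hq : IsYDHom B q) (hψ : IsYDHom B ψ) : IsYDHom B (actionOfCoaction (B := B) q ψ) :=
  rid.comp (hq.lTensor.comp (assoc.comp ((IsYDHom.braiding B D R).rTensor.comp
    (assoc_symm.comp hψ.lTensor))))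

/-- This runs against the orientation of the rules: a pairing is a morphism to the unit object, so a
strand of `R` may be pulled across it. The new crossings make Yang–Baxter applicable. -/
lemma op20_eq_braiding_left {f : M ⊗[k] N →ₗ[k] k} (hf : IsYDHom B f) :
    op20 (T := R ⊗[k] T) f = ▹(op20 f) ∘ₗ op22 (braiding B M R) ∘ₗ ▹(op22 (braiding B N R)) :=
  LinearMap.ext fun x => (op22_braiding_op20_left hf x).symm

lemma op20_eq_braiding_right {f : M ⊗[k] N →ₗ[k] k} (hf : IsYDHom B f) :
    LinearMap.lTensor R (op20 (T := T) f)
      = op20 f ∘ₗ ▹(op22 (braiding B R N)) ∘ₗ op22 (braiding B R M) :=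
  LinearMap.ext fun x => (op22_braiding_op20_right hf x).symm

/-- A right comodule algebra over `H` is a left module algebra over every `D` paired with `H`. -/
theorem isModuleAlgebra_actionOfCoaction {𝓓 : BraidedHopfAlgebra k B D}
    {𝓗 : BraidedHopfAlgebra k B H} {X : AlgStr k R} [hq : BialgebraPairing 𝓓 𝓗 q]
    [hψ : ComoduleAlgebra 𝓗 X ψ] :
    IsModuleAlgebra 𝓓 X (actionOfCoaction (B := B) q ψ) := by
  have hX : Fact (X.IsYDAlgebra B) := ⟨hψ.out.isYDAlgebra⟩
  refine ⟨hX.out, hq.hom.actionOfCoaction hψ.out.hom, fun r => ?_, fun x y r => ?_, fun x t => ?_,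
    fun x => ?_⟩
  · have : op21 (actionOfCoaction (B := B) q ψ) (op01 𝓓.one (r ⊗ₜ[k] (1 : k))) = r ⊗ₜ 1 := by
      simp only [op21_actionOfCoaction, LinearMap.comp_apply]
      rw [← op01_nat, Rw.eq (f := op22 (braiding B D R)) (g := op01 𝓓.one), ← LinearMap.lTensor_comp_apply,
        show op20 q ∘ₗ op01 𝓓.one = op10 (T := k) 𝓗.counit from LinearMap.ext fun x => Rw.eq (f := op20 q) x]
      simp [Rw.eq]
    simpa [op21_tmul, op01_apply] using tmul_one_injective this
  · have (x : D ⊗[k] (D ⊗[k] (R ⊗[k] k))) :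
        op21 (actionOfCoaction (B := B) q ψ) (op21 𝓓.mul x) = op21 (actionOfCoaction (B := B) q ψ)
          (▹(op21 (actionOfCoaction (B := B) q ψ)) x) := by
      simp only [op21_actionOfCoaction, Rw.eq, LinearMap.lTensor_comp, LinearMap.comp_apply]
    simpa [op21_tmul] using tmul_one_injective (this (x ⊗ₜ (y ⊗ₜ (r ⊗ₜ 1))))
  · have (x : D ⊗[k] (R ⊗[k] (R ⊗[k] k))) :
        op21 (actionOfCoaction (B := B) q ψ) (▹(op21 X.mul) x) =
        op21 X.mul (op21 (actionOfCoaction (B := B) q ψ)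
          (▹(▹(op21 (actionOfCoaction (B := B) q ψ)))
            (▹(op22 (braiding B D R)) (op12 𝓓.comul x)))) := by
      simp only [op21_actionOfCoaction, Rw.eq, LinearMap.lTensor_comp, LinearMap.comp_apply]
      -- The normal forms still differ by crossings. Pulling a strand of `R` across the pairing and
      -- applying Yang–Baxter makes them agree.
      rw [op20_eq_braiding_left (R := R) (B := B) hq.hom]
      simp only [Rw.eq, LinearMap.lTensor_comp, LinearMap.comp_apply]
      rw [← lTensor_congr₂ (op22_nat (braiding B D R) (op22 (braiding B D H)))]
      simp only [Rw₃.eq, LinearMap.lTensor_comp, LinearMap.comp_apply]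
    induction t with
    | zero => simp
    | add y z hy hz => simp only [map_add, TensorProduct.tmul_add, hy, hz]
    | tmul r s =>
    have := this (x ⊗ₜ (r ⊗ₜ (s ⊗ₜ 1)))
    rw [op12_flatten, lTensor_op22_flatten, op21_op21_flatten, op21_assoc, LinearMap.lTensor_tmul,
      op21_tmul, op21_tmul] at this
    exact tmul_one_injective this
  · have : op21 (actionOfCoaction (B := B) q ψ) (▹(op01 X.one) (x ⊗ₜ[k] (1 : k)))
        = op01 X.one (op10 𝓓.counit (x ⊗ₜ 1)) := by
      simp only [op21_actionOfCoaction, Rw.eq, LinearMap.lTensor_comp, LinearMap.comp_apply]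
      rw [op22_nat, Rw.eq (f := op22 (braiding B D R)), ← op01_nat, ← op01_nat, Rw.eq (f := op20 q),
        op10_nat]
    simp only [LinearMap.lTensor_tmul, op01_apply, op21_tmul, op10_tmul] at this
    apply tmul_one_injective (k := k)
    rw [this, TensorProduct.tmul_smul, TensorProduct.smul_tmul']

end action
end rules

/-! ### Module algebras and smash products -/

section moduleAlgebra
variable {k : Type*} [Field k] {B : Type*} [Ring B] [HopfAlgebra k B]
variable {D H R S T M N : Type*} [AddCommGroup D] [Module k D] [YDModule k B D]
  [AddCommGroup H] [Module k H] [YDModule k B H] [AddCommGroup R] [Module k R] [YDModule k B R]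
  [AddCommGroup T] [Module k T] [AddCommGroup S] [Module k S] [YDModule k B S]

local prefix:max "▹" => LinearMap.lTensor _

/-- `IsModuleAlgebra`, as a class determined by the action. -/
class ModuleAlgebra {k : Type*} [Field k] {B : outParam (Type*)} {_ : outParam (Ring B)}
    {_ : outParam (HopfAlgebra k B)} {H R : Type*} [AddCommGroup H] [Module k H]
    [iH : outParam (YDModule k B H)] [AddCommGroup R] [Module k R] [iR : outParam (YDModule k B R)]
    (𝓗 : outParam (BraidedHopfAlgebra k B H)) (X : outParam (AlgStr k R))
    (α : H ⊗[k] R →ₗ[k] R) : Prop where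
  out : IsModuleAlgebra 𝓗 X α

section
variable {𝓗 : BraidedHopfAlgebra k B H} {X : AlgStr k R} (α : H ⊗[k] R →ₗ[k] R)
  [h : ModuleAlgebra 𝓗 X α]

instance : Fact (IsYDHom B α) := ⟨h.out.hom⟩

instance : Rw (op21 (T := T) α) (op21 𝓗.mul) (op21 α ∘ₗ ▹(op21 α)) := ⟨fun x => by
  refine LinearMap.congr_fun (f := op21 α ∘ₗ op21 𝓗.mul) (ext_four fun x y z t => ?_) x
  simp [op21_tmul, h.out.mul_act]⟩

instance : Rw (op21 (T := T) α) (op01 𝓗.one) LinearMap.id := ⟨fun x => by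
  refine LinearMap.congr_fun (f := op21 α ∘ₗ op01 𝓗.one) (TensorProduct.ext' fun x t => ?_) x
  simp [op21_tmul, op01_apply, h.out.one_act]⟩

instance : Rw (op21 (T := T) α) ▹(op01 X.one) (op01 X.one ∘ₗ op10 𝓗.counit) := ⟨fun x => by
  refine LinearMap.congr_fun (f := op21 α ∘ₗ ▹(op01 X.one)) (TensorProduct.ext' fun x t => ?_) x
  simp [op21_tmul, op01_apply, op10_tmul, h.out.act_one, TensorProduct.smul_tmul']⟩

instance : Rw (op21 (T := T) α) ▹(op21 X.mul) (op21 X.mul ∘ₗ op21 α ∘ₗ ▹(▹(op21 α)) ∘ₗ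
    ▹(op22 (braiding B H R)) ∘ₗ op12 𝓗.comul) := ⟨fun x => by
  refine LinearMap.congr_fun (f := op21 α ∘ₗ ▹(op21 X.mul)) (ext_four fun x y z t => ?_) x
  simp only [LinearMap.comp_apply, op12_flatten, lTensor_op22_flatten, op21_op21_flatten,
    op21_assoc, LinearMap.lTensor_tmul, op21_tmul, h.out.act_mul]⟩
end

/-- The twist `x ⊗ a ↦ (x₁ ⇀ a') ⊗ x₂'` of the smash product. -/
def smashTwist (𝓗 : BraidedHopfAlgebra k B H) (α : H ⊗[k] R →ₗ[k] R) :
    H ⊗[k] R →ₗ[k] R ⊗[k] H :=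
  α.rTensor H ∘ₗ (TensorProduct.assoc k H R H).symm.toLinearMap
      ∘ₗ (braiding B H R).lTensor H ∘ₗ (TensorProduct.assoc k H H R).toLinearMap
      ∘ₗ 𝓗.comul.rTensor R

variable (𝓗 : BraidedHopfAlgebra k B H) (α : H ⊗[k] R →ₗ[k] R)

lemma op22_smashTwist : op22 (T := T) (smashTwist 𝓗 α)
    = op21 α ∘ₗ ▹(op22 (braiding B H R)) ∘ₗ op12 𝓗.comul := by
  refine ext_three fun x r t => ?_
  simp only [LinearMap.comp_apply, op12_tmul, op22_tmul, smashTwist, LinearMap.rTensor_tmul,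
    LinearEquiv.coe_coe]
  generalize 𝓗.comul x = z
  induction z with
  | zero => simp
  | add x y hx hy => simp only [map_add, TensorProduct.add_tmul, hx, hy]
  | tmul x y =>
    simp only [TensorProduct.assoc_tmul, op22_tmul, LinearMap.lTensor_tmul]
    generalize braiding (k := k) B H R _ = z
    induction z with
    | zero => simp
    | add x y hx hy => simp only [map_add, TensorProduct.add_tmul, TensorProduct.tmul_add, hx, hy]
    | tmul r y => simp [op21_tmul]

lemma IsYDHom.smashTwist {α : H ⊗[k] R →ₗ[k] R} (hα : IsYDHom B α) :
    IsYDHom B (smashTwist 𝓗 α) :=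
  hα.rTensor.comp (assoc_symm.comp ((IsYDHom.braiding B H R).lTensor.comp
    (assoc.comp 𝓗.comul_hom.rTensor)))

/-- Products of `R` pass because `α` distributes over them through the coproduct, which is
coassociative; products of `H` pass because the coproduct is multiplicative and `α` is an action. -/
theorem isTwist_smashTwist {X : AlgStr k R} [h : ModuleAlgebra 𝓗 X α] :
    IsTwist X 𝓗.toAlgStr (smashTwist 𝓗 α) where
  mul_right x := by
    have hX : Fact (X.IsYDAlgebra B) := ⟨h.out.isYDAlgebra⟩
    simp only [op22_smashTwist, Rw.eq, LinearMap.lTensor_comp, LinearMap.comp_apply]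
  mul_left x := by
    simp only [op22_smashTwist, Rw.eq, LinearMap.lTensor_comp, LinearMap.comp_apply]
  one_right x := by
    have hX : Fact (X.IsYDAlgebra B) := ⟨h.out.isYDAlgebra⟩
    simp only [op22_smashTwist, Rw.eq, LinearMap.comp_apply, LinearMap.id_apply]
  one_left x := by
    simp only [op22_smashTwist, Rw.eq, LinearMap.comp_apply]
    rw [← op01_nat, Rw.eq (f := op21 α), LinearMap.id_apply]

/-- For the braiding the twist relations are naturality and the hexagons, applied to multiplications
and units that are morphisms. -/
theorem isTwist_braiding (X : AlgStr k R) (Y : AlgStr k S) [Fact (X.IsYDAlgebra B)]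
    [Fact (Y.IsYDAlgebra B)] : IsTwist X Y (braiding B S R) where
  mul_right x := by
    simp only [Rw.eq, LinearMap.comp_apply]
  mul_left x := by
    simp only [Rw.eq, LinearMap.comp_apply]
  one_right x := by
    simp only [Rw.eq]
  one_left x := by
    simp only [Rw.eq]

lemma IsYDHom.midMap {W X Y Z : Type*} [AddCommGroup W] [Module k W] [YDModule k B W]
    [AddCommGroup X] [Module k X] [YDModule k B X] [AddCommGroup Y] [Module k Y] [YDModule k B Y]
    [AddCommGroup Z] [Module k Z] [YDModule k B Z] {τ : X ⊗[k] Y →ₗ[k] Y ⊗[k] X}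
    (hτ : IsYDHom B τ) : IsYDHom B (midMap W Z τ) :=
  assoc_symm.comp ((assoc.comp (hτ.rTensor.comp assoc_symm)).lTensor.comp assoc)

lemma isYDHom_toSpanSingleton_tmul {a : R} {b : S}
    (ha : IsYDHom B (LinearMap.toSpanSingleton k R a))
    (hb : IsYDHom B (LinearMap.toSpanSingleton k S b)) :
    IsYDHom B (LinearMap.toSpanSingleton k (R ⊗[k] S) (a ⊗ₜ b)) := by
  have e : LinearMap.toSpanSingleton k (R ⊗[k] S) (a ⊗ₜ b)
    = TensorProduct.map (LinearMap.toSpanSingleton k R a) (LinearMap.toSpanSingleton k S b)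
      ∘ₗ (TensorProduct.lid k k).symm.toLinearMap := by
    ext; simp
  rw [e]
  exact (ha.map hb).comp IsYDHom.lid.symm

theorem isYDAlgebra_twisted (X : AlgStr k R) (Y : AlgStr k S) {τ : S ⊗[k] R →ₗ[k] R ⊗[k] S}
    [hX : Fact (X.IsYDAlgebra B)] [hY : Fact (Y.IsYDAlgebra B)] (h : IsTwist X Y τ)
    (hτ : IsYDHom B τ) : (X.twisted Y τ).IsYDAlgebra B where
  toIsAlgebra := by
    have : Fact X.IsAlgebra := ⟨hX.out.toIsAlgebra⟩
    have : Fact Y.IsAlgebra := ⟨hY.out.toIsAlgebra⟩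
    exact isAlgebra_twisted X Y τ
  mul_hom := (hX.out.mul_hom.map hY.out.mul_hom).comp hτ.midMap
  one_hom := isYDHom_toSpanSingleton_tmul hX.out.one_hom hY.out.one_hom

theorem isYDAlgebra_tensor (X : AlgStr k R) (Y : AlgStr k S)
    [hX : Fact (X.IsYDAlgebra B)] [hY : Fact (Y.IsYDAlgebra B)] :
    (X.tensor B Y).IsYDAlgebra B :=
  isYDAlgebra_twisted X Y (isTwist_braiding X Y) (IsYDHom.braiding B S R)

theorem isYDAlgebra_smash {X : AlgStr k R} [h : ModuleAlgebra 𝓗 X α] :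
    (smash 𝓗 X α).IsYDAlgebra B := by
  have hX : Fact (X.IsYDAlgebra B) := ⟨h.out.isYDAlgebra⟩
  exact isYDAlgebra_twisted X 𝓗.toAlgStr (isTwist_smashTwist 𝓗 α) (h.out.hom.smashTwist 𝓗)

end moduleAlgebra

/-! ### The smash product as a comodule algebra -/

section smashComodule
variable {k : Type*} [Field k] {B : Type*} [Ring B] [HopfAlgebra k B]
variable {D H R T : Type*} [AddCommGroup D] [Module k D] [YDModule k B D]
  [AddCommGroup H] [Module k H] [YDModule k B H] [AddCommGroup R] [Module k R] [YDModule k B R]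
  [AddCommGroup T] [Module k T]

local prefix:max "▹" => LinearMap.lTensor _

/-- The coaction `R ⊗ Δ` on `R ⊗ H`. -/
def lTensorComul (R : Type*) [AddCommGroup R] [Module k R] (𝓗 : BraidedHopfAlgebra k B H) :
    R ⊗[k] H →ₗ[k] (R ⊗[k] H) ⊗[k] H :=
  (TensorProduct.assoc k R H H).symm.toLinearMap ∘ₗ 𝓗.comul.lTensor R

variable (𝓗 : BraidedHopfAlgebra k B H)

lemma IsYDHom.lTensorComul : IsYDHom B (lTensorComul R 𝓗) :=
  assoc_symm.comp 𝓗.comul_hom.lTensor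

omit [YDModule k B R] in
lemma assoc_op12_lTensorComul (x : (R ⊗[k] H) ⊗[k] T) :
    TensorProduct.assoc k R H _ (op12 (lTensorComul R 𝓗) x)
      = ▹(op12 𝓗.comul) (TensorProduct.assoc k R H T x) := by
  induction x with
  | zero => simp
  | add x y hx hy => simp only [map_add, hx, hy]
  | tmul x t =>
  induction x with
  | zero => simp
  | add x y hx hy => simp only [map_add, TensorProduct.add_tmul, hx, hy]
  | tmul r x =>
    simp only [op12_tmul, lTensorComul, LinearMap.comp_apply, LinearMap.lTensor_tmul,
      LinearEquiv.coe_coe, TensorProduct.assoc_tmul]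
    generalize 𝓗.comul x = z
    induction z with
    | zero => simp
    | add x y hx hy => simp only [map_add, TensorProduct.add_tmul, TensorProduct.tmul_add, hx, hy]
    | tmul x y => simp

/-- Multiplicativity holds because the twist of the smash product uses only the first leg of the
coproduct to act on `R`; coassociativity and multiplicativity of the coproduct handle the last leg.
-/
theorem isComoduleAlgebra_smash (X : AlgStr k R) (α : H ⊗[k] R →ₗ[k] R)
    [hα : ModuleAlgebra 𝓗 X α] :
    IsComoduleAlgebra 𝓗 (smash 𝓗 X α) (lTensorComul R 𝓗) where
  isYDAlgebra := isYDAlgebra_smash 𝓗 α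
  hom := IsYDHom.lTensorComul 𝓗
  coassoc x := by
    induction x with
    | zero => simp
    | add x y hx hy => simp only [map_add, hx, hy]
    | tmul r x =>
      have h1 : ∀ z : H ⊗[k] H, TensorProduct.assoc k R H (H ⊗[k] H)
          (TensorProduct.assoc k (R ⊗[k] H) H H
            ((lTensorComul R 𝓗).rTensor H ((TensorProduct.assoc k R H H).symm (r ⊗ₜ z))))
          = r ⊗ₜ (TensorProduct.assoc k H H H (𝓗.comul.rTensor H z)) := by
        intro z
        induction z with
        | zero => simp
        | add x y hx hy => simp only [map_add, TensorProduct.tmul_add, hx, hy]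
        | tmul x y =>
          simp only [TensorProduct.assoc_symm_tmul, LinearMap.rTensor_tmul, lTensorComul,
            LinearMap.comp_apply, LinearMap.lTensor_tmul, LinearEquiv.coe_coe]
          generalize 𝓗.comul x = z
          induction z with
          | zero => simp
          | add x y hx hy =>
            simp only [map_add, TensorProduct.tmul_add, TensorProduct.add_tmul, hx, hy]
          | tmul x z => simp
      have h2 : ∀ z : H ⊗[k] H, TensorProduct.assoc k R H (H ⊗[k] H)
          (𝓗.comul.lTensor (R ⊗[k] H) ((TensorProduct.assoc k R H H).symm (r ⊗ₜ z)))
          = r ⊗ₜ (𝓗.comul.lTensor H z) := by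
        intro z
        induction z with
        | zero => simp
        | add x y hx hy => simp only [map_add, TensorProduct.tmul_add, hx, hy]
        | tmul x y => simp
      apply (TensorProduct.assoc k R H (H ⊗[k] H)).injective
      have e : lTensorComul R 𝓗 (r ⊗ₜ x) = (TensorProduct.assoc k R H H).symm (r ⊗ₜ 𝓗.comul x) :=
        rfl
      rw [e, h1, h2, 𝓗.coassoc]
  counit x := by
    induction x with
    | zero => simp
    | add x y hx hy => simp only [map_add, TensorProduct.add_tmul, hx, hy]
    | tmul r x =>
      have h2 : ∀ z : H ⊗[k] H,
          (𝓗.counit.lTensor (R ⊗[k] H) ((TensorProduct.assoc k R H H).symm (r ⊗ₜ z)))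
          = (TensorProduct.assoc k R H k).symm (r ⊗ₜ (𝓗.counit.lTensor H z)) := by
        intro z
        induction z with
        | zero => simp
        | add x y hx hy => simp only [map_add, TensorProduct.tmul_add, hx, hy]
        | tmul x y => simp
      have e : lTensorComul R 𝓗 (r ⊗ₜ x) = (TensorProduct.assoc k R H H).symm (r ⊗ₜ 𝓗.comul x) :=
        rfl
      rw [e, h2, 𝓗.comul_counit, TensorProduct.assoc_symm_tmul]
  map_mul t := by
    have hX : Fact (X.IsYDAlgebra B) := ⟨hα.out.isYDAlgebra⟩
    set Q := smash 𝓗 X α with hQ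
    have key (x : R ⊗[k] (H ⊗[k] (R ⊗[k] (H ⊗[k] k)))) :
        ▹(op12 𝓗.comul) (opTwist X 𝓗.toAlgStr (smashTwist 𝓗 α) x)
        = opTwist X 𝓗.toAlgStr (smashTwist 𝓗 α) (▹(▹(▹(▹(op21 𝓗.mul))))
          (▹(▹(▹(op22 (braiding B H H)))) (▹(▹(op22 (braiding B H R)))
            (▹(▹(▹(▹(op12 𝓗.comul)))) (▹(op12 𝓗.comul) x))))) := by
      simp only [opTwist, op22_smashTwist, Rw.eq, LinearMap.lTensor_comp, LinearMap.comp_apply]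
    have (x : (R ⊗[k] H) ⊗[k] ((R ⊗[k] H) ⊗[k] k)) :
        op12 (lTensorComul R 𝓗) (op21 Q.mul x) = op21 Q.mul (▹(▹(op21 𝓗.mul))
          (▹(op22 (braiding B H (R ⊗[k] H))) (▹(▹(op12 (lTensorComul R 𝓗)))
            (op12 (lTensorComul R 𝓗) x)))) := by
      apply (TensorProduct.assoc k R H _).injective
      -- The mathematical content is `key`; what follows transports it from the unbracketed string
      -- to strings in which `R ⊗ H` is a single strand.
      have h1 : (TensorProduct.assoc k R H _).toLinearMap ∘ₗ op22 (T := H ⊗[k] k)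
          (braiding B H (R ⊗[k] H)) = ▹(op22 (braiding B H H)) ∘ₗ op22 (braiding B H R) ∘ₗ
          ▹(TensorProduct.assoc k R H _).toLinearMap := LinearMap.ext op22_braiding_assoc_right
      have h2 : (TensorProduct.assoc k R H _).toLinearMap ∘ₗ op12 (T := k) (lTensorComul R 𝓗)
          = ▹(op12 𝓗.comul) ∘ₗ (TensorProduct.assoc k R H _).toLinearMap :=
        LinearMap.ext (assoc_op12_lTensorComul 𝓗)
      have h3 : (TensorProduct.assoc k R H _).toLinearMap ∘ₗ ▹(op21 (T := k) 𝓗.mul)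
          = ▹(▹(op21 𝓗.mul)) ∘ₗ (TensorProduct.assoc k R H _).toLinearMap :=
        LinearMap.ext (assoc_lTensor (op21 (T := k) 𝓗.mul))
      rw [assoc_op12_lTensorComul, hQ]
      change ▹(op12 𝓗.comul) (TensorProduct.assoc k R H _
        (op21 (X.twisted 𝓗.toAlgStr (smashTwist 𝓗 α)).mul x)) = TensorProduct.assoc k R H _
        (op21 (X.twisted 𝓗.toAlgStr (smashTwist 𝓗 α)).mul _)
      have h1' := congrArg (LinearMap.lTensor (R ⊗[k] H)) h1
      have h2' := congrArg (fun f => LinearMap.lTensor (R ⊗[k] H) (LinearMap.lTensor H f)) h2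
      have h3' := congrArg (LinearMap.lTensor (R ⊗[k] H)) h3
      simp only [LinearMap.lTensor_comp] at h1' h2' h3'
      rw [assoc_op21_twisted, assoc_op21_twisted, key]
      congr 1
      symm
      rw [← LinearMap.comp_apply (LinearMap.lTensor (R ⊗[k] H) (LinearEquiv.toLinearMap _)), h3']
      simp only [LinearMap.comp_apply]
      rw [← LinearMap.comp_apply (LinearMap.lTensor (R ⊗[k] H) (LinearEquiv.toLinearMap _)), h1']
      simp only [LinearMap.comp_apply]
      rw [← LinearMap.comp_apply (LinearMap.lTensor (R ⊗[k] H) (LinearMap.lTensor H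
        (LinearEquiv.toLinearMap _))), h2']
      simp only [LinearMap.comp_apply, assoc_lTensor, assoc_op12_lTensorComul]
      rw [lTensor_congr₂ (op12_nat 𝓗.comul _)]
    induction t with
    | zero => simp
    | add x y hx hy => simp only [map_add, hx, hy]
    | tmul s t =>
      have := this (s ⊗ₜ (t ⊗ₜ 1))
      rw [op12_op12_tmul, lTensor_op22_flatten, op21_op21_flatten, op21_tmul, op12_tmul] at this
      exact tmul_one_injective ((TensorProduct.assoc k _ _ k).injective this)
  map_one := by
    simp [lTensorComul, smash, AlgStr.twisted, 𝓗.comul_one]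

omit [YDModule k B H] in
lemma assoc_op21_actRight (β : D ⊗[k] H →ₗ[k] H) (x : D ⊗[k] ((R ⊗[k] H) ⊗[k] T)) :
    TensorProduct.assoc k R H T (op21 (actRight (B := B) R β) x)
      = ▹(op21 β) (op22 (braiding B D R) (▹(TensorProduct.assoc k R H T).toLinearMap x)) := by
  refine LinearMap.congr_fun
    (f := (TensorProduct.assoc k R H T).toLinearMap ∘ₗ op21 (actRight (B := B) R β))
    (g := ▹(op21 β) ∘ₗ op22 (braiding B D R) ∘ₗ ▹(TensorProduct.assoc k R H T).toLinearMap)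
    (ext_three fun d x t => ?_) x
  induction x with
  | zero => simp
  | add x y hx hy => simp only [map_add, TensorProduct.add_tmul, TensorProduct.tmul_add, hx, hy]
  | tmul r x =>
    simp only [LinearMap.comp_apply, actRight, op21_tmul, LinearMap.lTensor_tmul,
      LinearEquiv.coe_coe, TensorProduct.assoc_tmul, TensorProduct.assoc_symm_tmul,
      LinearMap.rTensor_tmul, op22_tmul]
    generalize braiding (k := k) B D R _ = z
    induction z with
    | zero => simp
    | add x y hx hy => simp only [map_add, TensorProduct.add_tmul, hx, hy]
    | tmul r d => simp [op21_tmul]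

/-- The action that is trivial on `R` and `⇀` on `H` is dual to the coaction `R ⊗ Δ`. The module
algebra axioms for `R # U` thus follow from `isComoduleAlgebra_smash`. -/
lemma actRight_hit (p : D ⊗[k] H →ₗ[k] k) :
    actRight (B := B) R (hit 𝓗 p) = actionOfCoaction (B := B) p (lTensorComul R 𝓗) := by
  have key (x : D ⊗[k] ((R ⊗[k] H) ⊗[k] k)) : op21 (actRight (B := B) R (hit 𝓗 p)) x
      = op21 (actionOfCoaction (B := B) p (lTensorComul R 𝓗)) x := by
    have h1 : (TensorProduct.assoc k R H _).toLinearMap ∘ₗ op12 (T := k) (lTensorComul R 𝓗)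
        = ▹(op12 𝓗.comul) ∘ₗ (TensorProduct.assoc k R H _).toLinearMap :=
      LinearMap.ext (assoc_op12_lTensorComul 𝓗)
    have h2 : op21 (T := k) (hit 𝓗 p) = ▹(op20 p) ∘ₗ op22 (braiding B D H) ∘ₗ ▹(op12 𝓗.comul) :=
      op21_actionOfCoaction p 𝓗.comul
    apply (TensorProduct.assoc k R H k).injective
    rw [assoc_op21_actRight, op21_actionOfCoaction, h2]
    simp only [LinearMap.comp_apply, assoc_lTensor, op22_braiding_assoc_right,
      LinearMap.lTensor_comp]
    rw [← LinearMap.lTensor_comp_apply _ _ (op12 _), h1]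
    simp only [LinearMap.comp_apply, LinearMap.lTensor_comp, Rw.eq]
  ext d r h
  simpa [op21_tmul] using tmul_one_injective (key (d ⊗ₜ ((r ⊗ₜ h) ⊗ₜ 1)))

end smashComodule

/-! ### The antipode reverses products and coproducts -/

section antipode
variable {k : Type*} [Field k] {B : Type*} [Ring B] [HopfAlgebra k B]
variable {H T S : Type*} [AddCommGroup H] [Module k H] [YDModule k B H]
  [AddCommGroup T] [Module k T] [AddCommGroup S] [Module k S]

local prefix:max "▹" => LinearMap.lTensor _

variable (𝓗 : BraidedHopfAlgebra k B H)

/-- The comultiplication of the braided tensor square, on strings. -/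
def opComul₂ : H ⊗[k] (H ⊗[k] T) →ₗ[k] H ⊗[k] (H ⊗[k] (H ⊗[k] (H ⊗[k] T))) :=
  ▹(op22 (braiding B H H)) ∘ₗ ▹(▹(op12 𝓗.comul)) ∘ₗ op12 𝓗.comul

/-- `x ⊗ y ↦ S(y') S(x')`, on strings. -/
def opAntiMul : H ⊗[k] (H ⊗[k] T) →ₗ[k] H ⊗[k] T :=
  op21 𝓗.mul ∘ₗ op22 (braiding B H H) ∘ₗ ▹(op11 𝓗.antipode) ∘ₗ op11 𝓗.antipode

lemma opComul₂_nat (f : S →ₗ[k] T) (x : H ⊗[k] (H ⊗[k] S)) :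
    opComul₂ 𝓗 (▹(▹f) x) = ▹(▹(▹(▹f))) (opComul₂ 𝓗 x) := by
  simp only [opComul₂, LinearMap.comp_apply, op12_nat, lTensor_congr₂ (lTensor_congr₂ (op12_nat 𝓗.comul f)),
    lTensor_congr₂ (op22_nat (braiding B H H) (f.lTensor H))]

lemma opComul₂_coassoc (x : H ⊗[k] (H ⊗[k] T)) :
    opComul₂ 𝓗 (opComul₂ 𝓗 x) = ▹(▹(opComul₂ 𝓗)) (opComul₂ 𝓗 x) := by
  simp only [opComul₂, Rw.eq, LinearMap.lTensor_comp, LinearMap.comp_apply]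

/-- In the convolution algebra `Hom(H ⊗ H, H)` the candidate is a right inverse of the product: `x₁
y₁ S(y₂) S(x₂)` collapses from the inside. -/
lemma mul_antiMul (x : H ⊗[k] (H ⊗[k] T)) :
    op21 𝓗.mul (▹(op21 𝓗.mul) (▹(▹(opAntiMul 𝓗)) (opComul₂ 𝓗 x)))
      = op01 𝓗.one (op10 𝓗.counit (op10 𝓗.counit x)) := by
  have h : op21 (T := T) 𝓗.mul ∘ₗ ▹(op21 𝓗.mul) ∘ₗ ▹(op11 𝓗.antipode) ∘ₗ op12 𝓗.comul
      = op10 𝓗.counit := by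
    refine LinearMap.ext fun w => ?_
    simp only [LinearMap.comp_apply]
    rw [Rw.eq (f := op21 𝓗.mul) (g := ▹(op21 𝓗.mul)), LinearMap.comp_apply,
      Rw₃.eq (f := op21 𝓗.mul) (g := ▹(op11 𝓗.antipode)), LinearMap.comp_apply,
      Rw.eq (f := op21 𝓗.mul), LinearMap.id_apply]
  have h' : op10 (T := H ⊗[k] T) 𝓗.counit ∘ₗ op22 (braiding B H H) = ▹(op10 𝓗.counit) :=
    LinearMap.ext fun x => Rw.eq (f := op10 𝓗.counit) x
  calc _ = op21 𝓗.mul (▹(op21 (T := T) 𝓗.mul ∘ₗ ▹(op21 𝓗.mul) ∘ₗ ▹(op11 𝓗.antipode) ∘ₗ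
        op12 𝓗.comul) (▹(▹(op11 𝓗.antipode)) (▹(op22 (braiding B H H)) (op12 𝓗.comul x)))) := by
        simp only [opComul₂, opAntiMul, Rw.eq, LinearMap.lTensor_comp, LinearMap.comp_apply]
    _ = op21 𝓗.mul (▹(op11 𝓗.antipode) (op12 𝓗.comul (▹(op10 𝓗.counit) x))) := by
        rw [h, lTensor_congr₂ (fun x => (op10_nat 𝓗.counit (op11 𝓗.antipode) x).symm),
          ← LinearMap.lTensor_comp_apply H (op10 𝓗.counit) (op22 _), h', op12_nat]
    _ = _ := by
        rw [Rw₃.eq (f := op21 𝓗.mul) (g := ▹(op11 𝓗.antipode)), LinearMap.comp_apply,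
          ← op10_nat]

/-- `S ∘ m` is a left convolution inverse of `m`: the antipode axiom for the product `xy`, since the
coproduct is multiplicative. -/
lemma antipode_mul_mul (x : H ⊗[k] (H ⊗[k] T)) :
    op21 𝓗.mul (op11 𝓗.antipode (op21 𝓗.mul (▹(▹(op21 𝓗.mul)) (opComul₂ 𝓗 x))))
      = op01 𝓗.one (op10 𝓗.counit (op10 𝓗.counit x)) := by
  have := Rw₃.eq (f := op21 𝓗.mul) (g := op11 𝓗.antipode) (l := op12 𝓗.comul) (op21 𝓗.mul x)
  simp only [Rw.eq, LinearMap.lTensor_comp, LinearMap.comp_apply, opComul₂] at this ⊢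
  exact this

lemma counit_opComul₂ (x : H ⊗[k] (H ⊗[k] T)) :
    op10 𝓗.counit (op10 𝓗.counit (opComul₂ 𝓗 x)) = x := by
  rw [op10_nat, opComul₂, LinearMap.comp_apply,
    ← LinearMap.lTensor_comp_apply H (op10 𝓗.counit) (op22 _),
    show op10 (T := H ⊗[k] (H ⊗[k] T)) 𝓗.counit ∘ₗ op22 (braiding B H H) = ▹(op10 𝓗.counit) from
      LinearMap.ext fun x => Rw.eq (f := op10 𝓗.counit) x]
  simp only [LinearMap.comp_apply]
  rw [← op10_nat, ← op10_nat, Rw.eq (f := op10 𝓗.counit) (g := op12 𝓗.comul), LinearMap.id_apply,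
    lTensor_congr₂ (f' := LinearMap.id) (g' := LinearMap.id)
      (fun x => Rw.eq (f := op10 𝓗.counit) (g := op12 𝓗.comul) x)]
  simp

lemma lTensor_counit_opComul₂ (x : H ⊗[k] (H ⊗[k] T)) :
    ▹(▹(op10 𝓗.counit ∘ₗ op10 𝓗.counit)) (opComul₂ 𝓗 x) = x := by
  rw [opComul₂, LinearMap.lTensor_comp, LinearMap.lTensor_comp, LinearMap.comp_apply,
    LinearMap.comp_apply, LinearMap.comp_apply,
    ← LinearMap.lTensor_comp_apply H (LinearMap.lTensor H (op10 𝓗.counit)) (op22 _),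
    show ▹(op10 𝓗.counit) ∘ₗ op22 (T := H ⊗[k] T) (braiding B H H) = op10 𝓗.counit from
      LinearMap.ext fun x => Rw.eq (f := ▹(op10 𝓗.counit)) (g := op22 (braiding B H H)) x]
  rw [lTensor_congr₂ (f' := op12 𝓗.comul) (g' := op10 𝓗.counit)
    (fun x => (op10_nat 𝓗.counit (op12 𝓗.comul) x).symm),
    Rw.eq (f := ▹(op10 𝓗.counit)) (g := op12 𝓗.comul), LinearMap.id_apply,
    lTensor_congr₂ (f' := LinearMap.id) (g' := LinearMap.id)
      (fun x => Rw.eq (f := ▹(op10 𝓗.counit)) (g := op12 𝓗.comul) x)]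
  simp

/-- The antipode of a braided Hopf algebra is antimultiplicative. -/
theorem op11_antipode_op21_mul (x : H ⊗[k] (H ⊗[k] T)) :
    op11 𝓗.antipode (op21 𝓗.mul x) = opAntiMul 𝓗 x := by
  -- Uniqueness of convolution inverses: with `n` the candidate, `S∘m = (S∘m) * (m * n) = ((S∘m) *
  -- m) * n = n`.
  have h := LinearMap.ext (f := op21 (T := T) 𝓗.mul ∘ₗ ▹(op21 𝓗.mul) ∘ₗ ▹(▹(opAntiMul 𝓗)) ∘ₗ
    opComul₂ 𝓗) (g := op01 𝓗.one ∘ₗ op10 𝓗.counit ∘ₗ op10 𝓗.counit) (mul_antiMul 𝓗)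
  calc _ = op11 𝓗.antipode (op21 𝓗.mul (▹(▹(op10 𝓗.counit ∘ₗ op10 𝓗.counit)) (opComul₂ 𝓗 x))) := by
        rw [lTensor_counit_opComul₂]
    _ = op21 𝓗.mul (op11 𝓗.antipode (op21 𝓗.mul (▹(▹(op01 𝓗.one ∘ₗ op10 𝓗.counit ∘ₗ
          op10 𝓗.counit)) (opComul₂ 𝓗 x)))) := by
        rw [LinearMap.lTensor_comp _ (op01 _), LinearMap.lTensor_comp _ (LinearMap.lTensor _ _),
          LinearMap.comp_apply, ← op21_nat, op11_nat, ← op21_nat, op11_nat,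
          Rw.eq (f := op21 𝓗.mul) (g := ▹(op01 𝓗.one)), LinearMap.id_apply, ← op21_nat, op11_nat]
    _ = op21 𝓗.mul (op21 𝓗.mul (op11 𝓗.antipode (op21 𝓗.mul (▹(▹(op21 𝓗.mul))
          (opComul₂ 𝓗 (▹(▹(opAntiMul 𝓗)) (opComul₂ 𝓗 x))))))) := by
        rw [← h, opComul₂_nat, opComul₂_coassoc]
        simp only [Rw.eq, LinearMap.comp_apply, LinearMap.lTensor_comp]
        rw [← op21_nat, op11_nat, Rw.eq (f := op21 𝓗.mul) (g := ▹(op21 𝓗.mul)),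
          LinearMap.comp_apply]
    _ = _ := by
        rw [antipode_mul_mul, Rw.eq (f := op21 𝓗.mul), LinearMap.id_apply,
          ← op10_nat, ← op10_nat, counit_opComul₂]

/-- The multiplication of the braided tensor square, on strings. -/
def opMul₂ : H ⊗[k] (H ⊗[k] (H ⊗[k] (H ⊗[k] T))) →ₗ[k] H ⊗[k] (H ⊗[k] T) :=
  op21 𝓗.mul ∘ₗ ▹(▹(op21 𝓗.mul)) ∘ₗ ▹(op22 (braiding B H H))

/-- `x ↦ S(x₂)' ⊗ S(x₁)'`, on strings. -/
def opAntiComul : H ⊗[k] T →ₗ[k] H ⊗[k] (H ⊗[k] T) :=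
  op22 (braiding B H H) ∘ₗ ▹(op11 𝓗.antipode) ∘ₗ op11 𝓗.antipode ∘ₗ op12 𝓗.comul

lemma opMul₂_assoc (x : H ⊗[k] (H ⊗[k] (H ⊗[k] (H ⊗[k] (H ⊗[k] (H ⊗[k] T)))))) :
    opMul₂ 𝓗 (opMul₂ 𝓗 x) = opMul₂ 𝓗 (▹(▹(opMul₂ 𝓗)) x) := by
  simp only [opMul₂, Rw.eq, LinearMap.lTensor_comp, LinearMap.comp_apply]

/-- The dual argument in `Hom(H, H ⊗ H)`: the two innermost legs of the iterated coproduct cancel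
first, then the two outer ones. -/
lemma comul_antiComul (x : H ⊗[k] T) :
    opMul₂ 𝓗 (op12 𝓗.comul (▹(opAntiComul 𝓗) (op12 𝓗.comul x)))
      = op01 𝓗.one (op01 𝓗.one (op10 𝓗.counit x)) := by
  have h := Rw₃.eq (f := op21 𝓗.mul) (g := ▹(op11 𝓗.antipode)) (l := op12 (T := H ⊗[k] T) 𝓗.comul)
  calc _ = op21 𝓗.mul (▹(op22 (braiding B H H)) (▹(op21 𝓗.mul ∘ₗ ▹(op11 𝓗.antipode) ∘ₗ
        op12 𝓗.comul) (▹(▹(op11 𝓗.antipode)) (▹(op12 𝓗.comul) (op12 𝓗.comul x))))) := by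
        simp only [opMul₂, opAntiComul, Rw.eq, LinearMap.lTensor_comp, LinearMap.comp_apply]
    _ = op21 𝓗.mul (▹(op11 𝓗.antipode) (▹(▹(op01 𝓗.one)) (op12 𝓗.comul x))) := by
        rw [show op21 𝓗.mul ∘ₗ ▹(op11 𝓗.antipode) ∘ₗ op12 (T := H ⊗[k] T) 𝓗.comul
            = op01 𝓗.one ∘ₗ op10 𝓗.counit from LinearMap.ext h,
          LinearMap.lTensor_comp, LinearMap.comp_apply, ← LinearMap.lTensor_comp_apply H (op22 _),
          show op22 (braiding B H H) ∘ₗ op01 𝓗.one = ▹(op01 (T := T) 𝓗.one) from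
            LinearMap.ext fun x => Rw.eq (f := op22 (braiding B H H)) x,
          lTensor_congr₂ (fun x => (op10_nat 𝓗.counit (op11 𝓗.antipode) x).symm),
          ← LinearMap.lTensor_comp_apply H (op10 𝓗.counit) (op12 𝓗.comul),
          show op10 𝓗.counit ∘ₗ op12 𝓗.comul = LinearMap.id from
            LinearMap.ext fun x => Rw.eq (f := op10 𝓗.counit) (g := op12 𝓗.comul) x,
          LinearMap.lTensor_id, LinearMap.id_apply,
          lTensor_congr₂ (op11_nat 𝓗.antipode (op01 𝓗.one))]
    _ = _ := by
        rw [← op12_nat, Rw₃.eq (f := op21 𝓗.mul) (g := ▹(op11 𝓗.antipode)), LinearMap.comp_apply,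
          ← op10_nat]

lemma antipode_comul_mul (x : H ⊗[k] T) :
    opMul₂ 𝓗 (▹(▹(op12 𝓗.comul)) (op12 𝓗.comul (op11 𝓗.antipode (op12 𝓗.comul x))))
      = op01 𝓗.one (op01 𝓗.one (op10 𝓗.counit x)) := by
  have h := congrArg (op12 𝓗.comul)
    (Rw₃.eq (f := op21 𝓗.mul) (g := op11 𝓗.antipode) (l := op12 𝓗.comul) x)
  rw [LinearMap.comp_apply, Rw.eq (f := op12 𝓗.comul) (g := op01 𝓗.one), LinearMap.comp_apply] at h
  rw [← h]
  simp only [opMul₂, Rw.eq, LinearMap.comp_apply]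

/-- The antipode of a braided Hopf algebra is anticomultiplicative. -/
theorem op12_comul_op11_antipode (x : H ⊗[k] T) :
    op12 𝓗.comul (op11 𝓗.antipode x) = opAntiComul 𝓗 x := by
  have one_mul (y : H ⊗[k] (H ⊗[k] T)) : opMul₂ 𝓗 (op01 𝓗.one (op01 𝓗.one y)) = y := by
    simp only [opMul₂, LinearMap.comp_apply]
    rw [← op01_nat, Rw.eq (f := op22 (braiding B H H)), ← op01_nat,
      Rw.eq (f := op21 𝓗.mul) (g := op01 𝓗.one), LinearMap.id_apply,
      lTensor_congr₂ (f' := LinearMap.id) (g' := LinearMap.id)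
      (fun x => Rw.eq (f := op21 𝓗.mul) (g := op01 𝓗.one) x)]
    simp
  have mul_one (y : H ⊗[k] (H ⊗[k] T)) :
      opMul₂ 𝓗 (▹(▹(op01 𝓗.one ∘ₗ op01 𝓗.one)) y) = y := by
    simp only [opMul₂, LinearMap.comp_apply, LinearMap.lTensor_comp]
    rw [← LinearMap.lTensor_comp_apply H (op22 _),
      show op22 (braiding B H H) ∘ₗ ▹(op01 (T := H ⊗[k] T) 𝓗.one) = op01 𝓗.one from
        LinearMap.ext fun x => Rw.eq (f := op22 (braiding B H H)) x,
      lTensor_congr₂ (fun x => (op01_nat 𝓗.one (op21 𝓗.mul) x).symm),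
      Rw.eq (f := op21 𝓗.mul) (g := ▹(op01 𝓗.one)), LinearMap.id_apply,
      lTensor_congr₂ (f' := LinearMap.id) (g' := LinearMap.id)
        (fun x => Rw.eq (f := op21 𝓗.mul) (g := ▹(op01 𝓗.one)) x)]
    simp
  have counit_comul (y : H ⊗[k] T) : ▹(op10 𝓗.counit) (op12 𝓗.comul y) = y := by
    rw [Rw.eq (f := ▹(op10 𝓗.counit)) (g := op12 𝓗.comul), LinearMap.id_apply]
  -- Again a left and a right convolution inverse coincide, now those of the coproduct.
  have h : opMul₂ (T := T) 𝓗 ∘ₗ op12 𝓗.comul ∘ₗ ▹(opAntiComul 𝓗) ∘ₗ op12 𝓗.comul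
      = (op01 𝓗.one ∘ₗ op01 𝓗.one) ∘ₗ op10 𝓗.counit := LinearMap.ext (comul_antiComul 𝓗)
  calc _ = opMul₂ 𝓗 (▹(▹(op01 𝓗.one ∘ₗ op01 𝓗.one)) (op12 𝓗.comul (op11 𝓗.antipode
        (▹(op10 𝓗.counit) (op12 𝓗.comul x))))) := by
        rw [counit_comul, mul_one]
    _ = opMul₂ 𝓗 (▹(▹(opMul₂ 𝓗 ∘ₗ op12 𝓗.comul ∘ₗ ▹(opAntiComul 𝓗) ∘ₗ op12 𝓗.comul))
        (op12 𝓗.comul (op11 𝓗.antipode (op12 𝓗.comul x)))) := by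
        rw [h, LinearMap.lTensor_comp _ (_ ∘ₗ _) (op10 _),
          LinearMap.lTensor_comp _ (LinearMap.lTensor _ (_ ∘ₗ _)), LinearMap.comp_apply,
          ← op12_nat, ← op11_nat, ← op12_nat, ← op11_nat, ← op12_nat, ← op11_nat]
    _ = opMul₂ 𝓗 (opMul₂ 𝓗 (▹(▹(op12 𝓗.comul)) (op12 𝓗.comul (op11 𝓗.antipode (op12 𝓗.comul
          (▹(opAntiComul 𝓗) (op12 𝓗.comul x))))))) := by
        rw [opMul₂_assoc]
        simp only [LinearMap.lTensor_comp, LinearMap.comp_apply]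
        rw [← op12_nat, ← op11_nat, Rw.eq (f := ▹(op12 𝓗.comul)) (g := op12 𝓗.comul),
          LinearMap.comp_apply, op12_nat]
        congr 3
        rw [op11_nat, op12_nat]
    _ = _ := by
        rw [antipode_comul_mul, one_mul, ← op10_nat,
          Rw.eq (f := op10 𝓗.counit) (g := op12 𝓗.comul), LinearMap.id_apply]

end antipode

/-! ### Ordinary Hopf algebras as braided Hopf algebras over the base field -/

section base
variable {k : Type*} [Field k] {M N : Type*} [AddCommGroup M] [Module k M] [AddCommGroup N]
  [Module k N]

lemma act_base [YDModule k k M] (a : k) (m : M) : act k k M a m = a • m := by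
  have := (act k k M).commutes a
  rw [Algebra.algebraMap_self_apply] at this
  rw [this, Module.algebraMap_end_apply]

lemma coact_base [YDModule k k M] (m : M) : coact k k M m = 1 ⊗ₜ m := by
  have := YDModule.counit_coact (k := k) (B := k) m
  have e : (Coalgebra.counit (R := k) (A := k)) = LinearMap.id := by ext; simp
  rwa [e, LinearMap.rTensor_id, LinearMap.id_apply] at this

/-- Over the Hopf algebra `k`, all linear maps are morphisms of Yetter-Drinfeld modules. -/
lemma IsYDHom.base [YDModule k k M] [YDModule k k N] (f : M →ₗ[k] N) : IsYDHom k f :=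
  ⟨fun b m => by simp [act_base], fun m => by simp [coact_base]⟩

lemma braiding_base [YDModule k k M] [YDModule k k N] :
    braiding (k := k) k M N = (TensorProduct.comm k M N).toLinearMap := by
  ext m n
  simp [braiding_tmul, coact_base]

instance [YDModule k k M] [YDModule k k N] (f : M →ₗ[k] N) : Fact (IsYDHom k f) := ⟨.base f⟩

variable (k M) in
/-- The trivial Yetter-Drinfeld module structure over the Hopf algebra `k`. -/
abbrev trivialYDModule : YDModule k k M where
  act := Algebra.ofId k (Module.End k M)
  coact := TensorProduct.mk k k M 1
  coassoc m := by simp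
  counit_coact m := by simp
  compat b m := by
    simp [Algebra.ofId_apply, Module.algebraMap_end_eq_smul_id]
    rw [TensorProduct.smul_tmul', smul_eq_mul, mul_one]

variable {A : Type*} [Ring A] [HopfAlgebra k A]

variable (k A) in
/-- A Hopf algebra is a braided Hopf algebra over the base field. -/
def HopfAlgebra.toBraided [YDModule k k A] : BraidedHopfAlgebra k k A where
  mul := LinearMap.mul' k A
  one := 1
  isYDAlgebra := ⟨⟨by simp [mul_assoc], by simp, by simp⟩, .base _, .base _⟩
  comul := Coalgebra.comul
  counit := Coalgebra.counit
  antipode := HopfAlgebra.antipode k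
  comul_hom := .base _
  counit_hom := .base _
  antipode_hom := .base _
  coassoc := Coalgebra.coassoc_apply
  counit_comul := by simp
  comul_counit := by simp
  comul_mul t := by
    induction t with
    | zero => simp
    | add x y hx hy => simp only [map_add, hx, hy]
    | tmul x y =>
      simp only [LinearMap.mul'_apply, Bialgebra.comul_mul, TensorProduct.map_tmul]
      generalize Coalgebra.comul (R := k) x = z
      generalize Coalgebra.comul (R := k) y = w
      induction z with
      | zero => simp
      | add x y hx hy => simp only [add_mul, TensorProduct.add_tmul, map_add, hx, hy]
      | tmul x x' =>
        induction w with
        | zero => simp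
        | add x y hx hy => simp only [mul_add, TensorProduct.tmul_add, map_add, hx, hy]
        | tmul y y' => simp [AlgStr.tensor, AlgStr.twisted, midMap, braiding_base]
  comul_one := by simp [Algebra.TensorProduct.one_def]
  counit_mul := by simp
  counit_one := by simp
  antipode_comul x := by
    simp [HopfAlgebra.mul_antipode_rTensor_comul_apply, Algebra.algebraMap_eq_smul_one]
  comul_antipode x := by
    simp [HopfAlgebra.mul_antipode_lTensor_comul_apply, Algebra.algebraMap_eq_smul_one]

end base

/-! ### A nonzero integral on a finite-dimensional Hopf algebra -/

section bijective
variable {k : Type*} [Field k] {A T : Type*} [AddCommGroup A] [Module k A] [YDModule k k A]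
  [AddCommGroup T] [Module k T] (𝓐 : BraidedHopfAlgebra k k A)

local prefix:max "▹" => LinearMap.lTensor _

lemma op22_base_tmul {M N : Type*} [AddCommGroup M] [Module k M] [AddCommGroup N]
    [Module k N] [YDModule k k M] [YDModule k k N] (m : M) (n : N) (t : T) :
    op22 (braiding (k := k) k M N) (m ⊗ₜ (n ⊗ₜ t)) = n ⊗ₜ (m ⊗ₜ t) := by
  simp [op22_tmul, braiding_base]

/-- The square of the antipode. -/
def antipodeSq : A →ₗ[k] A := 𝓐.antipode ∘ₗ 𝓐.antipode

lemma op11_antipodeSq : op11 (T := T) (antipodeSq 𝓐) = op11 𝓐.antipode ∘ₗ op11 𝓐.antipode := by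
  ext; simp [op11_tmul, antipodeSq]

/-- The antipode reverses the coproduct; over the base field the braiding is the flip, so two
reversals cancel and `S²` is comultiplicative. -/
instance : Rw (op12 (T := T) 𝓐.comul) (op11 (antipodeSq 𝓐))
    (▹(op11 (antipodeSq 𝓐)) ∘ₗ op11 (antipodeSq 𝓐) ∘ₗ op12 𝓐.comul) := ⟨fun x => by
  simp only [op11_antipodeSq, LinearMap.lTensor_comp, LinearMap.comp_apply,
    op12_comul_op11_antipode, opAntiComul]
  generalize op12 𝓐.comul x = y
  refine LinearMap.congr_fun (f := op22 (braiding k A A) ∘ₗ ▹(op11 𝓐.antipode)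
    ∘ₗ op11 𝓐.antipode ∘ₗ op22 (braiding k A A) ∘ₗ ▹(op11 𝓐.antipode) ∘ₗ op11 𝓐.antipode)
    (g := ▹(op11 𝓐.antipode) ∘ₗ ▹(op11 𝓐.antipode) ∘ₗ op11 𝓐.antipode ∘ₗ op11 𝓐.antipode)
    (ext_three fun x y t => ?_) y
  simp [op11_tmul, op22_base_tmul]⟩

lemma antipode_one : 𝓐.antipode 𝓐.one = 𝓐.one := by
  have := 𝓐.antipode_comul 𝓐.one
  rw [𝓐.comul_one, LinearMap.rTensor_tmul, 𝓐.isYDAlgebra.mul_one, 𝓐.counit_one, one_smul] at this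
  exact this

/-- `S²(x₂) S(x₁) = ε(x)`. -/
lemma antipodeSq_mul_antipode (x : A ⊗[k] T) : op21 𝓐.mul (op22 (braiding k A A)
    (▹(op11 (antipodeSq 𝓐)) (op11 𝓐.antipode (op12 𝓐.comul x))))
    = op01 𝓐.one (op10 𝓐.counit x) := by
  -- Apply `S` to `x₁ S(x₂) = ε(x)`; being antimultiplicative, `S` reverses the two factors.
  have h := congrArg (op11 𝓐.antipode)
    (Rw₃.eq (f := op21 𝓐.mul) (g := ▹(op11 𝓐.antipode)) (l := op12 𝓐.comul) x)
  rw [op11_antipode_op21_mul] at h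
  simp only [opAntiMul, LinearMap.comp_apply, op01_apply, op11_tmul, antipode_one] at h
  simp only [op01_apply]
  rw [← h, op11_antipodeSq, LinearMap.lTensor_comp, LinearMap.comp_apply]
  simp only [Rw.eq, LinearMap.comp_apply]

/-- `S(x₂) S²(x₁) = ε(x)`. -/
lemma antipode_mul_antipodeSq (x : A ⊗[k] T) : op21 𝓐.mul (op22 (braiding k A A)
    (▹(op11 𝓐.antipode) (op11 (antipodeSq 𝓐) (op12 𝓐.comul x))))
    = op01 𝓐.one (op10 𝓐.counit x) := by
  have h := congrArg (op11 𝓐.antipode)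
    (Rw₃.eq (f := op21 𝓐.mul) (g := op11 𝓐.antipode) (l := op12 𝓐.comul) x)
  rw [op11_antipode_op21_mul] at h
  simp only [opAntiMul, LinearMap.comp_apply, op01_apply, op11_tmul, antipode_one] at h
  simp only [op01_apply]
  rw [← h, op11_antipodeSq, LinearMap.comp_apply]

end bijective

section ext
variable {k : Type*} [Field k] {A B C D E F G S T : Type*} [AddCommGroup T] [Module k T] [AddCommGroup A] [Module k A]
  [AddCommGroup B] [Module k B] [AddCommGroup C] [Module k C] [AddCommGroup D] [Module k D]
  [AddCommGroup E] [Module k E] [AddCommGroup F] [Module k F] [AddCommGroup G] [Module k G]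
  [AddCommGroup S] [Module k S]

lemma ext_six {f g : A ⊗[k] (B ⊗[k] (C ⊗[k] (D ⊗[k] (E ⊗[k] F)))) →ₗ[k] S}
    (h : ∀ a b c d e x, f (a ⊗ₜ (b ⊗ₜ (c ⊗ₜ (d ⊗ₜ (e ⊗ₜ x)))))
      = g (a ⊗ₜ (b ⊗ₜ (c ⊗ₜ (d ⊗ₜ (e ⊗ₜ x)))))) : f = g := by
  ext a b c d e x
  exact h a b c d e x

lemma ext_eight {f g : A ⊗[k] (B ⊗[k] (C ⊗[k] (D ⊗[k] (E ⊗[k] (F ⊗[k] (G ⊗[k] T)))))) →ₗ[k] S}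
    (h : ∀ a b c d e x y z, f (a ⊗ₜ (b ⊗ₜ (c ⊗ₜ (d ⊗ₜ (e ⊗ₜ (x ⊗ₜ (y ⊗ₜ z)))))))
      = g (a ⊗ₜ (b ⊗ₜ (c ⊗ₜ (d ⊗ₜ (e ⊗ₜ (x ⊗ₜ (y ⊗ₜ z)))))))) : f = g := by
  ext a b c d e x y z
  exact h a b c d e x y z
end ext

section bijective
variable {k : Type*} [Field k] {A T : Type*} [AddCommGroup A] [Module k A] [YDModule k k A]
  [AddCommGroup T] [Module k T] (𝓐 : BraidedHopfAlgebra k k A)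

local prefix:max "▹" => LinearMap.lTensor _

/-- `e ⊗ x ↦ x₁ S²(e₁) ⊗ e₂ ⊗ x₂`, on strings. -/
def opSq : A ⊗[k] (A ⊗[k] T) →ₗ[k] A ⊗[k] (A ⊗[k] (A ⊗[k] T)) :=
  op21 𝓐.mul ∘ₗ ▹(op11 (antipodeSq 𝓐)) ∘ₗ op22 (braiding k A A) ∘ₗ ▹(op22 (braiding k A A))
    ∘ₗ ▹(▹(op12 𝓐.comul)) ∘ₗ op12 𝓐.comul

-- Written out, `x₁ S²(e₂) S(e₁) ⊗ x₂ S²(e₃) ⊗ e₄ ⊗ x₃ = x₁ ⊗ x₂ S²(e₁) ⊗ e₂ ⊗ x₃`, which is `S²(e₂)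
-- S(e₁) = ε(e)`. It prepares `opTrace_comul`: the free leg `x₁` is expressed through a coproduct
-- taken inside the trace.
set_option maxHeartbeats 1000000 in
lemma opSq_comul (z : A ⊗[k] (A ⊗[k] T)) :
    op21 𝓐.mul (▹(op11 𝓐.antipode) (op22 (braiding k A A)
      (▹(op12 𝓐.comul ∘ₗ opSq 𝓐) (op12 𝓐.comul z))))
    = ▹(opSq 𝓐) (op22 (braiding k A A) (▹(op12 𝓐.comul) z)) := by
  let Q : A ⊗[k] (A ⊗[k] (A ⊗[k] (A ⊗[k] (A ⊗[k] (A ⊗[k] T))))) →ₗ[k] _ :=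
    ▹(op21 𝓐.mul) ∘ₗ ▹(▹(op11 (antipodeSq 𝓐))) ∘ₗ ▹(op22 (braiding k A A)) ∘ₗ
      ▹(▹(op22 (braiding k A A))) ∘ₗ op21 𝓐.mul ∘ₗ op22 (braiding k A A) ∘ₗ
        ▹(op22 (braiding k A A)) ∘ₗ ▹(▹(op22 (braiding k A A)))
  calc _ = Q (op21 𝓐.mul (op22 (braiding k A A) (▹(op11 (antipodeSq 𝓐)) (op11 𝓐.antipode
        (op12 𝓐.comul (op12 𝓐.comul (op12 𝓐.comul (▹(op12 𝓐.comul) (▹(op12 𝓐.comul) z))))))))) := by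
        simp only [Q, opSq, Rw.eq, LinearMap.lTensor_comp, LinearMap.comp_apply]
        generalize ▹(▹(▹(▹(op12 𝓐.comul)))) (▹(▹(▹(▹(op12 𝓐.comul))))
          (op12 𝓐.comul (op12 𝓐.comul (op12 𝓐.comul z)))) = y
        simp only [← LinearMap.comp_apply]
        refine LinearMap.congr_fun (ext_eight fun a b c d x y z t => ?_) y
        simp only [LinearMap.comp_apply, LinearMap.lTensor_tmul, op22_base_tmul, op11_tmul,
          op21_tmul, 𝓐.isYDAlgebra.mul_assoc]
    _ = Q (op01 𝓐.one (op12 𝓐.comul (▹(op12 𝓐.comul) (▹(op12 𝓐.comul) z)))) := by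
        rw [antipodeSq_mul_antipode, Rw.eq (f := op10 𝓐.counit) (g := op12 𝓐.comul),
          LinearMap.id_apply]
    _ = _ := by
        simp only [Q, opSq, Rw.eq, LinearMap.lTensor_comp, LinearMap.comp_apply]
        rw [← op01_nat, ← op01_nat, ← op01_nat]
        generalize ▹(▹(op12 𝓐.comul)) (▹(▹(op12 𝓐.comul)) (op12 𝓐.comul z)) = y
        simp only [← LinearMap.comp_apply]
        refine LinearMap.congr_fun (ext_six fun a b x y z t => ?_) y
        simp only [LinearMap.comp_apply, LinearMap.lTensor_tmul, op22_base_tmul, op11_tmul,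
          op21_tmul, op01_apply, 𝓐.isYDAlgebra.mul_one]

variable [FiniteDimensional k A]

omit [YDModule k k A] in
/-- Cyclicity of the partial trace. -/
lemma partialTrace_comm {S : Type*} [AddCommGroup S] [Module k S] (f : A →ₗ[k] A ⊗[k] T)
    (g : A →ₗ[k] S ⊗[k] A) :
    ∑ i, ▹(op10 ((Module.finBasis k A).coord i)) (op12 g (f (Module.finBasis k A i)))
    = ∑ i, ▹(op10 ((Module.finBasis k A).coord i)) (▹f (g (Module.finBasis k A i))) := by
  set b := Module.finBasis k A
  have h1 (x : A ⊗[k] T) : x = ∑ j, b j ⊗ₜ op10 (b.coord j) x := by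
    induction x with
    | zero => simp
    | add x y hx hy => simp only [map_add, TensorProduct.tmul_add, Finset.sum_add_distrib, ← hx, ← hy]
    | tmul a t =>
      conv_lhs => rw [← b.sum_repr a, TensorProduct.sum_tmul]
      simp only [op10_tmul, Module.Basis.coord_apply, TensorProduct.tmul_smul,
        TensorProduct.smul_tmul']
  have h2 (z : S ⊗[k] A) (t : T) (i) : ▹(op10 (b.coord i)) (TensorProduct.assoc k S A T (z ⊗ₜ t))
      = TensorProduct.rid k S ((b.coord i).lTensor S z) ⊗ₜ t := lTensor_op10_assoc _ z t
  have h3 (z : S ⊗[k] A) : ∑ i, TensorProduct.rid k S ((b.coord i).lTensor S z) ⊗ₜ b i = z := by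
    induction z with
    | zero => simp
    | add x y hx hy => simp only [map_add, TensorProduct.add_tmul, Finset.sum_add_distrib, hx, hy]
    | tmul s a =>
      conv_rhs => rw [← b.sum_repr a, TensorProduct.tmul_sum]
      simp [TensorProduct.smul_tmul']
  calc _ = ∑ i, ∑ j, TensorProduct.rid k S ((b.coord i).lTensor S (g (b j)))
        ⊗ₜ[k] op10 (b.coord j) (f (b i)) := by
        refine Finset.sum_congr rfl fun i _ => ?_
        conv_lhs => rw [h1 (f (b i))]
        simp only [map_sum, op12_tmul, h2]
    _ = _ := by
        rw [Finset.sum_comm]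
        refine Finset.sum_congr rfl fun j _ => ?_
        conv_rhs => rw [← h3 (g (b j))]
        simp

end bijective

section bijective
variable {k : Type*} [Field k] {A T : Type*} [AddCommGroup A] [Module k A] [YDModule k k A]
  [AddCommGroup T] [Module k T] (𝓐 : BraidedHopfAlgebra k k A)

local prefix:max "▹" => LinearMap.lTensor _

instance : Rw (op12 (T := T) 𝓐.comul) (op11 𝓐.antipode) (op22 (braiding k A A) ∘ₗ
    ▹(op11 𝓐.antipode) ∘ₗ op11 𝓐.antipode ∘ₗ op12 𝓐.comul) := ⟨op12_comul_op11_antipode 𝓐⟩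

/-- The map `y ↦ y₁ f(y₂)` commutes with the flip. -/
lemma op22_base_comul (f : A →ₗ[k] k) (x : A ⊗[k] (A ⊗[k] T)) :
    op22 (braiding k A A) (▹(▹(op10 f)) (▹(op12 𝓐.comul) x))
      = ▹(op10 f) (op12 𝓐.comul (op22 (braiding k A A) x)) := by
  simp only [← LinearMap.comp_apply]
  refine LinearMap.congr_fun (ext_three fun x y t => ?_) x
  simp only [LinearMap.comp_apply, LinearMap.lTensor_tmul, op22_base_tmul, op12_tmul,
    lTensor_op10_assoc]

variable [FiniteDimensional k A]

/-- `x ↦ ∑ᵢ eⁱ(x₁ S²(eᵢ₁)) eᵢ₂ ⊗ x₂`, on strings. -/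
def opTrace : A ⊗[k] T →ₗ[k] A ⊗[k] (A ⊗[k] T) :=
  ∑ i, op10 ((Module.finBasis k A).coord i) ∘ₗ opSq 𝓐 ∘ₗ op01 (Module.finBasis k A i)

/-- By `opSq_comul`, the extra leg is `y₁ S(e₁)` with `y = x₁ S²(e₂)`, and the coordinate of `y₂` is
traced. Cyclicity of the trace moves the coproduct of `y` onto the basis vector `e`, where it
produces `e₁ S(e₂)`, and this collapses to the unit. -/
lemma opTrace_comul (w : A ⊗[k] T) :
    ▹(opTrace 𝓐) (op12 𝓐.comul w) = op01 𝓐.one (opTrace 𝓐 w) := by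
  set b := Module.finBasis k A with hb
  let f : A →ₗ[k] A ⊗[k] (A ⊗[k] (A ⊗[k] (A ⊗[k] T))) := op22 (braiding k A A) ∘ₗ ▹(opSq 𝓐) ∘ₗ
    op12 𝓐.comul ∘ₗ (TensorProduct.mk k A _).flip w
  have h1 (i) : ▹(op10 (b.coord i) ∘ₗ opSq 𝓐 ∘ₗ op01 (b i)) (op12 𝓐.comul w)
      = op21 𝓐.mul (▹(op11 𝓐.antipode) (▹(op10 (b.coord i)) (op12 𝓐.comul (f (b i))))) := by
    have h := opSq_comul 𝓐 (op01 (k := k) (b i) w)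
    rw [← op01_nat, Rw.eq (f := op22 (braiding k A A)) (g := op01 (b i))] at h
    rw [LinearMap.lTensor_comp, LinearMap.lTensor_comp, LinearMap.comp_apply, LinearMap.comp_apply,
      ← h, op21_nat, ← lTensor_congr₂ (op11_nat 𝓐.antipode (op10 (b.coord i))),
      ← op22_nat, LinearMap.lTensor_comp, LinearMap.comp_apply, op22_base_comul]
    rfl
  have h2 (j) : op21 𝓐.mul (▹(op11 𝓐.antipode) (▹(op10 (b.coord j)) (▹f (𝓐.comul (b j)))))
      = op01 𝓐.one (op10 (b.coord j) (opSq 𝓐 (op01 (b j) w))) := by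
    have h3 (z : A ⊗[k] A) : ▹((TensorProduct.mk k A _).flip w) z
        = TensorProduct.assoc k A A _ (z ⊗ₜ w) := by
      induction z with
      | zero => simp
      | add x y hx hy => simp only [map_add, TensorProduct.add_tmul, hx, hy]
      | tmul x y => simp
    have h4 : ▹f (𝓐.comul (b j)) = ▹(op22 (braiding k A A)) (▹(▹(opSq 𝓐)) (▹(op12 𝓐.comul)
        (op12 𝓐.comul (op01 (b j) w)))) := by
      simp only [f, LinearMap.lTensor_comp, LinearMap.comp_apply, h3, op01_apply, op12_tmul]
    have h5 : op10 (b.coord j) ∘ₗ op22 (braiding k A A) = ▹(op10 (T := A ⊗[k] (A ⊗[k] T)) (b.coord j)) :=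
      LinearMap.ext fun x => Rw.eq (f := op10 (b.coord j)) (g := op22 (braiding k A A)) x
    rw [h4, ← LinearMap.lTensor_comp_apply A (op10 (b.coord j)), h5,
      Rw.eq (f := ▹(op12 𝓐.comul)) (g := op12 𝓐.comul), LinearMap.comp_apply, ← op12_nat,
      ← op12_nat, Rw₃.eq (f := op21 𝓐.mul) (g := ▹(op11 𝓐.antipode)), LinearMap.comp_apply,
      ← op10_nat, ← op10_nat, Rw.eq (f := op10 𝓐.counit) (g := op12 𝓐.comul), LinearMap.id_apply]
  have h := partialTrace_comm f 𝓐.comul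
  have h5 : ▹(opTrace 𝓐) = ∑ i, ▹(op10 (b.coord i) ∘ₗ opSq 𝓐 (T := T) ∘ₗ op01 (b i)) :=
    map_sum (LinearMap.lTensorHom A) _ _
  rw [h5, LinearMap.sum_apply, Finset.sum_congr rfl fun i _ => h1 i, ← map_sum, ← map_sum, h,
    map_sum, map_sum, Finset.sum_congr rfl fun i _ => h2 i, ← map_sum]
  simp [opTrace, hb]

/-- Apply the counit to the leg `x₂`, put `x = S(e_l)`, take the `l`-th coordinate and sum over `l`.
The result is the sum over `i` of `eⁱ(S(eᵢ₂) S²(eᵢ₁)) = ε(eᵢ) eⁱ(1)`, which is `ε(1) = 1`. -/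
lemma opTrace_ne_zero : opTrace (T := k) 𝓐 ≠ 0 := by
  intro h
  set b := Module.finBasis k A with hb
  have h1 (i) (x : A ⊗[k] k) : ▹(op10 𝓐.counit) (op10 (b.coord i) (opSq 𝓐 (op01 (b i) x)))
      = op10 (b.coord i) (op21 𝓐.mul (▹(op11 (antipodeSq 𝓐)) (op22 (braiding k A A)
        (▹(op22 (braiding k A A)) (op12 𝓐.comul (op01 (b i) x)))))) := by
    simp only [opSq, Rw.eq, LinearMap.comp_apply]
    rw [← lTensor_congr₂ (op11_nat (S := A ⊗[k] (A ⊗[k] k)) (T := A ⊗[k] k) (antipodeSq 𝓐)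
        (▹(op10 𝓐.counit))), ← op22_nat,
      ← lTensor_congr₂ (op22_nat (braiding k A A) (op10 𝓐.counit)),
      ← LinearMap.lTensor_comp_apply A (LinearMap.lTensor A (▹(op10 𝓐.counit))),
      ← LinearMap.lTensor_comp,
      show ▹(op10 𝓐.counit) ∘ₗ op12 (T := k) 𝓐.comul = LinearMap.id from
        LinearMap.ext fun x => Rw.eq (f := ▹(op10 𝓐.counit)) (g := op12 𝓐.comul) x]
    simp only [LinearMap.lTensor_id, LinearMap.id_apply]
  have h2 (i) : ∑ l, op10 (b.coord l) (op10 (b.coord i) (op21 𝓐.mul (▹(op11 (antipodeSq 𝓐))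
      (op22 (braiding k A A) (▹(op22 (braiding k A A)) (op12 𝓐.comul
        (op01 (b i) (𝓐.antipode (b l) ⊗ₜ[k] (1 : k)))))))))
      = op10 (b.coord i) (op21 𝓐.mul (op22 (braiding k A A) (▹(op11 𝓐.antipode)
        (op11 (antipodeSq 𝓐) (op12 𝓐.comul (b i ⊗ₜ[k] (1 : k))))))) := by
    simp only [op01_apply, op12_tmul]
    generalize 𝓐.comul (b i) = z
    induction z with
    | zero => simp
    | add x y hx hy => simp only [map_add, TensorProduct.add_tmul, Finset.sum_add_distrib, hx, hy]
    | tmul x y =>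
      simp only [TensorProduct.assoc_tmul, LinearMap.lTensor_tmul, op22_base_tmul, op11_tmul,
        op21_tmul, op10_tmul]
      simp only [map_smul, smul_eq_mul, Module.Basis.coord_apply]
      let G : A →ₗ[k] k := b.coord i ∘ₗ 𝓐.mul ∘ₗ
        (TensorProduct.mk k A A).flip (antipodeSq 𝓐 x) ∘ₗ 𝓐.antipode
      change ∑ l, G (b l) • b.repr y l • (1 : k) = G y • (1 : k)
      conv_rhs => rw [← b.sum_repr y, map_sum, Finset.sum_smul]
      simp only [map_smul, smul_eq_mul, mul_one, mul_comm (G _)]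
  have h3 (i) : op10 (b.coord i) (op21 𝓐.mul (op22 (braiding k A A) (▹(op11 𝓐.antipode)
        (op11 (antipodeSq 𝓐) (op12 𝓐.comul (b i ⊗ₜ[k] (1 : k)))))))
      = 𝓐.counit (b i) * b.coord i 𝓐.one := by
    rw [antipode_mul_antipodeSq]
    simp [op10_tmul, op01_apply, mul_comm]
  have h4 : ∑ i, 𝓐.counit (b i) * b.coord i 𝓐.one = 1 := by
    rw [← 𝓐.counit_one]
    conv_rhs => rw [← b.sum_repr 𝓐.one, map_sum]
    simp only [map_smul, smul_eq_mul, mul_comm, Module.Basis.coord_apply]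
  have h5 : ∑ i, 𝓐.counit (b i) * b.coord i 𝓐.one = 0 := by
    simp only [← h3, ← h2, ← h1]
    rw [Finset.sum_comm]
    refine Finset.sum_eq_zero fun l _ => ?_
    have h6 : op10 (b.coord l) (▹(op10 𝓐.counit)
        (opTrace 𝓐 (𝓐.antipode (b l) ⊗ₜ[k] (1 : k)))) = 0 := by simp [h]
    simpa only [opTrace, LinearMap.sum_apply, LinearMap.comp_apply, map_sum] using h6
  exact one_ne_zero (h4.symm.trans h5)

end bijective

/-! ### Injectivity of the antipode from an integral -/

section bijective
variable {k : Type*} [Field k] {A T : Type*} [AddCommGroup A] [Module k A] [YDModule k k A]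
  [AddCommGroup T] [Module k T] (𝓐 : BraidedHopfAlgebra k k A)

local prefix:max "▹" => LinearMap.lTensor _

/-- Any functional composed with `opTrace` has the integral property, by `opTrace_comul`; it
suffices to choose one that does not vanish on a nonzero value of `opTrace`. -/
lemma exists_integral [FiniteDimensional k A] : ∃ f : A →ₗ[k] k, f ≠ 0 ∧ ∀ x,
    TensorProduct.rid k A (f.lTensor A (𝓐.comul x)) = f x • 𝓐.one := by
  obtain ⟨z, hz⟩ : ∃ z, opTrace (T := k) 𝓐 z ≠ 0 := by
    by_contra! h
    exact opTrace_ne_zero 𝓐 (LinearMap.ext h)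
  obtain ⟨φ, hφ⟩ : ∃ φ : Module.Dual k (A ⊗[k] (A ⊗[k] k)), φ (opTrace (T := k) 𝓐 z) ≠ 0 := by
    by_contra! h
    exact hz ((Module.forall_dual_apply_eq_zero_iff k _).1 h)
  let f : A →ₗ[k] k := φ ∘ₗ opTrace 𝓐 ∘ₗ (TensorProduct.mk k A k).flip 1
  have hf : φ ∘ₗ opTrace 𝓐 = op10 f := TensorProduct.ext' fun x c => by
    have : x ⊗ₜ[k] c = c • (x ⊗ₜ[k] (1 : k)) := by simp [← TensorProduct.tmul_smul]
    simp only [LinearMap.comp_apply, this, map_smul, op10_tmul, f, LinearMap.flip_apply,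
      TensorProduct.mk_apply, smul_eq_mul, mul_one]
  refine ⟨f, fun h => hφ ?_, fun x => tmul_one_injective (k := k) ?_⟩
  · have := LinearMap.congr_fun hf z
    rw [h] at this
    simpa [op10] using this
  · have h := congrArg (φ.lTensor A) (opTrace_comul 𝓐 (x ⊗ₜ[k] (1 : k)))
    rw [← LinearMap.lTensor_comp_apply, hf, ← op01_nat, ← LinearMap.comp_apply φ, hf, op12_tmul,
      lTensor_op10_assoc] at h
    rw [h, op01_apply, op10_tmul, TensorProduct.tmul_smul, TensorProduct.smul_tmul']

variable {𝓐}

lemma op10_integral_comul {f : A →ₗ[k] k}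
    (hf : ∀ x, TensorProduct.rid k A (f.lTensor A (𝓐.comul x)) = f x • 𝓐.one) (x : A ⊗[k] T) :
    ▹(op10 f) (op12 𝓐.comul x) = op01 𝓐.one (op10 f x) := by
  induction x with
  | zero => simp
  | add x y hx hy => simp only [map_add, hx, hy]
  | tmul x t =>
    rw [op12_tmul, lTensor_op10_assoc, hf, op10_tmul, op01_apply, TensorProduct.tmul_smul,
      TensorProduct.smul_tmul']

/-- `f(x S(b₁)) b₂ = x₁ f(x₂ S(b))` for a left integral `f`. -/
lemma integral_mul_antipode {f : A →ₗ[k] k}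
    (hf : ∀ x, TensorProduct.rid k A (f.lTensor A (𝓐.comul x)) = f x • 𝓐.one) (z : A ⊗[k] (A ⊗[k] T)) :
    op10 f (op21 𝓐.mul (▹(op11 𝓐.antipode) (▹(op12 𝓐.comul) z)))
      = ▹(op10 f ∘ₗ op21 𝓐.mul ∘ₗ ▹(op11 𝓐.antipode)) (op12 𝓐.comul z) := by
  -- The integral property at `x S(b₁)`, with `b₂` in the tail, involves `x₁ S(b₂) f(x₂ S(b₁)) ⊗
  -- b₃`. Multiplying the first leg into the tail lets `S(b₂) b₃` cancel.
  have h := op10_integral_comul hf (op21 𝓐.mul (▹(op11 𝓐.antipode) (▹(op12 𝓐.comul) z)))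
  replace h := congrArg (op21 𝓐.mul) h
  have h1 (x : A ⊗[k] T) : op21 𝓐.mul (op01 𝓐.one x) = x := by
    induction x with
    | zero => simp
    | add x y hx hy => simp only [map_add, hx, hy]
    | tmul x t => rw [op01_apply, op21_tmul, 𝓐.isYDAlgebra.one_mul]
  rw [h1] at h
  rw [← h]
  let Q : A ⊗[k] (A ⊗[k] (A ⊗[k] (A ⊗[k] T))) →ₗ[k] A ⊗[k] T := op21 𝓐.mul ∘ₗ ▹(op10 f) ∘ₗ
    ▹(op21 𝓐.mul) ∘ₗ ▹(▹(op11 𝓐.antipode))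
  have h2 : op21 𝓐.mul ∘ₗ op11 𝓐.antipode ∘ₗ op12 𝓐.comul
      = op01 𝓐.one ∘ₗ op10 (T := T) 𝓐.counit := LinearMap.ext fun x =>
    Rw₃.eq (f := op21 𝓐.mul) (g := op11 𝓐.antipode) (l := op12 𝓐.comul) x
  calc _ = Q (▹(▹(▹(op21 𝓐.mul ∘ₗ op11 𝓐.antipode ∘ₗ op12 𝓐.comul)))
        (▹(▹(op12 𝓐.comul)) (op12 𝓐.comul z))) := by
        simp only [Q, Rw.eq, LinearMap.lTensor_comp, LinearMap.comp_apply]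
        generalize ▹(▹(op12 𝓐.comul)) (▹(▹(op12 𝓐.comul)) (op12 𝓐.comul z)) = y
        simp only [← LinearMap.comp_apply]
        refine LinearMap.congr_fun (ext_six fun a b x y z t => ?_) y
        simp only [LinearMap.comp_apply, LinearMap.lTensor_tmul, op22_base_tmul, op11_tmul,
          op21_tmul, op10_tmul, 𝓐.isYDAlgebra.mul_assoc, TensorProduct.tmul_smul, map_smul]
    _ = Q (▹(▹(▹(op01 𝓐.one))) (op12 𝓐.comul z)) := by
        rw [h2]
        simp only [LinearMap.lTensor_comp, LinearMap.comp_apply]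
        congr 2
        rw [← LinearMap.lTensor_comp_apply, ← LinearMap.lTensor_comp,
          show ▹(op10 𝓐.counit) ∘ₗ op12 (T := T) 𝓐.comul = LinearMap.id from
          LinearMap.ext fun x => Rw.eq (f := ▹(op10 𝓐.counit)) (g := op12 𝓐.comul) x]
        simp only [LinearMap.lTensor_id, LinearMap.id_apply]
    _ = _ := by
        generalize op12 𝓐.comul z = y
        simp only [← LinearMap.comp_apply]
        refine LinearMap.congr_fun (ext_four fun a b x t => ?_) y
        simp only [Q, LinearMap.comp_apply, LinearMap.lTensor_tmul, op11_tmul, op01_apply,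
          op21_tmul, op10_tmul, 𝓐.isYDAlgebra.mul_one, TensorProduct.tmul_smul, map_smul]

/-- If `S(b) = 0`, then `integral_mul_antipode` gives `f(x S(b₁)) b₂ = 0` for all `x`. But `f(y) b =
f(y S²(b₂) S(b₁)) b₃`, which is a combination of such terms, so `f(y) b = 0` for all `y`. -/
theorem antipode_injective [FiniteDimensional k A] : Function.Injective 𝓐.antipode := by
  rw [← LinearMap.ker_eq_bot, LinearMap.ker_eq_bot']
  intro b hb
  obtain ⟨f, hf0, hf⟩ := exists_integral 𝓐
  set e := Module.finBasis k A
  let μ (x : A) : A →ₗ[k] k := f ∘ₗ 𝓐.mul ∘ₗ TensorProduct.mk k A A x ∘ₗ 𝓐.antipode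
  have h1 (x : A) : op10 (μ x) (op12 𝓐.comul (b ⊗ₜ[k] (1 : k))) = 0 := by
    have h := integral_mul_antipode hf (x ⊗ₜ[k] (b ⊗ₜ[k] (1 : k)))
    have h2 (z : A ⊗[k] (A ⊗[k] k)) : op10 f (op21 𝓐.mul (▹(op11 𝓐.antipode) (x ⊗ₜ[k] z)))
        = op10 (μ x) z := by
      induction z with
      | zero => simp
      | add y z hy hz => simp only [map_add, TensorProduct.tmul_add, hy, hz]
      | tmul y z => simp [op10_tmul, op11_tmul, op21_tmul, μ]
    rw [LinearMap.lTensor_tmul, h2] at h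
    simp only [h, LinearMap.lTensor_comp, LinearMap.comp_apply, ← op12_nat, LinearMap.lTensor_tmul,
      op11_tmul, hb, TensorProduct.zero_tmul, TensorProduct.tmul_zero, map_zero]
  -- Expanding the argument of `S²` in the basis frees `x = y S²(e_l)` from the coproduct of `b`, so
  -- that `h1` applies.
  have h3 (y : A) (v : A ⊗[k] (A ⊗[k] (A ⊗[k] k))) : op10 f (op21 𝓐.mul (op01 y (op21 𝓐.mul
      (op22 (braiding k A A) (▹(op11 (antipodeSq 𝓐)) (op11 𝓐.antipode v))))))
      = ∑ l, op10 (e.coord l) (op10 (μ (𝓐.mul (y ⊗ₜ antipodeSq 𝓐 (e l)))) v) := by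
    have : op10 f ∘ₗ op21 𝓐.mul ∘ₗ op01 y ∘ₗ op21 𝓐.mul ∘ₗ op22 (braiding k A A) ∘ₗ
        ▹(op11 (antipodeSq 𝓐)) ∘ₗ op11 𝓐.antipode (T := A ⊗[k] (A ⊗[k] k))
        = ∑ l, op10 (e.coord l) ∘ₗ op10 (μ (𝓐.mul (y ⊗ₜ antipodeSq 𝓐 (e l)))) := by
      refine ext_four fun s x r c => ?_
      let G : A →ₗ[k] k := f ∘ₗ 𝓐.mul ∘ₗ (TensorProduct.mk k A A).flip (𝓐.antipode s) ∘ₗ 𝓐.mul ∘ₗ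
        TensorProduct.mk k A A y ∘ₗ antipodeSq 𝓐
      simp only [LinearMap.comp_apply, LinearMap.sum_apply, LinearMap.lTensor_tmul, op22_base_tmul,
        op11_tmul, op21_tmul, op10_tmul, op01_apply, ← 𝓐.isYDAlgebra.mul_assoc, map_smul]
      change G x • _ = ∑ l, G (e l) • e.repr x l • _
      conv_lhs => rw [← e.sum_repr x, map_sum, Finset.sum_smul]
      simp only [map_smul, smul_eq_mul, mul_smul]
      exact Finset.sum_congr rfl fun l _ => smul_comm _ _ _
    simpa only [LinearMap.sum_apply, LinearMap.comp_apply] using LinearMap.congr_fun this v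
  have h4 (y : A) : f y • b = 0 := by
    have h := h3 y (op12 𝓐.comul (op12 𝓐.comul (b ⊗ₜ[k] (1 : k))))
    rw [antipodeSq_mul_antipode, Rw.eq (f := op10 𝓐.counit) (g := op12 𝓐.comul),
      LinearMap.id_apply, Finset.sum_eq_zero] at h
    · rw [op01_apply, op01_apply, op21_tmul, 𝓐.isYDAlgebra.mul_one, op10_tmul,
        TensorProduct.smul_tmul'] at h
      exact tmul_one_injective (k := k) (h.trans (TensorProduct.zero_tmul _ _).symm)
    · intro l _
      have h5 := Rw.eq (f := ▹(op12 𝓐.comul)) (g := op12 𝓐.comul) (b ⊗ₜ[k] (1 : k))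
      rw [LinearMap.comp_apply] at h5
      rw [← h5, ← op10_nat, h1, map_zero, map_zero]
  by_contra hb0
  exact hf0 (LinearMap.ext fun y => (smul_eq_zero.1 (h4 y)).resolve_right hb0)

end bijective

/-- The antipode of a finite-dimensional Hopf algebra is bijective. -/
theorem HopfAlgebra.antipode_bijective (k B : Type*) [Field k] [Ring B] [HopfAlgebra k B]
    [FiniteDimensional k B] : Function.Bijective (HopfAlgebra.antipode k (A := B)) := by
  let _ := trivialYDModule k B
  have h : Function.Injective (HopfAlgebra.antipode k (A := B)) :=
    antipode_injective (𝓐 := HopfAlgebra.toBraided k B)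
  exact ⟨h, LinearMap.surjective_of_injective h⟩

/-! ### Surjectivity of the braiding and symmetric pairs of objects -/

section symmetry
variable {k : Type*} [Field k] {B : Type*} [Ring B] [HopfAlgebra k B]
variable {M N P T W X Y : Type*} [AddCommGroup M] [Module k M] [YDModule k B M]
  [AddCommGroup N] [Module k N] [YDModule k B N] [AddCommGroup P] [Module k P] [YDModule k B P]
  [AddCommGroup T] [Module k T] [AddCommGroup W] [Module k W] [AddCommGroup X] [Module k X]
  [AddCommGroup Y] [Module k Y]

local prefix:max "▹" => LinearMap.lTensor _

variable (k B) in
/-- The inverse of the antipode. -/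
def antipodeInv [FiniteDimensional k B] : B →ₗ[k] B :=
  (LinearEquiv.ofBijective _ (HopfAlgebra.antipode_bijective k B)).symm.toLinearMap

lemma antipode_antipodeInv [FiniteDimensional k B] (b : B) :
    HopfAlgebra.antipode k (antipodeInv k B b) = b :=
  (LinearEquiv.ofBijective _ (HopfAlgebra.antipode_bijective k B)).apply_symm_apply b

/-- `b₂ S⁻¹(b₁) = ε(b)`. -/
lemma mul_comm_antipodeInv_comul [FiniteDimensional k B] (b : B) :
    LinearMap.mul' k B (TensorProduct.comm k B B ((antipodeInv k B).rTensor B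
      (Coalgebra.comul (R := k) b))) = algebraMap k B (Coalgebra.counit (R := k) b) := by
  apply (HopfAlgebra.antipode_bijective k B).1
  have h (z : B ⊗[k] B) : HopfAlgebra.antipode k (LinearMap.mul' k B (TensorProduct.comm k B B
      ((antipodeInv k B).rTensor B z)))
      = LinearMap.mul' k B ((HopfAlgebra.antipode k (A := B)).lTensor B z) := by
    induction z with
    | zero => simp
    | add x y hx hy => simp only [map_add, hx, hy]
    | tmul x y => simp [HopfAlgebra.antipode_mul_antidistrib, antipode_antipodeInv]
  rw [h, HopfAlgebra.mul_antipode_lTensor_comul_apply, Algebra.algebraMap_eq_smul_one, map_smul,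
    HopfAlgebra.antipode_one]

/-- A preimage of `n ⊗ m` is `m₍₀₎ ⊗ S⁻¹(m₍₋₁₎) • n`, by `b₂ S⁻¹(b₁) = ε(b)`. -/
lemma braiding_surjective [FiniteDimensional k B] :
    Function.Surjective (braiding (k := k) B M N) := by
  rw [← LinearMap.range_eq_top, ← top_le_iff, ← TensorProduct.span_tmul_eq_top, Submodule.span_le]
  rintro _ ⟨n, m, rfl⟩
  let G : B ⊗[k] M →ₗ[k] M ⊗[k] N := ((act k B N).toLinearMap.flip n ∘ₗ antipodeInv k B).lTensor M
    ∘ₗ (TensorProduct.comm k B M).toLinearMap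
  let K : B ⊗[k] (B ⊗[k] M) →ₗ[k] N ⊗[k] M :=
    ((act k B N).toLinearMap.flip n ∘ₗ LinearMap.mul' k B ∘ₗ (TensorProduct.comm k B B).toLinearMap
      ∘ₗ (antipodeInv k B).rTensor B).rTensor M ∘ₗ (TensorProduct.assoc k B B M).symm.toLinearMap
  refine ⟨G (coact k B M m), ?_⟩
  have h1 (z : B ⊗[k] M) : braiding B M N (G z) = K ((coact k B M).lTensor B z) := by
    induction z with
    | zero => simp
    | add x y hx hy => simp only [map_add, hx, hy]
    | tmul b m =>
      simp only [G, K, LinearMap.comp_apply, LinearEquiv.coe_coe, TensorProduct.comm_tmul,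
        LinearMap.lTensor_tmul, braiding_tmul]
      generalize coact k B M m = z
      induction z with
      | zero => simp
      | add x y hx hy => simp only [map_add, TensorProduct.tmul_add, hx, hy]
      | tmul c m => simp
  have h2 (z : B ⊗[k] M) : K (TensorProduct.assoc k B B M
      ((Coalgebra.comul (R := k) (A := B)).rTensor M z))
      = (LinearMap.toSpanSingleton k N n).rTensor M
        ((Coalgebra.counit (R := k) (A := B)).rTensor M z) := by
    induction z with
    | zero => simp
    | add x y hx hy => simp only [map_add, hx, hy]
    | tmul b m =>
      simp only [K, LinearMap.comp_apply, LinearEquiv.coe_coe, LinearMap.rTensor_tmul,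
        LinearEquiv.symm_apply_apply, mul_comm_antipodeInv_comul]
      simp [Module.algebraMap_end_apply]
  rw [h1, ← coact_coassoc, h2, YDModule.counit_coact]
  simp

variable (B M N) in
/-- The braidings between `M` and `N` are inverse to each other. -/
class Symmetric : Prop where
  comp_eq : braiding (k := k) B N M ∘ₗ braiding B M N = LinearMap.id

instance [h : Symmetric (k := k) B M N] :
    Rw (op22 (T := T) (braiding B N M)) (op22 (braiding (k := k) B M N)) LinearMap.id :=
  ⟨op22_op22_of_comp_eq_id h.comp_eq⟩

/-- A left inverse of a surjective map is a two-sided inverse. -/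
lemma Symmetric.symm [FiniteDimensional k B] (h : Symmetric (k := k) B M N) :
    Symmetric (k := k) B N M where
  comp_eq := LinearMap.ext fun x => by
    obtain ⟨y, rfl⟩ := braiding_surjective (k := k) (B := B) (M := M) (N := N) x
    rw [LinearMap.comp_apply, ← LinearMap.comp_apply (braiding B N M), h.comp_eq]
    rfl

/-- By naturality the double braiding commutes with `f ⊗ P`, which is injective over a field. -/
lemma Symmetric.of_injective {f : M →ₗ[k] N} (hf : IsYDHom B f) (hi : Function.Injective f)
    (h : Symmetric (k := k) B N P) : Symmetric (k := k) B M P where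
  comp_eq := LinearMap.ext fun x => by
    apply Module.Flat.rTensor_preserves_injective_linearMap (M := P) f hi
    rw [LinearMap.comp_apply, ← braiding_nat_right hf, ← braiding_nat_left hf,
      ← LinearMap.comp_apply, h.comp_eq]
    rfl

/-- A bilinear map that is nondegenerate on the left separates the points of `W ⊗ X`. -/
lemma eq_zero_of_lTensor_apply {Z : Type*} [AddCommGroup Z] [Module k Z] {e : X ⊗[k] Y →ₗ[k] Z}
    (he : ∀ x, (∀ y, e (x ⊗ₜ y) = 0) → x = 0) (z : W ⊗[k] X)
    (hz : ∀ y, (e ∘ₗ (TensorProduct.mk k X Y).flip y).lTensor W z = 0) : z = 0 := by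
  classical
  let b := Module.Basis.ofVectorSpace k W
  have h (f : X →ₗ[k] Z) (z : W ⊗[k] X) (i) : TensorProduct.equivFinsuppOfBasisLeft b (f.lTensor W z) i
      = f (TensorProduct.equivFinsuppOfBasisLeft b z i) := by
    induction z with
    | zero => simp
    | add x y hx hy => simp only [map_add, Finsupp.add_apply, hx, hy]
    | tmul w x => simp
  apply (TensorProduct.equivFinsuppOfBasisLeft b).injective
  rw [map_zero]
  ext i
  refine he _ fun y => ?_
  have := h (e ∘ₗ (TensorProduct.mk k X Y).flip y) z i
  rw [hz, map_zero] at this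
  exact this.symm

lemma eq_of_lTensor_op20 {e : X ⊗[k] Y →ₗ[k] k}
    (he : ∀ x, (∀ y, e (x ⊗ₜ y) = 0) → x = 0) {z z' : W ⊗[k] X}
    (hz : ∀ y, ▹(op20 e) (TensorProduct.assoc k W X _ (z ⊗ₜ (y ⊗ₜ[k] (1 : k))))
      = ▹(op20 e) (TensorProduct.assoc k W X _ (z' ⊗ₜ (y ⊗ₜ[k] (1 : k))))) : z = z' := by
  rw [← sub_eq_zero]
  refine eq_zero_of_lTensor_apply he _ fun y => ?_
  have h (z : W ⊗[k] X) : ▹(op20 e) (TensorProduct.assoc k W X _ (z ⊗ₜ (y ⊗ₜ[k] (1 : k))))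
      = (e ∘ₗ (TensorProduct.mk k X Y).flip y).lTensor W z := by
    induction z with
    | zero => simp
    | add x y hx hy => simp only [map_add, TensorProduct.add_tmul, hx, hy]
    | tmul w x => simp [op20_tmul]
  rw [map_sub, ← h, ← h, hz, sub_self]

/-- Since `e` is a morphism to the unit object, `P` can be pulled across the pair `M ⊗ N` and back.
Its double crossing with `N` is trivial, so after pairing with `N` its double crossing with `M` is
trivial too, and `e` separates the points of `M`. -/
lemma Symmetric.of_pairing {e : M ⊗[k] N →ₗ[k] k} (hom : IsYDHom B e)
    (he : ∀ x, (∀ y, e (x ⊗ₜ y) = 0) → x = 0) (h : Symmetric (k := k) B P N) :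
    Symmetric (k := k) B P M where
  comp_eq := LinearMap.ext fun z => by
    refine eq_of_lTensor_op20 he fun y => ?_
    have h1 (z : P ⊗[k] M) : TensorProduct.assoc k P M _ ((braiding B M P ∘ₗ braiding B P M) z
        ⊗ₜ[k] (y ⊗ₜ[k] (1 : k))) = op22 (braiding B M P) (op22 (braiding B P M)
          (TensorProduct.assoc k P M _ (z ⊗ₜ[k] (y ⊗ₜ[k] (1 : k))))) := by
      simp [op22]
    rw [h1, LinearMap.id_apply]
    generalize TensorProduct.assoc k P M _ (z ⊗ₜ[k] (y ⊗ₜ[k] (1 : k))) = x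
    have h2 (y : M ⊗[k] (P ⊗[k] (N ⊗[k] k))) :
        ▹(op22 (braiding B N P)) (▹(op22 (braiding B P N)) y) = y := by
      rw [← LinearMap.lTensor_comp_apply, show op22 (braiding B N P) ∘ₗ op22 (T := k)
        (braiding B P N) = LinearMap.id from LinearMap.ext (op22_op22_of_comp_eq_id h.comp_eq),
        LinearMap.lTensor_id, LinearMap.id_apply]
    rw [← op22_braiding_op20_right hom x, ← op22_braiding_op20_left hom (▹(op22 (braiding B P N)) _),
      h2]

/-- `F(b • m ⊗ n) = b₁ • F(m ⊗ S(b₂) • n)`: the action on `m` is determined by the map `F(m ⊗ ·)`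
alone, which is how it is used. -/
lemma IsYDHom.apply_act_tmul {F : M ⊗[k] N →ₗ[k] P} (hF : IsYDHom B F) (b : B) (m : M) (n : N) :
    F (act k B M b m ⊗ₜ n) = TensorProduct.lift ((act k B P).toLinearMap.compl₂
      ((F ∘ₗ TensorProduct.mk k M N m) ∘ₗ (act k B N).toLinearMap.flip n ∘ₗ
        HopfAlgebra.antipode k (A := B))) (Coalgebra.comul (R := k) b) := by
  let G : B ⊗[k] (B ⊗[k] B) →ₗ[k] P := F ∘ₗ TensorProduct.map ((act k B M).toLinearMap.flip m)
    ((act k B N).toLinearMap.flip n ∘ₗ LinearMap.mul' k B ∘ₗ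
      (HopfAlgebra.antipode k (A := B)).lTensor B)
  have h1 (z : B ⊗[k] B) : G ((Coalgebra.comul (R := k) (A := B)).lTensor B z)
      = F (act k B M (TensorProduct.rid k B ((Coalgebra.counit (R := k) (A := B)).lTensor B z)) m
        ⊗ₜ n) := by
    induction z with
    | zero => simp
    | add x y hx hy => simp only [map_add, LinearMap.add_apply, TensorProduct.add_tmul, hx, hy]
    | tmul a b =>
      simp only [G, LinearMap.comp_apply, LinearMap.lTensor_tmul, TensorProduct.map_tmul,
        HopfAlgebra.mul_antipode_lTensor_comul_apply]
      simp [Module.algebraMap_end_apply, TensorProduct.smul_tmul']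
  have h2 (z : B ⊗[k] B) : G (TensorProduct.assoc k B B B
      ((Coalgebra.comul (R := k) (A := B)).rTensor B z))
      = TensorProduct.lift ((act k B P).toLinearMap.compl₂
      ((F ∘ₗ TensorProduct.mk k M N m) ∘ₗ (act k B N).toLinearMap.flip n ∘ₗ
        HopfAlgebra.antipode k (A := B))) z := by
    induction z with
    | zero => simp
    | add x y hx hy => simp only [map_add, hx, hy]
    | tmul a b =>
      simp only [LinearMap.rTensor_tmul, TensorProduct.lift.tmul, LinearMap.compl₂_apply,
        LinearMap.comp_apply, TensorProduct.mk_apply, AlgHom.toLinearMap_apply, ← hF.map_act,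
        act_tmul, LinearMap.flip_apply]
      generalize Coalgebra.comul (R := k) a = z
      induction z with
      | zero => simp
      | add x y hx hy => simp only [map_add, TensorProduct.add_tmul, hx, hy]
      | tmul x y => simp [G]
  rw [← h2, Coalgebra.coassoc_apply, h1, Coalgebra.lTensor_counit_comul]
  simp

/-- The counterpart for coactions: `m₍₋₁₎ ⊗ F(m₍₀₎ ⊗ n) = p₍₋₁₎ S⁻¹(n₍₋₁₎) ⊗ p₍₀₎` with `p = F(m ⊗
n₍₀₎)`, so the coaction of `m` is also read off from `F(m ⊗ ·)`. -/
lemma IsYDHom.lTensor_apply_coact [FiniteDimensional k B] {F : M ⊗[k] N →ₗ[k] P}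
    (hF : IsYDHom B F) (m : M) (n : N) :
    (F ∘ₗ (TensorProduct.mk k M N).flip n).lTensor B (coact k B M m)
    = (LinearMap.mul' k B).rTensor P ((TensorProduct.comm k B B).toLinearMap.rTensor P
      ((TensorProduct.assoc k B B P).symm (TensorProduct.map (antipodeInv k B)
        (coact k B P ∘ₗ F ∘ₗ TensorProduct.mk k M N m) (coact k B N n)))) := by
  let Θ : B ⊗[k] (B ⊗[k] N) →ₗ[k] B ⊗[k] N :=
    (LinearMap.mul' k B ∘ₗ (TensorProduct.comm k B B).toLinearMap
      ∘ₗ (antipodeInv k B).rTensor B).rTensor N ∘ₗ (TensorProduct.assoc k B B N).symm.toLinearMap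
  have h1 (z : B ⊗[k] N) : (LinearMap.mul' k B).rTensor P
      ((TensorProduct.comm k B B).toLinearMap.rTensor P ((TensorProduct.assoc k B B P).symm
        (TensorProduct.map (antipodeInv k B) (coact k B P ∘ₗ F ∘ₗ TensorProduct.mk k M N m) z)))
      = TensorProduct.map₂ (LinearMap.mul k B) (TensorProduct.curry F) (coact k B M m)
        (Θ ((coact k B N).lTensor B z)) := by
    induction z with
    | zero => simp
    | add x y hx hy => simp only [map_add, hx, hy]
    | tmul c n =>
      simp only [TensorProduct.map_tmul, LinearMap.comp_apply, TensorProduct.mk_apply,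
        hF.map_coact, coact_tmul, LinearMap.lTensor_tmul]
      generalize coact k B M m = y
      generalize coact k B N n = z
      induction y with
      | zero => simp
      | add x y hx hy => simp only [map_add, LinearMap.add_apply, TensorProduct.tmul_add, hx, hy]
      | tmul a m =>
        induction z with
        | zero => simp
        | add x y hx hy => simp only [map_add, TensorProduct.tmul_add, hx, hy]
        | tmul d n => simp [Θ, mul_assoc]
  have h2 (z : B ⊗[k] N) : Θ (TensorProduct.assoc k B B N
      ((Coalgebra.comul (R := k) (A := B)).rTensor N z))
      = 1 ⊗ₜ TensorProduct.lid k N ((Coalgebra.counit (R := k) (A := B)).rTensor N z) := by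
    induction z with
    | zero => simp
    | add x y hx hy => simp only [map_add, TensorProduct.tmul_add, hx, hy]
    | tmul b m =>
      simp only [Θ, LinearMap.comp_apply, LinearEquiv.coe_coe, LinearMap.rTensor_tmul,
        LinearEquiv.symm_apply_apply, mul_comm_antipodeInv_comul]
      simp [Algebra.algebraMap_eq_smul_one, TensorProduct.smul_tmul]
  rw [h1, ← coact_coassoc, h2, YDModule.counit_coact]
  generalize coact k B M m = y
  induction y with
  | zero => simp
  | add x y hx hy => simp only [map_add, LinearMap.add_apply, hx, hy]
  | tmul a m => simp

/-- A linear map is a morphism if it is one after composition with an injective morphism. -/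
lemma isYDHom_of_apply [FiniteDimensional k B] {Q : Type*} [AddCommGroup Q] [Module k Q]
    [YDModule k B Q] {F : M ⊗[k] N →ₗ[k] P} (hF : IsYDHom B F) {G : Q ⊗[k] N →ₗ[k] P}
    (hG : IsYDHom B G) (hi : ∀ m, (∀ n, F (m ⊗ₜ n) = 0) → m = 0) {w : Q →ₗ[k] M}
    (hw : ∀ q n, F (w q ⊗ₜ n) = G (q ⊗ₜ n)) : IsYDHom B w := by
  -- Action and coaction of `w q`, tested by `F`, depend only on this partial map, which is the one
  -- that `G` attaches to `q`.
  have hw' (q : Q) : F ∘ₗ TensorProduct.mk k M N (w q) = G ∘ₗ TensorProduct.mk k Q N q :=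
    LinearMap.ext fun n => hw q n
  refine ⟨fun b q => ?_, fun q => ?_⟩
  · rw [← sub_eq_zero]
    refine hi _ fun n => ?_
    rw [TensorProduct.sub_tmul, map_sub, hw, hG.apply_act_tmul, hF.apply_act_tmul, hw', sub_self]
  · rw [← sub_eq_zero]
    refine eq_zero_of_lTensor_apply hi _ fun n => ?_
    rw [map_sub, hF.lTensor_apply_coact, ← LinearMap.lTensor_comp_apply, hw',
      show (F ∘ₗ (TensorProduct.mk k M N).flip n) ∘ₗ w = G ∘ₗ (TensorProduct.mk k Q N).flip n from
      LinearMap.ext fun q => hw q n, hG.lTensor_apply_coact, sub_self]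

end symmetry

/-! ### The evaluation pairing and its braided version -/

section pairings
variable {k : Type*} [Field k] {B : Type*} [Ring B] [HopfAlgebra k B]
variable {H U V T : Type*} [AddCommGroup H] [Module k H] [YDModule k B H]
  [AddCommGroup U] [Module k U] [YDModule k B U] [AddCommGroup V] [Module k V] [YDModule k B V]
  [AddCommGroup T] [Module k T]
  {𝓗 : BraidedHopfAlgebra k B H} {𝓤 : BraidedHopfAlgebra k B U} {𝓥 : BraidedHopfAlgebra k B V}
  {ι : U →ₗ[k] Module.Dual k H} {j : V →ₗ[k] H}

local prefix:max "▹" => LinearMap.lTensor _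

/-- The antipode in the action on `H*` cancels the action on `H` by `S(b₁) b₂ = ε(b)`. For the
coaction, the defining relation with `S` applied reduces to `b₁ S(b₂) = ε(b)`. -/
lemma IsHopfSubalgebraOfFiniteDual.isYDHom_lift (hU : IsHopfSubalgebraOfFiniteDual 𝓗 𝓤 ι) :
    IsYDHom B (TensorProduct.lift ι) where
  map_act b t := by
    induction t with
    | zero => simp
    | add x y hx hy => simp only [map_add, hx, hy]
    | tmul u x =>
    have h (z : B ⊗[k] B) : TensorProduct.lift ι (TensorProduct.map
        ((act k B U).toLinearMap.flip u) ((act k B H).toLinearMap.flip x) z)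
        = ι u (act k B H (LinearMap.mul' k B
          ((HopfAlgebra.antipode k (A := B)).rTensor B z)) x) := by
      induction z with
      | zero => simp
      | add x y hx hy => simp only [map_add, hx, hy, LinearMap.add_apply]
      | tmul a b => simp [hU.act_apply]
    rw [act_tmul, h, HopfAlgebra.mul_antipode_rTensor_comul_apply, act_unit]
    simp [Module.algebraMap_end_apply]
  map_coact t := by
    induction t with
    | zero => simp
    | add x y hx hy => simp only [map_add, hx, hy]
    | tmul u x =>
    apply (TensorProduct.rid k B).injective
    let G : B ⊗[k] (B ⊗[k] U) →ₗ[k] B := LinearMap.mul' k B ∘ₗ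
      ((TensorProduct.rid k B).toLinearMap ∘ₗ TensorProduct.map (HopfAlgebra.antipode k (A := B))
        (Module.Dual.eval k H x ∘ₗ ι)).lTensor B
    have h1 (z : B ⊗[k] U) : TensorProduct.rid k B ((TensorProduct.lift ι).lTensor B
        (TensorProduct.map₂ (LinearMap.mul k B) (TensorProduct.mk k U H) z (coact k B H x)))
        = G ((coact k B U).lTensor B z) := by
      induction z with
      | zero => simp
      | add x y hx hy => simp only [map_add, hx, hy, LinearMap.add_apply]
      | tmul b u =>
        simp only [G, LinearMap.comp_apply, LinearMap.lTensor_tmul, LinearEquiv.coe_coe,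
          hU.coact_apply, LinearMap.mul'_apply]
        generalize coact k B H x = w
        induction w with
        | zero => simp
        | add x y hx hy => simp only [map_add, hx, hy, mul_add]
        | tmul c y => simp
    have h2 (z : B ⊗[k] U) : G (TensorProduct.assoc k B B U
        ((Coalgebra.comul (R := k) (A := B)).rTensor U z))
        = TensorProduct.lift ι (TensorProduct.lid k U
          ((Coalgebra.counit (R := k) (A := B)).rTensor U z) ⊗ₜ x) • 1 := by
      induction z with
      | zero => simp
      | add x y hx hy => simp only [map_add, hx, hy, add_smul, TensorProduct.add_tmul]
      | tmul b u =>
        have h3 (z : B ⊗[k] B) : G (TensorProduct.assoc k B B U (z ⊗ₜ u))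
            = ι u x • LinearMap.mul' k B ((HopfAlgebra.antipode k (A := B)).lTensor B z) := by
          induction z with
          | zero => simp
          | add x y hx hy => simp only [map_add, TensorProduct.add_tmul, hx, hy, smul_add]
          | tmul a b => simp [G]
        rw [LinearMap.rTensor_tmul, h3, HopfAlgebra.mul_antipode_lTensor_comul_apply]
        simp [Algebra.algebraMap_eq_smul_one, smul_smul, mul_comm]
    rw [coact_tmul, h1, ← coact_coassoc, h2, YDModule.counit_coact, coact_unit]
    simp

lemma IsHopfSubalgebraOfFiniteDual.isYDHom_pairing (hU : IsHopfSubalgebraOfFiniteDual 𝓗 𝓤 ι)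
    (hj : IsYDHom B j) : IsYDHom B (TensorProduct.lift ι ∘ₗ j.lTensor U) :=
  hU.isYDHom_lift.comp hj.lTensor

lemma op20_comp {X Y M N : Type*} [AddCommGroup X] [Module k X] [AddCommGroup Y] [Module k Y]
    [AddCommGroup M] [Module k M] [AddCommGroup N] [Module k N] (q : X ⊗[k] Y →ₗ[k] k)
    (f : M ⊗[k] N →ₗ[k] X ⊗[k] Y) : op20 (T := T) (q ∘ₗ f) = op20 q ∘ₗ op22 f := by
  ext; simp [op20, op22]

/-- The evaluation pairing of `U` with a braided Hopf subalgebra `V` of `H`. -/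
lemma bialgebraPairing_eval (hU : IsHopfSubalgebraOfFiniteDual 𝓗 𝓤 ι)
    (hV : IsHopfSubalgebra 𝓗 𝓥 j) :
    BialgebraPairing 𝓤 𝓥 (TensorProduct.lift ι ∘ₗ j.lTensor U) := by
  have h := hU.pairing.bialgebraPairing hU.isYDHom_lift
  set e := TensorProduct.lift ι
  have he : op20 (T := k) (e ∘ₗ j.lTensor U) = op20 e ∘ₗ ▹(op11 j) := by ext; simp [op20, op11]
  have hj : Fact (IsYDHom B j) := ⟨hV.hom⟩
  have hm : Rw (op11 j) (op21 (T := k) 𝓥.mul) (op21 𝓗.mul ∘ₗ op11 j ∘ₗ ▹(op11 j)) := ⟨fun x => by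
    refine LinearMap.congr_fun (f := op11 j ∘ₗ op21 𝓥.mul) (ext_three fun x y t => ?_) x
    simp [op11_tmul, op21_tmul, hV.map_mul]⟩
  have hd : Rw (op12 𝓗.comul) (op11 (T := k) j) (▹(op11 j) ∘ₗ op11 j ∘ₗ op12 𝓥.comul) := ⟨fun x => by
    refine LinearMap.congr_fun (f := op12 𝓗.comul ∘ₗ op11 j) (TensorProduct.ext' fun v t => ?_) x
    simp only [LinearMap.comp_apply]
    rw [op12_tmul, op11_tmul, op12_tmul, ← hV.map_comul]
    generalize 𝓥.comul v = z
    induction z with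
    | zero => simp
    | add x y hx hy => simp only [map_add, TensorProduct.add_tmul, hx, hy]
    | tmul x y => simp [op11_tmul]⟩
  refine ⟨hU.isYDHom_pairing hV.hom, fun x => ?_, fun x => ?_, fun f => ?_, fun x => ?_⟩
  · simp only [he, Rw.eq, LinearMap.lTensor_comp, LinearMap.comp_apply]
  · simp only [he, Rw.eq, LinearMap.lTensor_comp, LinearMap.comp_apply]
  · simp [e, hV.map_one, hU.pairing.pair_one]
  · simp [e, hU.pairing.one_pair, hV.map_counit]

lemma AlgStr.IsYDAlgebra.braiding_one {X : AlgStr k U} (hX : X.IsYDAlgebra B) (v : V) :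
    braiding (k := k) B V U (v ⊗ₜ X.one) = X.one ⊗ₜ v := by
  simpa [braiding_unit_right] using braiding_nat_right hX.one_hom (v ⊗ₜ[k] (1 : k))

lemma AlgStr.IsYDAlgebra.one_braiding {X : AlgStr k U} (hX : X.IsYDAlgebra B) (v : V) :
    braiding (k := k) B U V (X.one ⊗ₜ v) = v ⊗ₜ X.one := by
  simpa [braiding_unit_left] using braiding_nat_left hX.one_hom ((1 : k) ⊗ₜ[k] v)

/-- The pairing `⟨,⟩_ev C`. -/
lemma bialgebraPairing_comp_braiding (q : U ⊗[k] V →ₗ[k] k) [hq : BialgebraPairing 𝓤 𝓥 q]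
    [Symmetric (k := k) B V U] : BialgebraPairing 𝓥 𝓤 (q ∘ₗ braiding B V U) where
  hom := hq.hom.comp (.braiding B V U)
  pair_mul x := by
    simp only [op20_comp, Rw.eq, LinearMap.lTensor_comp, LinearMap.comp_apply,
      LinearMap.lTensor_id, LinearMap.id_apply]
  mul_pair x := by
    simp only [op20_comp, Rw.eq, LinearMap.lTensor_comp, LinearMap.comp_apply,
      LinearMap.lTensor_id, LinearMap.id_apply]
  pair_one f := by
    rw [LinearMap.comp_apply, 𝓤.isYDAlgebra.braiding_one, hq.one_pair]
  one_pair x := by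
    rw [LinearMap.comp_apply, 𝓥.isYDAlgebra.one_braiding, hq.pair_one]

-- For each functional, density gives an element of `U` with the same value at `j v`, so all
-- functionals vanish there.
omit [YDModule k B U] in
lemma pairing_eval_nondegenerate (hV : IsHopfSubalgebra 𝓗 𝓥 j) (hdense : IsDenseInDual ι) (v : V)
    (h : ∀ u, (TensorProduct.lift ι ∘ₗ j.lTensor U) (u ⊗ₜ v) = 0) : v = 0 := by
  apply hV.injective
  rw [map_zero, ← Module.forall_dual_apply_eq_zero_iff k]
  intro f
  obtain ⟨u, hu⟩ := hdense f {j v}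
  rw [← hu _ (Finset.mem_singleton_self _)]
  simpa using h u

/-- Because `C² = id`, `q(u ⊗ v)` is the braided pairing evaluated at `u₍₋₁₎ • v ⊗ u₍₀₎`.
Equivariance transfers the action to the second argument, leaving values of the pairing at `v`
itself, which vanish. -/
lemma comp_braiding_nondegenerate {q : U ⊗[k] V →ₗ[k] k} (hq : IsYDHom B q)
    [h : Symmetric (k := k) B U V] (hn : ∀ v, (∀ u, q (u ⊗ₜ v) = 0) → v = 0) (v : V)
    (hv : ∀ u, (q ∘ₗ braiding B V U) (v ⊗ₜ u) = 0) : v = 0 := by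
  refine hn v fun u => ?_
  have h1 : q (u ⊗ₜ v) = (q ∘ₗ braiding B V U) (braiding B U V (u ⊗ₜ v)) := by
    rw [LinearMap.comp_apply, ← LinearMap.comp_apply (braiding B V U), h.comp_eq]
    rfl
  rw [h1, braiding_tmul]
  generalize coact k B U u = z
  induction z with
  | zero => simp
  | add x y hx hy => rw [map_add, map_add, hx, hy, add_zero]
  | tmul b u =>
    rw [LinearMap.rTensor_tmul, LinearMap.flip_apply, AlgHom.toLinearMap_apply,
      (hq.comp (.braiding B V U)).apply_act_tmul, show (q ∘ₗ braiding B V U) ∘ₗ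
        TensorProduct.mk k V U v = 0 from LinearMap.ext hv, LinearMap.zero_comp]
    generalize Coalgebra.comul (R := k) b = z
    induction z with
    | zero => simp
    | add x y hx hy => rw [map_add, hx, hy, add_zero]
    | tmul x y => simp

end pairings

/-! ### The inverse antipode in the symmetric case -/

section inverse
variable {k : Type*} [Field k] {B : Type*} [Ring B] [HopfAlgebra k B]
variable {H T : Type*} [AddCommGroup H] [Module k H] [YDModule k B H]
  [AddCommGroup T] [Module k T] (𝓗 : BraidedHopfAlgebra k B H)

local prefix:max "▹" => LinearMap.lTensor _

/-- `θ` is inverse to the antipode. -/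
class IsAntipodeInverse (θ : H →ₗ[k] H) : Prop where
  apply_antipode : ∀ x, θ (𝓗.antipode x) = x
  antipode_apply : ∀ x, 𝓗.antipode (θ x) = x

lemma exists_isAntipodeInverse (h : Function.Bijective 𝓗.antipode) :
    ∃ θ : H →ₗ[k] H, IsAntipodeInverse 𝓗 θ ∧ IsYDHom B θ := by
  let e := LinearEquiv.ofBijective _ h
  exact ⟨e.symm, ⟨e.symm_apply_apply, e.apply_symm_apply⟩, IsYDHom.symm (e := e) 𝓗.antipode_hom⟩

variable (θ : H →ₗ[k] H) [hθ : IsAntipodeInverse 𝓗 θ]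

instance : Rw (op11 (T := T) 𝓗.antipode) (op11 θ) LinearMap.id := ⟨fun x => by
  refine LinearMap.congr_fun (f := op11 𝓗.antipode ∘ₗ op11 θ) (TensorProduct.ext' fun x t => ?_) x
  simp [op11_tmul, hθ.antipode_apply]⟩

include hθ in
lemma op11_antipode_injective : Function.Injective (op11 (T := T) 𝓗.antipode) := by
  refine Function.LeftInverse.injective (g := op11 θ) fun x => ?_
  refine LinearMap.congr_fun (f := op11 θ ∘ₗ op11 𝓗.antipode) (g := LinearMap.id)
    (TensorProduct.ext' fun x t => ?_) x
  simp [op11_tmul, hθ.apply_antipode]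

lemma BraidedHopfAlgebra.antipode_one : 𝓗.antipode 𝓗.one = 𝓗.one := by
  have := 𝓗.antipode_comul 𝓗.one
  rw [𝓗.comul_one, LinearMap.rTensor_tmul, 𝓗.isYDAlgebra.mul_one, 𝓗.counit_one, one_smul] at this
  exact this

variable [Symmetric (k := k) B H H]

/-- `x₂ S⁻¹(x₁) = ε(x)`. -/
lemma mul_antipodeInverse (x : H ⊗[k] T) :
    op21 𝓗.mul (▹(op11 θ) (op22 (braiding B H H) (op12 𝓗.comul x)))
      = op01 𝓗.one (op10 𝓗.counit x) := by
  -- After applying `S`, antimultiplicativity introduces a second braiding, `C² = id` removes both,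
  -- and the antipode axiom remains.
  apply (op11_antipode_injective 𝓗 θ)
  rw [op11_antipode_op21_mul, op01_apply, op11_tmul, 𝓗.antipode_one]
  simp only [opAntiMul, LinearMap.comp_apply, Rw.eq]
  simp only [LinearMap.lTensor_id, LinearMap.id_apply, Rw.eq, Rw₃.eq, LinearMap.comp_apply]
  rw [← op10_nat, op01_apply]

/-- `S⁻¹(x₂) x₁ = ε(x)`. -/
lemma antipodeInverse_mul (x : H ⊗[k] T) :
    op21 𝓗.mul (op11 θ (op22 (braiding B H H) (op12 𝓗.comul x)))
      = op01 𝓗.one (op10 𝓗.counit x) := by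
  apply (op11_antipode_injective 𝓗 θ)
  rw [op11_antipode_op21_mul, op01_apply, op11_tmul, 𝓗.antipode_one]
  simp only [opAntiMul, LinearMap.comp_apply, Rw.eq]
  simp only [LinearMap.id_apply, Rw.eq, Rw₃.eq, LinearMap.comp_apply]
  rw [← op10_nat, op01_apply]

end inverse

/-! ### The representation of `U # V` on `U` is faithful -/

section regular
variable {k : Type*} [Field k] {B : Type*} [Ring B] [HopfAlgebra k B]
variable {U V T : Type*} [AddCommGroup U] [Module k U] [YDModule k B U] [AddCommGroup V]
  [Module k V] [YDModule k B V] [AddCommGroup T] [Module k T]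
  (𝓤 : BraidedHopfAlgebra k B U) (𝓥 : BraidedHopfAlgebra k B V) (p : V ⊗[k] U →ₗ[k] k)

local prefix:max "▹" => LinearMap.lTensor _

/-- The action of `U # V` on `U`, on strings. -/
def opLam : U ⊗[k] (V ⊗[k] (U ⊗[k] T)) →ₗ[k] U ⊗[k] T :=
  op21 𝓤.mul ∘ₗ ▹(op21 (hit 𝓤 p))

lemma op21_hit : op21 (T := T) (hit 𝓤 p)
    = ▹(op20 p) ∘ₗ op22 (braiding B V U) ∘ₗ ▹(op12 𝓤.comul) :=
  op21_actionOfCoaction p 𝓤.comul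

lemma lam_tmul (u : U) (v : V) (x : U) (t : T) :
    lam 𝓤 p ((u ⊗ₜ v) ⊗ₜ x) ⊗ₜ t = opLam 𝓤 p (u ⊗ₜ[k] (v ⊗ₜ[k] (x ⊗ₜ[k] t))) := by
  simp only [lam, opLam, op21_hit, LinearMap.lTensor_comp, LinearMap.comp_apply,
    LinearMap.lTensor_tmul, op12_tmul]
  generalize 𝓤.comul x = z
  induction z with
  | zero => simp
  | add x y hx hy => simp only [map_add, TensorProduct.add_tmul, TensorProduct.tmul_add, hx, hy]
  | tmul x y =>
    simp only [midMap, LinearMap.comp_apply, LinearEquiv.coe_coe, TensorProduct.assoc_tmul,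
      LinearMap.lTensor_tmul, TensorProduct.assoc_symm_tmul, op22_tmul, LinearMap.rTensor_tmul]
    generalize braiding (k := k) B V U _ = z
    induction z with
    | zero => simp
    | add x y hx hy => simp only [map_add, TensorProduct.add_tmul, TensorProduct.tmul_add, hx, hy]
    | tmul x' v =>
      simp only [TensorProduct.map_tmul, TensorProduct.assoc_symm_tmul, TensorProduct.assoc_tmul,
        LinearMap.lTensor_tmul, TensorProduct.rid_tmul, op20_tmul, TensorProduct.tmul_smul]
      rw [← TensorProduct.tmul_smul, ← TensorProduct.tmul_smul, op21_tmul, TensorProduct.tmul_smul,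
        TensorProduct.smul_tmul']

omit [YDModule k B V] in
lemma rho_one_tmul (v : V) (x : U) (t : T) : rho 𝓤 p ((v ⊗ₜ 𝓤.one) ⊗ₜ x) ⊗ₜ t
    = op20 p (▹(op12 𝓤.comul) (v ⊗ₜ[k] (x ⊗ₜ[k] t))) := by
  simp only [rho, LinearMap.comp_apply, LinearMap.lTensor_tmul, op12_tmul]
  generalize 𝓤.comul x = z
  induction z with
  | zero => simp
  | add x y hx hy => simp only [map_add, TensorProduct.add_tmul, TensorProduct.tmul_add, hx, hy]
  | tmul x y =>
    simp [midMap, 𝓤.isYDAlgebra.one_braiding, op20_tmul, 𝓤.isYDAlgebra.mul_one,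
      TensorProduct.smul_tmul']

variable {𝓤 𝓥} [hp : BialgebraPairing 𝓥 𝓤 p] (θ : U →ₗ[k] U) [IsAntipodeInverse 𝓤 θ]
  [Fact (IsYDHom B θ)] [Symmetric (k := k) B U U]

-- Up to braidings, `u x₂ ⟨v, x₃⟩ S⁻¹(x₁) = u ⟨v, x⟩`: the functional `⟨v, ·⟩` is recovered from the
-- operator `λ(u # v)`. This is where invertibility of the antipode of `U` enters.
include hp in
lemma opLam_antipodeInverse (z : U ⊗[k] (V ⊗[k] (U ⊗[k] T))) :
    op21 𝓤.mul (▹(op11 θ) (opLam 𝓤 p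
      (▹(▹(op22 (braiding B U U))) (▹(▹(op12 𝓤.comul)) z)))) = ▹(op20 p) z := by
  have h : op21 (T := U ⊗[k] T) 𝓤.mul ∘ₗ ▹(op11 θ) ∘ₗ op22 (braiding B U U) ∘ₗ op12 𝓤.comul
      = op01 𝓤.one ∘ₗ op10 𝓤.counit := LinearMap.ext fun x => mul_antipodeInverse 𝓤 θ x
  simp only [opLam, op21_hit, LinearMap.lTensor_comp, LinearMap.comp_apply]
  calc _ = op21 𝓤.mul (▹(▹(op20 p)) (▹(op22 (braiding B V U)) (▹(▹(op21 (T := U ⊗[k] T) 𝓤.mul ∘ₗ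
        ▹(op11 θ) ∘ₗ op22 (braiding B U U) ∘ₗ op12 𝓤.comul)) (▹(▹(op12 𝓤.comul)) z)))) := by
        rw [op20_eq_braiding_left (R := U) (B := B) hp.hom]
        simp only [Rw.eq, Rw₃.eq, LinearMap.lTensor_comp, LinearMap.comp_apply,
          LinearMap.lTensor_id, LinearMap.id_apply]
    _ = _ := by
        rw [h]
        simp only [Rw.eq, LinearMap.lTensor_comp, LinearMap.comp_apply, LinearMap.lTensor_id,
          LinearMap.id_apply]
        have h1 (x : V ⊗[k] (U ⊗[k] T)) : LinearMap.lTensor U (op20 p) (op01 𝓤.one x)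
          = op01 𝓤.one (op20 p x) := rfl
        rw [lTensor_congr₂ h1, Rw.eq (f := op21 𝓤.mul) (g := ▹(op01 𝓤.one)), LinearMap.id_apply]

include hp θ in
/-- The action of `U # V` on `U` is faithful. -/
lemma eq_zero_of_lam (hn : ∀ v, (∀ u, p (v ⊗ₜ u) = 0) → v = 0) (t : U ⊗[k] V)
    (ht : ∀ x, lam 𝓤 p (t ⊗ₜ x) = 0) : t = 0 := by
  refine eq_of_lTensor_op20 hn fun y => ?_
  have h1 (w : U ⊗[k] (U ⊗[k] k)) : opLam 𝓤 p (TensorProduct.assoc k U V _ (t ⊗ₜ w)) = 0 := by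
    have h (t : U ⊗[k] V) (x : U) (w : U ⊗[k] k) : opLam 𝓤 p (TensorProduct.assoc k U V _
        (t ⊗ₜ (x ⊗ₜ w))) = lam 𝓤 p (t ⊗ₜ x) ⊗ₜ w := by
      induction t with
      | zero => simp
      | add x y hx hy => simp only [map_add, TensorProduct.add_tmul, hx, hy]
      | tmul u v => rw [lam_tmul, TensorProduct.assoc_tmul]
    induction w with
    | zero => simp
    | add x y hx hy => simp only [map_add, TensorProduct.tmul_add, hx, hy, add_zero]
    | tmul x w => rw [h, ht, TensorProduct.zero_tmul]
  -- Each contraction of `t` with `y ∈ U` is recovered from `λ(t) = 0`, hence vanishes, and the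
  -- pairing separates the points of `V`.
  rw [← opLam_antipodeInverse (B := B) p θ, ← opLam_antipodeInverse (B := B) p θ]
  congr 2
  simp only [← assoc_lTensor, LinearMap.lTensor_tmul, h1, TensorProduct.zero_tmul, map_zero]

variable (𝓤) in
/-- The map `v ⊗ x ↦ ⟨v, x₁⟩ x₂`. -/
def contract : V ⊗[k] U →ₗ[k] U := (TensorProduct.lid k U).toLinearMap ∘ₗ p.rTensor U ∘ₗ
  (TensorProduct.assoc k V U U).symm.toLinearMap ∘ₗ 𝓤.comul.lTensor V

variable (𝓤) in
omit [YDModule k B V] [Symmetric (k := k) B U U] in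
lemma op21_contract : op21 (T := T) (contract 𝓤 p) = op20 p ∘ₗ ▹(op12 𝓤.comul) := by
  refine ext_three fun v x t => ?_
  rw [LinearMap.comp_apply, ← rho_one_tmul]
  simp only [op21_tmul, contract, rho, LinearMap.comp_apply, LinearMap.lTensor_tmul]
  congr 1
  generalize 𝓤.comul x = z
  induction z with
  | zero => simp
  | add x y hx hy => simp only [map_add, TensorProduct.tmul_add, hx, hy]
  | tmul x y => simp [midMap, 𝓤.isYDAlgebra.one_braiding, 𝓤.isYDAlgebra.mul_one]

omit [Symmetric (k := k) B U U] in
include hp in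
lemma IsYDHom.contract : IsYDHom B (contract 𝓤 p) :=
  lid.comp (hp.hom.rTensor.comp (assoc_symm.comp 𝓤.comul_hom.lTensor))

omit [Symmetric (k := k) B U U] in
include hp in
lemma IsYDHom.lam : IsYDHom B (lam 𝓤 p) :=
  rid.comp ((𝓤.isYDAlgebra.mul_hom.map hp.hom).comp ((IsYDHom.braiding B V U).midMap.comp
    𝓤.comul_hom.lTensor))

include hp θ in
/-- Under the `RL`-condition, the map `v ↦ ρ(v # 1)` lifts to a morphism `V → U # V`. -/
theorem exists_lift_of_RLCondition [FiniteDimensional k B]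
    (hn : ∀ v, (∀ u, p (v ⊗ₜ u) = 0) → v = 0) (hRL : RLCondition 𝓤 p) :
    ∃ w : V →ₗ[k] U ⊗[k] V, IsYDHom B w ∧
      ∀ v x, lam 𝓤 p (w v ⊗ₜ x) = contract 𝓤 p (v ⊗ₜ x) := by
  -- A linear left inverse of the faithful map `λ` makes the choice in the `RL`-condition linear in
  -- `v`.
  obtain ⟨g, hg⟩ := LinearMap.exists_leftInverse_of_injective (TensorProduct.curry (lam 𝓤 p))
    (LinearMap.ker_eq_bot'.2 fun t ht => eq_zero_of_lam p θ hn t fun x => LinearMap.congr_fun ht x)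
  have hw (v : V) (x : U) : lam 𝓤 p ((g ∘ₗ TensorProduct.curry (contract 𝓤 p)) v ⊗ₜ x)
      = contract 𝓤 p (v ⊗ₜ x) := by
    obtain ⟨t, ht⟩ := hRL v
    have h1 : TensorProduct.curry (contract 𝓤 p) v = TensorProduct.curry (lam 𝓤 p) t := by
      ext x
      rw [TensorProduct.curry_apply, TensorProduct.curry_apply, ← ht]
      apply tmul_one_injective (k := k)
      rw [rho_one_tmul, ← LinearMap.comp_apply, ← op21_contract, op21_tmul]
    have h2 := LinearMap.congr_fun hg t
    rw [LinearMap.comp_apply, LinearMap.id_apply] at h2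
    rw [LinearMap.comp_apply, h1, h2, ← TensorProduct.curry_apply, ← h1, TensorProduct.curry_apply]
  -- The left inverse of `λ` need not be a morphism; its composite with the contraction is one,
  -- because `λ` and the contraction are morphisms and `λ` is faithful.
  exact ⟨_, isYDHom_of_apply (IsYDHom.lam p) (IsYDHom.contract p)
    (fun t ht => eq_zero_of_lam p θ hn t ht) hw, hw⟩

end regular

/-! ### Commutation relations of the lift `w : V → U # V` -/

section lift
variable {k : Type*} [Field k] {B : Type*} [Ring B] [HopfAlgebra k B]
variable {U V S T : Type*} [AddCommGroup U] [Module k U] [YDModule k B U] [AddCommGroup V]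
  [Module k V] [YDModule k B V] [AddCommGroup T] [Module k T]
  [AddCommGroup S] [Module k S]
  {𝓤 : BraidedHopfAlgebra k B U} {𝓥 : BraidedHopfAlgebra k B V} {p : V ⊗[k] U →ₗ[k] k}

local prefix:max "▹" => LinearMap.lTensor _

instance comoduleAlgebra_comul (𝓗 : BraidedHopfAlgebra k B U) :
    ComoduleAlgebra 𝓗 𝓗.toAlgStr 𝓗.comul :=
  ⟨𝓗.isYDAlgebra, 𝓗.comul_hom, 𝓗.coassoc, 𝓗.comul_counit, 𝓗.comul_mul, 𝓗.comul_one⟩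

instance moduleAlgebra_hit [BialgebraPairing 𝓥 𝓤 p] : ModuleAlgebra 𝓥 𝓤.toAlgStr (hit 𝓤 p) :=
  ⟨isModuleAlgebra_actionOfCoaction p 𝓤.comul⟩

/-- The map `w : V → U # V` lifts `v ↦ ρ(v # 1)` along the faithful representation of `U # V`
on `U`. -/
class RLLift {k : Type*} [Field k] {B : outParam (Type*)} {_ : outParam (Ring B)}
    {_ : outParam (HopfAlgebra k B)} {U V : Type*} [AddCommGroup U] [Module k U]
    [iU : outParam (YDModule k B U)] [AddCommGroup V] [Module k V] [iV : outParam (YDModule k B V)]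
    (𝓤 : outParam (BraidedHopfAlgebra k B U)) (𝓥 : outParam (BraidedHopfAlgebra k B V))
    (p : outParam (V ⊗[k] U →ₗ[k] k)) (w : V →ₗ[k] U ⊗[k] V) : Prop where
  pairing : BialgebraPairing 𝓥 𝓤 p
  hom : IsYDHom B w
  faithful : ∀ t, (∀ x, lam 𝓤 p (t ⊗ₜ x) = 0) → t = 0
  lam_apply : ∀ v x, lam 𝓤 p (w v ⊗ₜ x) = contract 𝓤 p (v ⊗ₜ x)

variable (𝓤 𝓥 p) in
/-- The product of `U # V`, on strings. -/
abbrev opMul : U ⊗[k] (V ⊗[k] (U ⊗[k] (V ⊗[k] T))) →ₗ[k] U ⊗[k] (V ⊗[k] T) :=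
  opTwist 𝓤.toAlgStr 𝓥.toAlgStr (smashTwist 𝓥 (hit 𝓤 p))

lemma opMul_nat (f : S →ₗ[k] T) (z : U ⊗[k] (V ⊗[k] (U ⊗[k] (V ⊗[k] S)))) :
    ▹(▹f) (opMul 𝓤 𝓥 p z) = opMul 𝓤 𝓥 p (▹(▹(▹(▹f))) z) := by
  simp only [opMul, opTwist, LinearMap.comp_apply, op21_nat,
    lTensor_congr₂ (lTensor_congr₂ (fun z => (op21_nat 𝓥.mul f z).symm)),
    lTensor_congr₂ (op22_nat (smashTwist 𝓥 (hit 𝓤 p)) (f.lTensor V))]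

variable (w : V →ₗ[k] U ⊗[k] V) [h : RLLift 𝓤 𝓥 p w]

include h

/-- `λ` is a representation: `U` acts by left multiplication, `V` by `⇀`, and `U` is a `V`-module
algebra. -/
lemma opLam_opMul (z : U ⊗[k] (V ⊗[k] (U ⊗[k] (V ⊗[k] (U ⊗[k] T))))) :
    opLam 𝓤 p (opMul 𝓤 𝓥 p z) = opLam 𝓤 p (▹(▹(opLam 𝓤 p)) z) := by
  have := h.pairing
  simp only [opMul, opLam, opTwist, op22_smashTwist, Rw.eq, LinearMap.lTensor_comp,
    LinearMap.comp_apply]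

lemma opLam_op12 (z : V ⊗[k] (U ⊗[k] T)) :
    opLam 𝓤 p (op12 w z) = op21 (contract 𝓤 p) z := by
  refine LinearMap.congr_fun (f := opLam 𝓤 p ∘ₗ op12 w) (ext_three fun v x t => ?_) z
  rw [LinearMap.comp_apply, op12_tmul, op21_tmul, ← h.lam_apply]
  generalize w v = z
  induction z with
  | zero => simp
  | add x y hx hy => simp only [map_add, TensorProduct.add_tmul, hx, hy]
  | tmul u v => rw [lam_tmul, TensorProduct.assoc_tmul]

/-- Faithfulness of `λ` on strings; it reduces each relation below to an identity between operators
on `U`. -/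
lemma eq_of_opLam {z z' : U ⊗[k] (V ⊗[k] T)} (hz : ∀ x, opLam 𝓤 p (▹(▹(op01 x)) z)
    = opLam 𝓤 p (▹(▹(op01 x)) z')) : z = z' := by
  rw [← sub_eq_zero]
  let e := (TensorProduct.assoc k U V T).symm.trans (TensorProduct.comm k (U ⊗[k] V) T)
  apply e.injective
  rw [map_zero]
  refine eq_zero_of_lTensor_apply h.faithful _ fun x => ?_
  have h1 (z : U ⊗[k] (V ⊗[k] T)) : opLam 𝓤 p (▹(▹(op01 x)) z) = TensorProduct.comm k T U
      ((lam 𝓤 p ∘ₗ (TensorProduct.mk k (U ⊗[k] V) U).flip x).lTensor T (e z)) := by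
    refine LinearMap.congr_fun (f := opLam 𝓤 p ∘ₗ ▹(▹(op01 x))) (g := (TensorProduct.comm k T U).toLinearMap
      ∘ₗ (lam 𝓤 p ∘ₗ (TensorProduct.mk k (U ⊗[k] V) U).flip x).lTensor T ∘ₗ e.toLinearMap)
      (ext_three fun u v t => ?_) z
    simp [e, op01_apply, lam_tmul]
  apply (TensorProduct.comm k T U).injective
  rw [← h1, map_sub, map_sub, hz, sub_self, map_zero]

/-- Contracting by `v'` and then by `v` gives `⟨v', x₁⟩ ⟨v, x₂⟩ x₃`, in which the factors appear in
the order of `v' v`. Hence `w` reverses products. -/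
lemma op12_lift_mul [Symmetric (k := k) B V V] (z : V ⊗[k] (V ⊗[k] T)) :
    opMul 𝓤 𝓥 p (op12 w (▹(op12 w) z)) = op12 w (op21 𝓥.mul (op22 (braiding B V V) z)) := by
  refine eq_of_opLam w fun x => ?_
  have := h.pairing
  rw [opMul_nat, ← op12_nat, ← lTensor_congr₂ (op12_nat w _), ← op12_nat, op21_nat, ← op22_nat,
    opLam_opMul w, opLam_op12 w]
  generalize ▹(▹(op01 x)) z = y
  rw [← op12_nat, ← LinearMap.lTensor_comp_apply V (opLam 𝓤 p) (op12 w),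
    show opLam 𝓤 p ∘ₗ op12 w = op21 (contract 𝓤 p) from LinearMap.ext (opLam_op12 w), opLam_op12 w]
  simp only [op21_contract, LinearMap.lTensor_comp, LinearMap.comp_apply]
  rw [op20_eq_braiding_right (R := V) (B := B) this.hom]
  simp only [Rw.eq, LinearMap.lTensor_comp, LinearMap.comp_apply]

lemma op12_lift_one (z : T) : op12 w (op01 𝓥.one z) = op01 𝓤.one (op01 𝓥.one z) := by
  refine eq_of_opLam w fun x => ?_
  have := h.pairing
  rw [← op12_nat, opLam_op12 w, op21_contract, LinearMap.comp_apply, ← op01_nat, ← op01_nat,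
    Rw.eq (f := op20 p) (g := op01 𝓥.one), Rw.eq (f := op10 𝓤.counit) (g := op12 𝓤.comul),
    LinearMap.id_apply, opLam, LinearMap.comp_apply, ← op01_nat, ← op01_nat, ← op01_nat,
    Rw.eq (f := op21 𝓤.mul) (g := op01 𝓤.one), LinearMap.id_apply,
    Rw.eq (f := op21 (hit 𝓤 p)) (g := op01 𝓥.one), LinearMap.id_apply]

/-- On `U`, `w(v')` contracts the first leg of the coproduct and `1 # v` the last; by
coassociativity these operators commute up to the braiding. -/
lemma opMul_one_lift [Symmetric (k := k) B V V] (z : V ⊗[k] (V ⊗[k] T)) :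
    opMul 𝓤 𝓥 p (op01 𝓤.one (▹(op12 w) z))
      = ▹(op21 𝓥.mul) (op12 w (op22 (braiding B V V) z)) := by
  refine eq_of_opLam w fun x => ?_
  have := h.pairing
  rw [opMul_nat, ← op01_nat, ← lTensor_congr₂ (op12_nat w _), opLam_opMul w,
    ← lTensor_congr₂ (fun z => (op21_nat 𝓥.mul (op01 x) z).symm), ← op12_nat, ← op22_nat]
  generalize ▹(▹(op01 x)) z = y
  have h1 (z : U ⊗[k] (V ⊗[k] (V ⊗[k] (U ⊗[k] T)))) :
      opLam 𝓤 p (▹(op21 𝓥.mul) z) = opLam 𝓤 p (▹(▹(op21 (hit 𝓤 p))) z) := by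
    simp only [opLam, Rw.eq, LinearMap.lTensor_comp, LinearMap.comp_apply]
  rw [h1, ← op12_nat, opLam_op12 w, ← op01_nat, ← LinearMap.lTensor_comp_apply V (opLam 𝓤 p),
    show opLam 𝓤 p ∘ₗ op12 w = op21 (contract 𝓤 p) from LinearMap.ext (opLam_op12 w), opLam,
    LinearMap.comp_apply, ← op01_nat, Rw.eq (f := op21 𝓤.mul) (g := op01 𝓤.one),
    LinearMap.id_apply]
  simp only [op21_contract, op21_hit, LinearMap.lTensor_comp, LinearMap.comp_apply]
  rw [op20_eq_braiding_right (R := V) (B := B) this.hom]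
  simp only [Rw.eq, LinearMap.lTensor_comp, LinearMap.comp_apply]

/-- Applied to `x`, the left-hand side contracts the product `ux`. The coproduct of `ux` is
multiplicative and pairing with `v` splits over `v₁` and `v₂`, so it is the product of the
contractions of `u` and `x`. -/
lemma opMul_lift_left [Symmetric (k := k) B V U] (z : V ⊗[k] (U ⊗[k] T)) :
    opMul 𝓤 𝓥 p (op12 w (▹(▹(op01 𝓥.one)) z))
      = op21 𝓤.mul (▹(op12 w) (op21 (contract 𝓤 p) (▹(op22 (braiding B V U)) (op12 𝓥.comul z)))) := by
  refine eq_of_opLam w fun x => ?_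
  have := h.pairing
  have h1 (z : U ⊗[k] (U ⊗[k] (V ⊗[k] (U ⊗[k] T)))) :
      opLam 𝓤 p (op21 𝓤.mul z) = op21 𝓤.mul (▹(opLam 𝓤 p) z) := by
    simp only [opLam, Rw.eq, LinearMap.lTensor_comp, LinearMap.comp_apply]
  have h2 : opLam 𝓤 p ∘ₗ ▹(op01 𝓥.one) = op21 (T := T) 𝓤.mul := LinearMap.ext fun z => by
    simp only [opLam, Rw.eq, LinearMap.comp_apply, LinearMap.lTensor_id, LinearMap.id_apply]
  have h3 (z : T) : LinearMap.lTensor V (op01 x) (op01 𝓥.one z)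
      = op01 𝓥.one (op01 (k := k) x z) := rfl
  rw [opMul_nat, ← op12_nat, lTensor_congr₂ (lTensor_congr₂ h3), opLam_opMul w, ← op12_nat,
    opLam_op12 w, ← LinearMap.lTensor_comp_apply V (opLam 𝓤 p), h2,
    op21_nat, h1, ← lTensor_congr₂ (op12_nat w _), ← LinearMap.lTensor_comp_apply U (opLam 𝓤 p),
    show opLam 𝓤 p ∘ₗ op12 w = op21 (contract 𝓤 p) from LinearMap.ext (opLam_op12 w), op21_nat,
    ← lTensor_congr₂ (op22_nat (braiding B V U) (op01 x)), ← op12_nat]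
  generalize ▹(▹(op01 x)) z = y
  simp only [op21_contract, Rw.eq, LinearMap.lTensor_comp, LinearMap.comp_apply]
  -- Pulling the strand of `U` across the pairing creates a crossing that cancels the one present,
  -- by `C_{U,V} C_{V,U} = id`.
  have h4 (z : V ⊗[k] (U ⊗[k] (U ⊗[k] (U ⊗[k] T)))) : ▹(op20 p) (op22 (braiding B V U) z)
      = op20 p (▹(op22 (braiding B U U)) z) := by
    rw [op20_eq_braiding_right (R := U) (B := B) this.hom]
    simp only [Rw.eq, LinearMap.comp_apply, LinearMap.id_apply]
  rw [lTensor_congr₂ (lTensor_congr₂ h4)]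
  simp only [Rw.eq, LinearMap.lTensor_comp, LinearMap.comp_apply]

end lift

/-! ### The elements `r₀ w(r₁)` braided-commute with `U # V` -/

section exchange
variable {k : Type*} [Field k] {B : Type*} [Ring B] [HopfAlgebra k B]
variable {R U V S T : Type*} [AddCommGroup R] [Module k R] [YDModule k B R]
  [AddCommGroup U] [Module k U] [YDModule k B U] [AddCommGroup V]
  [Module k V] [YDModule k B V] [AddCommGroup T] [Module k T] [AddCommGroup S] [Module k S]
  {𝓤 : BraidedHopfAlgebra k B U} {𝓥 : BraidedHopfAlgebra k B V}

local prefix:max "▹" => LinearMap.lTensor _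

section
variable {p : V ⊗[k] U →ₗ[k] k}

lemma opMul_one (z : V ⊗[k] (U ⊗[k] (V ⊗[k] T))) : opMul 𝓤 𝓥 p (op01 𝓤.one z)
    = ▹(op21 𝓥.mul) (op22 (smashTwist 𝓥 (hit 𝓤 p)) z) := by
  simp only [opMul, opTwist, LinearMap.comp_apply]
  rw [← op01_nat, ← op01_nat, Rw.eq (f := op21 𝓤.mul) (g := op01 𝓤.one), LinearMap.id_apply]

/-- The product of `U # V` is left linear over `U` and, by the next lemma, right linear over `V`.
This reduces commutation with `u # v` to the factors `u # 1` and `1 # v`. -/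
lemma opMul_eq_op21_mul (z : U ⊗[k] (V ⊗[k] (U ⊗[k] (V ⊗[k] T)))) :
    opMul 𝓤 𝓥 p z = op21 𝓤.mul (▹(opMul 𝓤 𝓥 p) (▹(op01 𝓤.one) z)) := by
  rw [← LinearMap.lTensor_comp_apply, show opMul 𝓤 𝓥 p ∘ₗ op01 𝓤.one = ▹(op21 𝓥.mul) ∘ₗ
    op22 (T := V ⊗[k] T) (smashTwist 𝓥 (hit 𝓤 p)) from LinearMap.ext opMul_one]
  simp only [opMul, opTwist, LinearMap.lTensor_comp, LinearMap.comp_apply]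

lemma opMul_eq_lTensor_op21_mul (z : U ⊗[k] (V ⊗[k] (U ⊗[k] (V ⊗[k] T)))) :
    opMul 𝓤 𝓥 p z = ▹(op21 𝓥.mul) (opMul 𝓤 𝓥 p (▹(▹(▹(op01 𝓥.one))) z)) := by
  simp only [opMul, opTwist, LinearMap.comp_apply]
  rw [lTensor_congr₂ (op22_nat (smashTwist 𝓥 (hit 𝓤 p)) (op01 𝓥.one)),
    lTensor_congr₂ (W := U) (lTensor_congr₂ (W := U) (f' := LinearMap.id) (g' := LinearMap.id)
      (Rw.eq (f := op21 (T := V ⊗[k] T) 𝓥.mul) (g := ▹(op01 𝓥.one)))), op21_nat]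
  simp only [LinearMap.lTensor_id, LinearMap.id_apply]

end

variable {q : U ⊗[k] V →ₗ[k] k} {X : AlgStr k R}
  (ψ : R →ₗ[k] R ⊗[k] V) [hψ : ComoduleAlgebra 𝓥 X ψ]
  (w : V →ₗ[k] U ⊗[k] V) [h : RLLift 𝓤 𝓥 (q ∘ₗ braiding B V U) w]
  [Symmetric (k := k) B V U] [Symmetric (k := k) B U V]

-- Commutation with `u # 1`: by `opMul_lift_left`, passing `u` to the left of `w(r₁)` costs a
-- pairing of `u₁` with a leg of `r`, and this is exactly how `u₁` acts on `r`.
include hψ in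
lemma op22_smashTwist_lift (z : U ⊗[k] (R ⊗[k] T)) :
    ▹(op21 𝓤.mul) (op22 (smashTwist 𝓤 (actionOfCoaction (B := B) q ψ))
      (▹(▹(op12 w)) (▹(op12 ψ) z)))
    = ▹(opMul 𝓤 𝓥 (q ∘ₗ braiding B V U)) (▹(op12 w) (▹(▹(▹(op01 𝓥.one)))
      (op12 ψ (op22 (braiding B U R) z)))) := by
  have h1 (z : V ⊗[k] (U ⊗[k] T)) := opMul_lift_left w z
  rw [← LinearMap.lTensor_comp_apply R _ (▹(▹(op01 𝓥.one))), lTensor_congr₂ (W := R)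
    (f' := op21 𝓤.mul) (g' := ▹(op12 w) ∘ₗ op21 (contract 𝓤 (q ∘ₗ braiding B V U)) ∘ₗ
      (▹(op22 (braiding B V U))) ∘ₗ (op12 𝓥.comul)) h1]
  simp only [op22_smashTwist, op21_actionOfCoaction, op21_contract, op20_comp, Rw.eq,
    LinearMap.lTensor_comp, LinearMap.comp_apply, LinearMap.lTensor_id, LinearMap.id_apply]

-- Commutation with `1 # v`: it passes `r₀` by the braiding alone and `w(r₁)` by `opMul_one_lift`;
-- as `ψ` is a morphism, the two crossings combine into one with `r`.
omit [Symmetric (k := k) B V U] [Symmetric (k := k) B U V] in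
include hψ in
lemma lTensor_opMul_one_lift [Symmetric (k := k) B V V] (z : V ⊗[k] (R ⊗[k] T)) :
    ▹(opMul 𝓤 𝓥 (q ∘ₗ braiding B V U)) (▹(op01 𝓤.one) (op22 (braiding B V R)
      (▹(▹(op12 w)) (▹(op12 ψ) z))))
    = ▹(▹(op21 𝓥.mul)) (▹(op12 w) (op12 ψ (op22 (braiding B V R) z))) := by
  rw [op22_nat, op22_braiding_op12_right hψ.out.hom, ← LinearMap.lTensor_comp_apply R _ (▹(op12 w)),
    lTensor_congr₂ (W := R) (f' := ▹(op21 𝓥.mul)) (g' := op12 w ∘ₗ op22 (braiding B V V))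
      (fun z => opMul_one_lift w z)]
  simp only [LinearMap.lTensor_comp, LinearMap.comp_apply]

include hψ in
/-- `t r = r₀' (w(r₁') t')`, where `r' ⊗ t' = C(t ⊗ r)`, in the smash product of `R`, `U` and `V`,
where `r` stands for `r₀ w(r₁)`. -/
lemma opMul_smashTwist_lift [Symmetric (k := k) B V V] (z : U ⊗[k] (V ⊗[k] (R ⊗[k] T))) :
    ▹(opMul 𝓤 𝓥 (q ∘ₗ braiding B V U)) (op22 (smashTwist 𝓤 (actionOfCoaction (B := B) q ψ))
      (▹(op22 (braiding B V R)) (▹(▹(▹(op12 w))) (▹(▹(op12 ψ)) z))))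
    = ▹(opMul 𝓤 𝓥 (q ∘ₗ braiding B V U)) (▹(op12 w) (op12 ψ (op22 (braiding B U R)
      (▹(op22 (braiding B V R)) z)))) := by
  have hp := h.pairing
  set p := q ∘ₗ braiding B V U with h_p
  have h1 (y : U ⊗[k] (R ⊗[k] (V ⊗[k] (U ⊗[k] (V ⊗[k] T))))) : ▹(opMul 𝓤 𝓥 p)
      (op22 (smashTwist 𝓤 (actionOfCoaction (B := B) q ψ)) y) = ▹(op21 𝓤.mul)
      (op22 (smashTwist 𝓤 (actionOfCoaction (B := B) q ψ))
        (▹(▹(opMul 𝓤 𝓥 p)) (▹(▹(op01 𝓤.one)) y))) := by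
    rw [op22_nat, op22_nat, ← LinearMap.lTensor_comp_apply, ← LinearMap.lTensor_comp_apply]
    congr 2
    exact LinearMap.ext opMul_eq_op21_mul
  have h2 (y : V ⊗[k] (U ⊗[k] (V ⊗[k] T))) : opMul 𝓤 𝓥 p (op12 w y)
      = ▹(op21 𝓥.mul) (opMul 𝓤 𝓥 p (op12 w (▹(▹(op01 𝓥.one)) y))) := by
    rw [opMul_eq_lTensor_op21_mul, ← op12_nat]
  have h3 := LinearMap.congr_fun (congrArg (LinearMap.lTensor U) (LinearMap.ext
    (f := ▹(opMul 𝓤 𝓥 p) ∘ₗ ▹(op01 𝓤.one) ∘ₗ op22 (braiding B V R) ∘ₗ ▹(▹(op12 w)) ∘ₗ ▹(op12 ψ))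
    (g := ▹(▹(op21 𝓥.mul)) ∘ₗ ▹(op12 w) ∘ₗ op12 ψ ∘ₗ op22 (braiding B V R))
    (lTensor_opMul_one_lift ψ w))) z
  simp only [LinearMap.lTensor_comp, LinearMap.comp_apply] at h3
  have h4 := LinearMap.congr_fun (congrArg (LinearMap.lTensor R)
    (LinearMap.ext (f := opMul 𝓤 𝓥 p ∘ₗ op12 w) (g := ▹(op21 𝓥.mul) ∘ₗ opMul 𝓤 𝓥 p ∘ₗ op12 w ∘ₗ
      ▹(▹(op01 𝓥.one))) h2))
  simp only [LinearMap.lTensor_comp, LinearMap.comp_apply] at h4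
  have h5 (y : U ⊗[k] (U ⊗[k] (V ⊗[k] (V ⊗[k] T)))) := (op21_nat 𝓤.mul (op21 𝓥.mul) y).symm
  rw [h1, h3, op22_nat, lTensor_congr₂ h5, op22_smashTwist_lift, h4]

end exchange

/-! ### Twisting `R` with `U # V` -/

section tensorTwist
variable {k : Type*} [Field k] {B : Type*} [Ring B] [HopfAlgebra k B]
variable {R U V S T : Type*} [AddCommGroup R] [Module k R] [YDModule k B R]
  [AddCommGroup U] [Module k U] [YDModule k B U] [AddCommGroup V]
  [Module k V] [YDModule k B V] [AddCommGroup T] [Module k T] [AddCommGroup S] [Module k S]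
  {𝓤 : BraidedHopfAlgebra k B U} {𝓥 : BraidedHopfAlgebra k B V}

local prefix:max "▹" => LinearMap.lTensor _

variable {p : V ⊗[k] U →ₗ[k] k} [hp : BialgebraPairing 𝓥 𝓤 p] {X : AlgStr k R}
  {α : U ⊗[k] R →ₗ[k] R} [hα : ModuleAlgebra 𝓤 X α]

-- The Yang–Baxter relation for the three exchanges `V`–`U`, `V`–`R` and `U`–`R`. It is the
-- compatibility needed to treat `U # V` as a single factor twisted with `R`.
include hp hα in
lemma smashTwist_hexagon (z : V ⊗[k] (U ⊗[k] (R ⊗[k] T))) :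
    op22 (smashTwist 𝓤 α) (▹(op22 (braiding B V R)) (op22 (smashTwist 𝓥 (hit 𝓤 p)) z))
    = ▹(op22 (smashTwist 𝓥 (hit 𝓤 p))) (op22 (braiding B V R) (▹(op22 (smashTwist 𝓤 α)) z)) := by
  have := hp.hom
  simp only [op22_smashTwist, op21_hit, Rw.eq, LinearMap.lTensor_comp, LinearMap.comp_apply]
  rw [op20_eq_braiding_left (R := R) (B := B) hp.hom]
  simp only [Rw.eq, LinearMap.lTensor_comp, LinearMap.comp_apply]
  rw [← lTensor_congr₂ (op22_nat (braiding B V R) (op22 (braiding B V U)))]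
  simp only [Rw.eq, Rw₃.eq, LinearMap.lTensor_comp, LinearMap.comp_apply]
  rw [← lTensor_congr₂ (op22_nat (braiding B U R) (LinearMap.lTensor V (op22 (braiding B V U)))),
    ← lTensor_congr₂ (lTensor_congr₂ (op22_nat (braiding B V R) (op22 (braiding B V U))))]
  simp only [Rw₃.eq, LinearMap.lTensor_comp, LinearMap.comp_apply]

instance : Rw₃ (op22 (smashTwist 𝓤 α)) ▹(op22 (T := T) (braiding B V R))
    (op22 (smashTwist 𝓥 (hit 𝓤 p))) (▹(op22 (smashTwist 𝓥 (hit 𝓤 p))) ∘ₗ op22 (braiding B V R)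
      ∘ₗ ▹(op22 (smashTwist 𝓤 α))) := ⟨smashTwist_hexagon⟩

/-- The map `(U ⊗ V) ⊗ R → R ⊗ (U ⊗ V)` moving `R` first past `V` by `σ₂` and then past `U`
by `σ₁`. -/
def tensorTwist (σ₁ : U ⊗[k] R →ₗ[k] R ⊗[k] U) (σ₂ : V ⊗[k] R →ₗ[k] R ⊗[k] V) :
    (U ⊗[k] V) ⊗[k] R →ₗ[k] R ⊗[k] (U ⊗[k] V) :=
  (TensorProduct.assoc k R U V).toLinearMap ∘ₗ σ₁.rTensor V
    ∘ₗ (TensorProduct.assoc k U R V).symm.toLinearMap ∘ₗ σ₂.lTensor U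
    ∘ₗ (TensorProduct.assoc k U V R).toLinearMap

omit [YDModule k B R] [YDModule k B U] [YDModule k B V] in
lemma op22_tensorTwist_assoc (σ₁ : U ⊗[k] R →ₗ[k] R ⊗[k] U) (σ₂ : V ⊗[k] R →ₗ[k] R ⊗[k] V)
    (z : (U ⊗[k] V) ⊗[k] (R ⊗[k] T)) :
    ▹(TensorProduct.assoc k U V T).toLinearMap (op22 (tensorTwist σ₁ σ₂) z)
      = op22 σ₁ (▹(op22 σ₂) (TensorProduct.assoc k U V _ z)) := by
  induction z with
  | zero => simp
  | add x y hx hy => simp only [map_add, hx, hy]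
  | tmul s w =>
  induction w with
  | zero => simp
  | add x y hx hy => simp only [map_add, TensorProduct.tmul_add, hx, hy]
  | tmul r t =>
  induction s with
  | zero => simp
  | add x y hx hy => simp only [map_add, TensorProduct.add_tmul, hx, hy]
  | tmul u v =>
    simp only [op22_tmul, tensorTwist, LinearMap.comp_apply, LinearEquiv.coe_coe,
      TensorProduct.assoc_tmul, LinearMap.lTensor_tmul]
    generalize σ₂ (v ⊗ₜ r) = y
    induction y with
    | zero => simp
    | add x y hx hy => simp only [map_add, TensorProduct.add_tmul, TensorProduct.tmul_add, hx, hy]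
    | tmul r v =>
      simp only [TensorProduct.assoc_tmul, TensorProduct.assoc_symm_tmul, LinearMap.rTensor_tmul,
        op22_tmul]
      generalize σ₁ (u ⊗ₜ r) = y
      induction y with
      | zero => simp
      | add x y hx hy => simp only [map_add, TensorProduct.add_tmul, hx, hy]
      | tmul r u => simp

lemma lTensor_assoc_injective {W A A' : Type*} [AddCommGroup W] [Module k W] [AddCommGroup A]
    [Module k A] [AddCommGroup A'] [Module k A'] :
    Function.Injective (LinearMap.lTensor W (TensorProduct.assoc k A A' T).toLinearMap) :=
  ((TensorProduct.assoc k A A' T).lTensor W).injective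

section
omit [YDModule k B R] [YDModule k B U] [YDModule k B V]
variable (σ₁ : U ⊗[k] R →ₗ[k] R ⊗[k] U) (σ₂ : V ⊗[k] R →ₗ[k] R ⊗[k] V)

lemma assoc_comp_op22_tensorTwist : ▹(TensorProduct.assoc k U V T).toLinearMap ∘ₗ
    op22 (tensorTwist σ₁ σ₂) = op22 σ₁ ∘ₗ ▹(op22 σ₂) ∘ₗ
      (TensorProduct.assoc k U V _).toLinearMap :=
  LinearMap.ext (op22_tensorTwist_assoc σ₁ σ₂)
end

omit [YDModule k B R] hp in
lemma assoc_op21_smash (x : (U ⊗[k] V) ⊗[k] ((U ⊗[k] V) ⊗[k] T)) :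
    TensorProduct.assoc k U V T (op21 (smash 𝓥 𝓤.toAlgStr (hit 𝓤 p)).mul x)
      = opMul 𝓤 𝓥 p (TensorProduct.assoc k U V _ (▹(TensorProduct.assoc k U V T).toLinearMap x)) :=
  assoc_op21_twisted _ _ _ x

-- The relations for `R` follow from those of its two exchanges with `U` and `V`. For the product of
-- `U # V` the internal exchange of `V` with `U` must also slide past `R`, which is
-- `smashTwist_hexagon`.
omit hα in
lemma isTwist_tensorTwist [hα : ModuleAlgebra 𝓤 X α] :
    IsTwist X (smash 𝓥 𝓤.toAlgStr (hit 𝓤 p)) (tensorTwist (smashTwist 𝓤 α) (braiding B V R)) where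
  mul_right z := by
    have hX : Fact (X.IsYDAlgebra B) := ⟨hα.out.isYDAlgebra⟩
    have := isTwist_smashTwist 𝓤 α
    have h1 := assoc_comp_op22_tensorTwist (T := k) (smashTwist 𝓤 α) (braiding (k := k) B V R)
    apply lTensor_assoc_injective
    rw [op22_tensorTwist_assoc, assoc_lTensor, op21_nat,
      ← LinearMap.lTensor_comp_apply _ _ (op22 (tensorTwist _ _)), h1, LinearMap.lTensor_comp, LinearMap.lTensor_comp, LinearMap.comp_apply,
      LinearMap.comp_apply, op22_tensorTwist_assoc]
    simp only [Rw.eq, LinearMap.lTensor_comp, LinearMap.comp_apply]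
  mul_left z := by
    have := isTwist_smashTwist 𝓤 α
    have h1 := assoc_comp_op22_tensorTwist (T := k) (smashTwist 𝓤 α) (braiding (k := k) B V R)
    have h2 : (TensorProduct.assoc k U V k).toLinearMap ∘ₗ
        op21 (smash 𝓥 𝓤.toAlgStr (hit 𝓤 p)).mul = opMul 𝓤 𝓥 p ∘ₗ
        (TensorProduct.assoc k U V _).toLinearMap ∘ₗ ▹(TensorProduct.assoc k U V k).toLinearMap :=
      LinearMap.ext assoc_op21_smash
    have key (y : U ⊗[k] (V ⊗[k] (U ⊗[k] (V ⊗[k] (R ⊗[k] k))))) :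
        op22 (smashTwist 𝓤 α) (▹(op22 (braiding B V R)) (opMul 𝓤 𝓥 p y))
        = ▹(opMul 𝓤 𝓥 p) (op22 (smashTwist 𝓤 α) (▹(op22 (braiding B V R))
          (▹(▹(op22 (smashTwist 𝓤 α))) (▹(▹(▹(op22 (braiding B V R)))) y)))) := by
      simp only [opMul, opTwist, Rw.eq, LinearMap.lTensor_comp, LinearMap.comp_apply]
      rw [← lTensor_congr₂ (op22_nat (smashTwist 𝓥 (hit 𝓤 p)) (op22 (braiding B V R)))]
      simp only [Rw₃.eq, LinearMap.lTensor_comp, LinearMap.comp_apply]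
      simp only [Rw.eq, LinearMap.comp_apply]
    apply lTensor_assoc_injective
    rw [op22_tensorTwist_assoc, assoc_op21_smash, key, ← LinearMap.lTensor_comp_apply _ _ (op21 _),
      h2]
    simp only [LinearMap.lTensor_comp, LinearMap.comp_apply]
    congr 1
    rw [← op22_nat, op22_tensorTwist_assoc, ← LinearMap.lTensor_comp_apply _ _ (op22 (tensorTwist _ _)), h1]
    simp only [LinearMap.lTensor_comp, LinearMap.comp_apply, ← assoc_lTensor]
  one_right z := by
    have hX : Fact (X.IsYDAlgebra B) := ⟨hα.out.isYDAlgebra⟩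
    have := isTwist_smashTwist 𝓤 α
    apply lTensor_assoc_injective
    rw [op22_tensorTwist_assoc, assoc_lTensor]
    simp only [Rw.eq]
    rfl
  one_left z := by
    have hX : Fact (X.IsYDAlgebra B) := ⟨hα.out.isYDAlgebra⟩
    have := isTwist_smashTwist 𝓤 α
    have h2 : (TensorProduct.assoc k U V k).toLinearMap ∘ₗ
        op01 (smash 𝓥 𝓤.toAlgStr (hit 𝓤 p)).one = op01 𝓤.one ∘ₗ op01 𝓥.one :=
      LinearMap.ext (assoc_op01_twisted 𝓤.toAlgStr 𝓥.toAlgStr _)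
    apply lTensor_assoc_injective
    rw [op22_tensorTwist_assoc, ← LinearMap.lTensor_comp_apply _ _ (op01 _), h2,
      smash, assoc_op01_twisted]
    simp only [LinearMap.lTensor_comp, LinearMap.comp_apply]
    rw [← op01_nat, Rw.eq (f := op22 (braiding B V R)) (g := op01 𝓥.one),
      Rw.eq (f := op22 (smashTwist 𝓤 α)) (g := op01 𝓤.one)]

end tensorTwist

/-! ### Reassociating `(R # U) # V` -/

section transport
variable {k : Type*} [Field k] {B : Type*} [Ring B] [HopfAlgebra k B]
variable {R U V S T : Type*} [AddCommGroup R] [Module k R] [YDModule k B R]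
  [AddCommGroup U] [Module k U] [YDModule k B U] [AddCommGroup V]
  [Module k V] [YDModule k B V] [AddCommGroup T] [Module k T] [AddCommGroup S] [Module k S]
  {𝓤 : BraidedHopfAlgebra k B U} {𝓥 : BraidedHopfAlgebra k B V}

local prefix:max "▹" => LinearMap.lTensor _

section
variable {p : V ⊗[k] U →ₗ[k] k} {X : AlgStr k R} {α : U ⊗[k] R →ₗ[k] R}

/-- As `V` acts trivially on `R`, it passes `R` by the braiding alone, and both the action and the
exchange take place on `U`. -/
lemma assoc_op22_smashTwist_actRight (z : V ⊗[k] ((R ⊗[k] U) ⊗[k] T)) :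
    TensorProduct.assoc k R U _ (op22 (smashTwist 𝓥 (actRight (B := B) R (hit 𝓤 p))) z)
      = ▹(op22 (smashTwist 𝓥 (hit 𝓤 p))) (op22 (braiding B V R)
        (▹(TensorProduct.assoc k R U T).toLinearMap z)) := by
  have h1 : (TensorProduct.assoc k R U _).toLinearMap ∘ₗ op22 (T := T)
      (braiding B V (R ⊗[k] U)) = ▹(op22 (braiding B V U)) ∘ₗ op22 (braiding B V R) ∘ₗ
      ▹(TensorProduct.assoc k R U _).toLinearMap := LinearMap.ext op22_braiding_assoc_right
  simp only [op22_smashTwist, LinearMap.comp_apply]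
  rw [assoc_op21_actRight, ← LinearMap.lTensor_comp_apply _ _ (op22 (braiding B V (R ⊗[k] U))), h1]
  simp only [LinearMap.comp_apply, LinearMap.lTensor_comp, ← op12_nat]
  simp only [Rw.eq, LinearMap.comp_apply]

lemma assoc_assoc_op21_smash_smash (x : ((R ⊗[k] U) ⊗[k] V) ⊗[k] (((R ⊗[k] U) ⊗[k] V) ⊗[k] k)) :
    TensorProduct.assoc k R U _ (TensorProduct.assoc k (R ⊗[k] U) V _
      (op21 (smash 𝓥 (smash 𝓤 X α) (actRight (B := B) R (hit 𝓤 p))).mul x))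
    = op21 X.mul (▹(▹(opMul 𝓤 𝓥 p)) (▹(op22 (smashTwist 𝓤 α)) (▹(▹(op22 (braiding B V R)))
      (TensorProduct.assoc k R U _ (▹(▹(TensorProduct.assoc k R U _).toLinearMap)
      (TensorProduct.assoc k (R ⊗[k] U) V _ (▹(TensorProduct.assoc k (R ⊗[k] U) V k).toLinearMap
        x))))))) := by
  rw [show op21 (T := k) (smash 𝓥 (smash 𝓤 X α) (actRight (B := B) R (hit 𝓤 p))).mul = op21 ((smash 𝓤 X α).twisted 𝓥.toAlgStr
    (smashTwist 𝓥 (actRight (B := B) R (hit 𝓤 p)))).mul from rfl, assoc_op21_twisted]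
  generalize TensorProduct.assoc k (R ⊗[k] U) V _ (LinearMap.lTensor ((R ⊗[k] U) ⊗[k] V)
    (TensorProduct.assoc k (R ⊗[k] U) V k).toLinearMap x) = y
  have e1 : (TensorProduct.assoc k R U _).toLinearMap ∘ₗ op22 (T := V ⊗[k] k) (smashTwist 𝓥 (actRight (B := B) R (hit 𝓤 p)))
      = ▹(op22 (smashTwist 𝓥 (hit 𝓤 p))) ∘ₗ op22 (braiding B V R) ∘ₗ
        ▹(TensorProduct.assoc k R U _).toLinearMap :=
    LinearMap.ext assoc_op22_smashTwist_actRight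
  have e2 : (TensorProduct.assoc k R U _).toLinearMap ∘ₗ ▹(op21 (T := k) 𝓥.mul)
      = ▹(▹(op21 𝓥.mul)) ∘ₗ (TensorProduct.assoc k R U _).toLinearMap :=
    LinearMap.ext (assoc_lTensor _)
  rw [opTwist, LinearMap.comp_apply, show op21 (T := V ⊗[k] k) (smash 𝓤 X α).mul
    = op21 (X.twisted 𝓤.toAlgStr (smashTwist 𝓤 α)).mul from rfl, assoc_op21_twisted,
    LinearMap.comp_apply, ← LinearMap.lTensor_comp_apply _ _ (LinearMap.lTensor (R ⊗[k] U) (op21 _)),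
    e2, LinearMap.lTensor_comp, LinearMap.comp_apply,
    ← LinearMap.lTensor_comp_apply _ _ (op22 (smashTwist 𝓥 (actRight (B := B) R (hit 𝓤 p)))), e1]
  simp only [LinearMap.lTensor_comp, LinearMap.comp_apply, assoc_lTensor, opMul, opTwist]
  generalize TensorProduct.assoc k R U (V ⊗[k] (R ⊗[k] (U ⊗[k] (V ⊗[k] k)))) _ = y
  simp only [Rw.eq, LinearMap.lTensor_comp, LinearMap.comp_apply]

lemma assoc_assoc_op21_twisted_tensorTwist (x : (R ⊗[k] (U ⊗[k] V)) ⊗[k] ((R ⊗[k] (U ⊗[k] V)) ⊗[k] k)) :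
    ▹(TensorProduct.assoc k U V _).toLinearMap (TensorProduct.assoc k R (U ⊗[k] V) k
      (op21 (X.twisted (smash 𝓥 𝓤.toAlgStr (hit 𝓤 p))
      (tensorTwist (smashTwist 𝓤 α) (braiding B V R))).mul x))
    = op21 X.mul (▹(▹(opMul 𝓤 𝓥 p)) (▹(op22 (smashTwist 𝓤 α)) (▹(▹(op22 (braiding B V R)))
      (▹(TensorProduct.assoc k U V _).toLinearMap
      (TensorProduct.assoc k R (U ⊗[k] V) _ (▹(▹(TensorProduct.assoc k U V k).toLinearMap)
        (▹(TensorProduct.assoc k R (U ⊗[k] V) k).toLinearMap x))))))) := by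
  rw [assoc_op21_twisted]
  generalize LinearMap.lTensor _ (TensorProduct.assoc k R (U ⊗[k] V) k).toLinearMap x = y
  have e1 : (TensorProduct.assoc k U V k).toLinearMap ∘ₗ op21 (smash 𝓥 𝓤.toAlgStr (hit 𝓤 p)).mul = opMul 𝓤 𝓥 p ∘ₗ
      (TensorProduct.assoc k U V _).toLinearMap ∘ₗ ▹(TensorProduct.assoc k U V k).toLinearMap :=
    LinearMap.ext assoc_op21_smash
  have e2 := assoc_comp_op22_tensorTwist (T := U ⊗[k] (V ⊗[k] k)) (smashTwist 𝓤 α)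
    (braiding (k := k) B V R)
  simp only [opTwist, LinearMap.comp_apply]
  rw [op21_nat, ← LinearMap.lTensor_comp_apply _ _ (LinearMap.lTensor R (op21 _)),
    ← LinearMap.lTensor_comp, e1]
  simp only [LinearMap.lTensor_comp, LinearMap.comp_apply]
  rw [← lTensor_congr₂ (op22_nat (tensorTwist (smashTwist 𝓤 α) (braiding B V R)) (TensorProduct.assoc k U V k).toLinearMap),
    ← LinearMap.lTensor_comp_apply _ _ (op22 (tensorTwist (smashTwist 𝓤 α) (braiding B V R))), e2]
  simp only [LinearMap.lTensor_comp, LinearMap.comp_apply, assoc_lTensor, opMul, opTwist]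

/-- Without brackets, both products are the same string on `R, U, V, R, U, V`: the second `R` moves
left past `V` and `U`, then `U # V` multiplies. -/
lemma assoc_smash_smash_mul (x : ((R ⊗[k] U) ⊗[k] V) ⊗[k] ((R ⊗[k] U) ⊗[k] V)) :
    TensorProduct.assoc k R U V
      ((smash 𝓥 (smash 𝓤 X α) (actRight (B := B) R (hit 𝓤 p))).mul x)
    = (X.twisted (smash 𝓥 𝓤.toAlgStr (hit 𝓤 p))
        (tensorTwist (smashTwist 𝓤 α) (braiding B V R))).mul (TensorProduct.map
          (TensorProduct.assoc k R U V).toLinearMap (TensorProduct.assoc k R U V).toLinearMap x) := by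
  set γ := actRight (B := B) R (hit 𝓤 p)
  set Y := smash 𝓥 𝓤.toAlgStr (hit 𝓤 p) with hY
  set τ := tensorTwist (smashTwist 𝓤 α) (braiding (k := k) B V R)
  have h3 (r : R) (u : U) (v : V) (r' : R) (u' : U) (v' : V) : TensorProduct.assoc k R U V
      ((smash 𝓥 (smash 𝓤 X α) γ).mul (((r ⊗ₜ u) ⊗ₜ v) ⊗ₜ ((r' ⊗ₜ u') ⊗ₜ v')))
      = (X.twisted Y τ).mul ((r ⊗ₜ (u ⊗ₜ v)) ⊗ₜ (r' ⊗ₜ (u' ⊗ₜ v'))) := by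
    have h4 := assoc_assoc_op21_smash_smash (𝓤 := 𝓤) (𝓥 := 𝓥) (p := p) (X := X) (α := α) (((r ⊗ₜ u) ⊗ₜ v) ⊗ₜ (((r' ⊗ₜ u') ⊗ₜ v') ⊗ₜ 1))
    have h5 := assoc_assoc_op21_twisted_tensorTwist (𝓤 := 𝓤) (𝓥 := 𝓥) (p := p) (X := X) (α := α) ((r ⊗ₜ (u ⊗ₜ v)) ⊗ₜ ((r' ⊗ₜ (u' ⊗ₜ v')) ⊗ₜ 1))
    simp only [LinearMap.lTensor_tmul, LinearEquiv.coe_coe, TensorProduct.assoc_tmul] at h4 h5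
    rw [← h5, op21_tmul, op21_tmul] at h4
    have h6 (z : (R ⊗[k] U) ⊗[k] V) : TensorProduct.assoc k R U _ (TensorProduct.assoc k (R ⊗[k] U)
        V k (z ⊗ₜ 1)) = ▹(TensorProduct.assoc k U V _).toLinearMap (TensorProduct.assoc k R
          (U ⊗[k] V) k (TensorProduct.assoc k R U V z ⊗ₜ 1)) := by
      induction z with
      | zero => simp
      | add x y hx hy => simp only [map_add, TensorProduct.add_tmul, hx, hy]
      | tmul z v =>
        induction z with
        | zero => simp
        | add x y hx hy => simp only [map_add, TensorProduct.add_tmul, hx, hy]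
        | tmul r u => simp
    rw [h6] at h4
    exact tmul_one_injective ((TensorProduct.assoc k R (U ⊗[k] V) k).injective
      (lTensor_assoc_injective h4))
  refine LinearMap.congr_fun (f := (TensorProduct.assoc k R U V).toLinearMap ∘ₗ
    (smash 𝓥 (smash 𝓤 X α) γ).mul) (g := (X.twisted Y τ).mul ∘ₗ TensorProduct.map
      (TensorProduct.assoc k R U V).toLinearMap (TensorProduct.assoc k R U V).toLinearMap) ?_ x
  ext r u v r' u' v'
  simpa using h3 r u v r' u' v'

end
end transport

/-! ### The shear turns the braided product into the twisted one -/

section untwist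
variable {k : Type*} [Field k] {B : Type*} [Ring B] [HopfAlgebra k B]
variable {R U V S T : Type*} [AddCommGroup R] [Module k R] [YDModule k B R]
  [AddCommGroup U] [Module k U] [YDModule k B U] [AddCommGroup V]
  [Module k V] [YDModule k B V] [AddCommGroup T] [Module k T] [AddCommGroup S] [Module k S]
  {𝓤 : BraidedHopfAlgebra k B U} {𝓥 : BraidedHopfAlgebra k B V}

local prefix:max "▹" => LinearMap.lTensor _

section
variable {p : V ⊗[k] U →ₗ[k] k} (w : V →ₗ[k] U ⊗[k] V) [h : RLLift 𝓤 𝓥 p w]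

/-- The algebra `U # V`. -/
local notation "𝓨" => smash 𝓥 (BraidedHopfAlgebra.toAlgStr 𝓤) (hit 𝓤 p)

include h in
omit [AddCommGroup T] [Module k T] in
lemma fact_isYDAlgebra_smash_hit : Fact ((𝓨).IsYDAlgebra B) := by
  have := h.pairing
  exact ⟨isYDAlgebra_smash 𝓥 (hit 𝓤 p)⟩

include h in
lemma op21_smash_lift [Symmetric (k := k) B V V] (z : V ⊗[k] (V ⊗[k] T)) :
    op21 (𝓨).mul (▹(op11 w) (op11 w z)) = op11 w (op21 𝓥.mul (op22 (braiding B V V) z)) := by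
  apply (TensorProduct.assoc k U V T).injective
  have h1 : (TensorProduct.assoc k U V _).toLinearMap ∘ₗ op11 (T := T) w = op12 w := rfl
  have h2 (y : V ⊗[k] T) : TensorProduct.assoc k U V _ (op11 w y) = op12 w y := rfl
  rw [assoc_op21_smash, ← LinearMap.lTensor_comp_apply, h1, h2, ← op12_lift_mul w z,
    assoc_lTensor, op12_nat]
  rfl

include h in
lemma lift_one : w 𝓥.one = (𝓨).one := by
  have := op12_lift_one w (1 : k)
  simp only [op01_apply, op12_tmul] at this
  exact tmul_one_injective ((TensorProduct.assoc k U V k).injective this)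

end

section
variable {q : U ⊗[k] V →ₗ[k] k} {X : AlgStr k R}
  (ψ : R →ₗ[k] R ⊗[k] V) [hψ : ComoduleAlgebra 𝓥 X ψ]
  (w : V →ₗ[k] U ⊗[k] V) [h : RLLift 𝓤 𝓥 (q ∘ₗ braiding B V U) w]
  [Symmetric (k := k) B V U] [Symmetric (k := k) B U V] [Symmetric (k := k) B V V]

local notation "𝓨" => smash 𝓥 (BraidedHopfAlgebra.toAlgStr 𝓤) (hit 𝓤 (q ∘ₗ braiding B V U))
local notation "τ" => tensorTwist (smashTwist 𝓤 (actionOfCoaction (B := B) q ψ)) (braiding B V R)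

include hψ in
lemma op21_smash_tensorTwist_lift (z : (U ⊗[k] V) ⊗[k] (R ⊗[k] T)) :
    ▹(op21 (𝓨).mul) (op22 τ (▹(▹(op11 w)) (▹(op12 ψ) z)))
    = ▹(op21 (𝓨).mul) (▹(op11 w) (op12 ψ (op22 (braiding B (U ⊗[k] V) R) z))) := by
  have h1 : (TensorProduct.assoc k U V T).toLinearMap ∘ₗ op21 (𝓨).mul
      = opMul 𝓤 𝓥 (q ∘ₗ braiding B V U) ∘ₗ (TensorProduct.assoc k U V _).toLinearMap ∘ₗ
        ▹(TensorProduct.assoc k U V T).toLinearMap := LinearMap.ext assoc_op21_smash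
  have h2 : (TensorProduct.assoc k U V T).toLinearMap ∘ₗ op11 w = op12 w := rfl
  have h2' : (TensorProduct.assoc k U V (U ⊗[k] (V ⊗[k] T))).toLinearMap ∘ₗ op11 w = op12 w := rfl
  have h3 (y : V ⊗[k] ((U ⊗[k] V) ⊗[k] T)) :=
    (op11_nat w (TensorProduct.assoc k U V T).toLinearMap y).symm
  have h1' := LinearMap.congr_fun (congrArg (LinearMap.lTensor R) h1)
  simp only [LinearMap.lTensor_comp, LinearMap.comp_apply] at h1'
  apply lTensor_assoc_injective
  rw [h1', h1', lTensor_congr₂ h3, ← LinearMap.lTensor_comp_apply _ _ (op11 w), h2', ← op12_nat,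
    ← op22_nat, ← LinearMap.lTensor_comp_apply _ _ (LinearMap.lTensor R (op11 w)),
    ← LinearMap.lTensor_comp, h2, op22_tensorTwist_assoc, op22_braiding_assoc_left, assoc_lTensor,
    assoc_lTensor]
  exact opMul_smashTwist_lift ψ w _

end
section shear
variable {C : Type*} [AddCommGroup C] [Module k C]

omit [YDModule k B R] [YDModule k B V] in
/-- The map `r ⊗ c ↦ r₀ ⊗ f(r₁) c`. -/
def shear (Y : AlgStr k C) (f : V →ₗ[k] C) (ψ : R →ₗ[k] R ⊗[k] V) : R ⊗[k] C →ₗ[k] R ⊗[k] C :=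
  (Y.mul ∘ₗ f.rTensor C).lTensor R ∘ₗ (TensorProduct.assoc k R V C).toLinearMap ∘ₗ ψ.rTensor C

omit [YDModule k B R] [YDModule k B V] in
lemma op22_shear (Y : AlgStr k C) (f : V →ₗ[k] C) (ψ : R →ₗ[k] R ⊗[k] V) :
    op22 (T := T) (shear Y f ψ) = ▹(op21 Y.mul) ∘ₗ ▹(op11 f) ∘ₗ op12 ψ := by
  refine ext_three fun r c t => ?_
  simp only [LinearMap.comp_apply, op12_tmul, op22_tmul, shear, LinearMap.rTensor_tmul,
    LinearEquiv.coe_coe]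
  generalize ψ r = z
  induction z with
  | zero => simp
  | add x y hx hy => simp only [map_add, TensorProduct.add_tmul, hx, hy]
  | tmul r v => simp [op11_tmul, op21_tmul]

end shear

section
variable {q : U ⊗[k] V →ₗ[k] k} {X : AlgStr k R}
  (ψ : R →ₗ[k] R ⊗[k] V) [hψ : ComoduleAlgebra 𝓥 X ψ]
  (w : V →ₗ[k] U ⊗[k] V) [h : RLLift 𝓤 𝓥 (q ∘ₗ braiding B V U) w]
  [Symmetric (k := k) B V U] [Symmetric (k := k) B U V] [Symmetric (k := k) B V V]

local notation "𝓨" => smash 𝓥 (BraidedHopfAlgebra.toAlgStr 𝓤) (hit 𝓤 (q ∘ₗ braiding B V U))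
local notation "τ" => tensorTwist (smashTwist 𝓤 (actionOfCoaction (B := B) q ψ)) (braiding B V R)

-- In the twisted algebra, `c · r₀ w(r₁) c' = r₀ w(r₁) · c c'` up to the braiding of `c` with `r`.
-- This is the commutation of `op21_smash_tensorTwist_lift` multiplied on the right by `c'`.
include hψ in
lemma op22_tensorTwist_op22_shear
    (z : (U ⊗[k] V) ⊗[k] (R ⊗[k] ((U ⊗[k] V) ⊗[k] T))) :
    ▹(op21 (𝓨).mul) (op22 τ (▹(op22 (shear 𝓨 w ψ)) z))
    = op22 (shear 𝓨 w ψ) (▹(op21 (𝓨).mul) (op22 (braiding B (U ⊗[k] V) R) z)) := by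
  have hY := fact_isYDAlgebra_smash_hit (𝓤 := 𝓤) w
  have hY' : Fact (𝓨).IsAlgebra := ⟨hY.out.toIsAlgebra⟩
  have h1 := op21_smash_tensorTwist_lift (T := (U ⊗[k] V) ⊗[k] T) (q := q) ψ w z
  have h2 := congrArg (▹(op21 (𝓨).mul)) h1
  simp only [op22_shear, Rw.eq, LinearMap.lTensor_comp, LinearMap.comp_apply] at h2 ⊢
  rw [h2]

-- In `r₀ w(r₁) c · s₀ w(s₁) c'`, the factor `w(r₁) c` moves past `s₀ w(s₁)` up to braidings, giving
-- `r₀ s₀ w(s₁) w(r₁) c c'`. As `w` reverses products and `ψ` is multiplicative, this is the shear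
-- of `rs ⊗ cc'`.
include hψ in
set_option maxHeartbeats 800000 in
lemma opTwist_op22_shear [BialgebraPairing 𝓤 𝓥 q] (z : R ⊗[k] ((U ⊗[k] V) ⊗[k] (R ⊗[k] ((U ⊗[k] V) ⊗[k] T)))) :
    opTwist X 𝓨 τ (op22 (shear 𝓨 w ψ) (▹(▹(op22 (shear 𝓨 w ψ))) z))
    = op22 (shear 𝓨 w ψ) (opTwist X 𝓨 (braiding B (U ⊗[k] V) R) z) := by
  have hX : Fact (X.IsYDAlgebra B) := ⟨hψ.out.isYDAlgebra⟩
  have hY := fact_isYDAlgebra_smash_hit (𝓤 := 𝓤) w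
  have hY' : Fact (𝓨).IsAlgebra := ⟨hY.out.toIsAlgebra⟩
  have hp := h.pairing
  have : ModuleAlgebra 𝓤 X (actionOfCoaction (B := B) q ψ) := ⟨isModuleAlgebra_actionOfCoaction q ψ⟩
  have hτ := isTwist_tensorTwist (𝓤 := 𝓤) (𝓥 := 𝓥) (p := q ∘ₗ braiding B V U) (X := X)
    (α := actionOfCoaction (B := B) q ψ)
  have s1 (y : (U ⊗[k] V) ⊗[k] ((U ⊗[k] V) ⊗[k] (R ⊗[k] ((U ⊗[k] V) ⊗[k] T)))) :
      (▹(op21 (𝓨).mul) ∘ₗ op22 τ) (op21 (𝓨).mul y)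
      = (▹(op21 (𝓨).mul) ∘ₗ op22 τ) (▹(▹(op21 (𝓨).mul) ∘ₗ op22 τ) y) := by
    simp only [Rw.eq, LinearMap.lTensor_comp, LinearMap.comp_apply]
  have s2 : (▹(op21 (𝓨).mul) ∘ₗ op22 τ) ∘ₗ ▹(op22 (T := T) (shear 𝓨 w ψ))
      = op22 (shear 𝓨 w ψ) ∘ₗ ▹(op21 (𝓨).mul) ∘ₗ op22 (braiding B (U ⊗[k] V) R) :=
    LinearMap.ext (op22_tensorTwist_op22_shear ψ w)
  have s3 (y : V ⊗[k] ((U ⊗[k] V) ⊗[k] (R ⊗[k] ((U ⊗[k] V) ⊗[k] T)))) :=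
    op11_nat w (LinearMap.lTensor (U ⊗[k] V) (op22 (shear 𝓨 w ψ))) y
  have e : opTwist X 𝓨 τ = op21 (T := (U ⊗[k] V) ⊗[k] T) X.mul ∘ₗ ▹(▹(op21 (𝓨).mul) ∘ₗ op22 τ) := by
    rw [opTwist, LinearMap.lTensor_comp]
  -- Left multiplication by `U # V` in the twisted algebra is made opaque: only its compatibility
  -- with products and with the shear is used.
  obtain ⟨Λ, hΛ⟩ : ∃ Λ, ▹(op21 (T := T) (𝓨).mul) ∘ₗ op22 τ = Λ := ⟨_, rfl⟩
  rw [hΛ] at s1 s2 e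
  rw [e, LinearMap.comp_apply, op22_shear, LinearMap.comp_apply, lTensor_congr₂ s1,
    LinearMap.comp_apply, op12_nat, lTensor_congr₂ s3,
    ← LinearMap.lTensor_comp_apply _ _ (LinearMap.lTensor (U ⊗[k] V) (LinearMap.lTensor _ _)),
    ← LinearMap.lTensor_comp, s2, LinearMap.lTensor_comp, LinearMap.lTensor_comp,
    LinearMap.comp_apply, ← LinearMap.lTensor_comp_apply _ _
      (LinearMap.lTensor (U ⊗[k] V) (op22 (shear _ _ _))), s2]
  -- `w` reverses products; `C² = id` moves the braiding of `op21_smash_lift` to the other side.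
  have a : op11 w ∘ₗ op21 𝓥.mul (T := (U ⊗[k] V) ⊗[k] T)
      = op21 (𝓨).mul ∘ₗ ▹(op11 w) ∘ₗ op11 w ∘ₗ op22 (braiding B V V) := LinearMap.ext fun y => by
    have := op21_smash_lift w (op22 (braiding (k := k) B V V) y)
    simp only [Rw.eq, LinearMap.id_apply] at this
    exact this.symm
  have a' := LinearMap.congr_fun (congrArg (LinearMap.lTensor R) (congrArg (LinearMap.lTensor R) a))
  simp only [LinearMap.lTensor_comp, LinearMap.comp_apply] at a'
  simp only [opTwist, op22_shear, Rw.eq, LinearMap.lTensor_comp, LinearMap.comp_apply]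
  rw [a']
  simp only [Rw.eq, LinearMap.lTensor_comp, LinearMap.comp_apply]
  have r1 (y : V ⊗[k] ((U ⊗[k] V) ⊗[k] (R ⊗[k] (V ⊗[k] ((U ⊗[k] V) ⊗[k] T))))) :=
    (op11_nat w (op22 (braiding (k := k) B (U ⊗[k] V) R)) y).symm
  have r2 (y : V ⊗[k] (R ⊗[k] ((U ⊗[k] V) ⊗[k] (V ⊗[k] ((U ⊗[k] V) ⊗[k] T))))) :=
    op22_braiding_op11_left h.hom y
  have r3 (y : V ⊗[k] ((U ⊗[k] V) ⊗[k] (V ⊗[k] ((U ⊗[k] V) ⊗[k] T)))) :=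
    (op11_nat w (op22 (braiding (k := k) B (U ⊗[k] V) V)) y).symm
  have r4 (y : V ⊗[k] (V ⊗[k] ((U ⊗[k] V) ⊗[k] ((U ⊗[k] V) ⊗[k] T)))) :=
    op22_braiding_op11_left h.hom y
  have r5 : op21 (𝓨).mul ∘ₗ op21 (𝓨).mul ∘ₗ ▹(▹(op21 (T := T) (𝓨).mul))
      = op21 (𝓨).mul ∘ₗ op21 (𝓨).mul ∘ₗ op21 (𝓨).mul := by
    have r6 : op21 (𝓨).mul ∘ₗ ▹(op21 (T := T) (𝓨).mul) = op21 (𝓨).mul ∘ₗ op21 (𝓨).mul :=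
      LinearMap.ext fun y => by simp only [Rw.eq, LinearMap.comp_apply]
    refine LinearMap.ext fun y => ?_
    rw [LinearMap.comp_apply, LinearMap.comp_apply, ← op21_nat]
    exact LinearMap.congr_fun r6 _
  have r5' := LinearMap.congr_fun (congrArg (LinearMap.lTensor R) (congrArg (LinearMap.lTensor R) r5))
  simp only [LinearMap.lTensor_comp, LinearMap.comp_apply] at r5'
  rw [lTensor_congr₂ r1, lTensor_congr₂ r2, lTensor_congr₂ (lTensor_congr₂ r3),
    lTensor_congr₂ (lTensor_congr₂ r4), r5']
  simp only [Rw.eq, LinearMap.lTensor_comp, LinearMap.comp_apply]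

end

end untwist

/-! ### Inverting the shear and the duality isomorphism -/

section
variable {k : Type*} [Field k] {B : Type*} [Ring B] [HopfAlgebra k B]

local prefix:max "▹" => LinearMap.lTensor _

section
variable {A A' : Type*} [AddCommGroup A] [Module k A] [AddCommGroup A'] [Module k A']

lemma twisted_mul_map {X : AlgStr k A} {Y : AlgStr k A'} {σ τ : A' ⊗[k] A →ₗ[k] A ⊗[k] A'}
    {f : A ⊗[k] A' →ₗ[k] A ⊗[k] A'}
    (hf : ∀ z, opTwist (T := k) X Y τ (op22 f (▹(▹(op22 f)) z)) = op22 f (opTwist X Y σ z))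
    (s t : A ⊗[k] A') : (X.twisted Y τ).mul (f s ⊗ₜ f t) = f ((X.twisted Y σ).mul (s ⊗ₜ t)) := by
  apply tmul_one_injective (k := k)
  apply (TensorProduct.assoc k A A' k).injective
  have h1 := assoc_op21_twisted X Y τ (f s ⊗ₜ (f t ⊗ₜ (1 : k)))
  have h2 := assoc_op21_twisted X Y σ (s ⊗ₜ (t ⊗ₜ (1 : k)))
  rw [op21_tmul, LinearMap.lTensor_tmul, LinearEquiv.coe_coe] at h1 h2
  rw [h1, ← op22_assoc _ ((X.twisted Y σ).mul _), h2, ← hf]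
  congr 1
  rw [← assoc_lTensor, LinearMap.lTensor_tmul, op22_assoc, op22_assoc]

end

section
variable {R V C : Type*} [AddCommGroup R] [Module k R] [YDModule k B R] [AddCommGroup V]
  [Module k V] [YDModule k B V] [AddCommGroup C] [Module k C]
  {𝓥 : BraidedHopfAlgebra k B V} {X : AlgStr k R} {Y : AlgStr k C} [hY : Fact Y.IsAlgebra]
  (ψ : R →ₗ[k] R ⊗[k] V) [hψ : ComoduleAlgebra 𝓥 X ψ]

-- By coassociativity of `ψ`, the composite is the shear by the convolution `f(v₁) g(v₂)`, which is
-- trivial by `h`.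
include hψ in
lemma op22_shear_op22_shear {T : Type*} [AddCommGroup T] [Module k T] (f g : V →ₗ[k] C)
    (h : ∀ y : V ⊗[k] (C ⊗[k] T), op21 Y.mul (▹(op11 g) (op11 f (op12 𝓥.comul y)))
      = op01 Y.one (op10 𝓥.counit y)) (z : R ⊗[k] (C ⊗[k] T)) :
    op22 (shear Y f ψ) (op22 (shear Y g ψ) z) = z := by
  have h' : op21 Y.mul ∘ₗ ▹(op11 g) ∘ₗ op11 f ∘ₗ op12 𝓥.comul
      = op01 Y.one ∘ₗ op10 (T := C ⊗[k] T) 𝓥.counit := LinearMap.ext h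
  replace h' := LinearMap.congr_fun (congrArg (LinearMap.lTensor R) h')
  simp only [LinearMap.lTensor_comp, LinearMap.comp_apply] at h'
  have h2 := congrArg (▹(op21 Y.mul)) (h' (op12 ψ z))
  simp only [op22_shear, Rw.eq, LinearMap.lTensor_comp, LinearMap.comp_apply, LinearMap.lTensor_id,
    LinearMap.id_apply] at h2 ⊢
  exact h2

include hψ in
lemma shear_shear (f g : V →ₗ[k] C)
    (h : ∀ y : V ⊗[k] (C ⊗[k] k), op21 Y.mul (▹(op11 g) (op11 f (op12 𝓥.comul y)))
      = op01 Y.one (op10 𝓥.counit y)) : shear Y f ψ ∘ₗ shear Y g ψ = LinearMap.id := by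
  refine LinearMap.ext fun s => ?_
  have := op22_shear_op22_shear ψ f g h (TensorProduct.assoc k R C k (s ⊗ₜ 1))
  rw [op22_assoc, op22_assoc] at this
  exact tmul_one_injective ((TensorProduct.assoc k R C k).injective this)

include hψ in
lemma shear_one (f : V →ₗ[k] C) (h : f 𝓥.one = Y.one) :
    shear Y f ψ (X.one ⊗ₜ Y.one) = X.one ⊗ₜ Y.one := by
  simp [shear, hψ.out.map_one, h, hY.out.one_mul]

variable [YDModule k B C]

omit hY hψ in
lemma IsYDHom.shear {f : V →ₗ[k] C} (hm : IsYDHom B Y.mul) (hf : IsYDHom B f)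
    (h : IsYDHom B ψ) : IsYDHom B (shear Y f ψ) :=
  (hm.comp hf.rTensor).lTensor.comp (assoc.comp h.rTensor)

end

section
variable {R U V T : Type*} [AddCommGroup R] [Module k R] [YDModule k B R]
  [AddCommGroup U] [Module k U] [YDModule k B U] [AddCommGroup V]
  [Module k V] [YDModule k B V] [AddCommGroup T] [Module k T]
  {𝓤 : BraidedHopfAlgebra k B U} {𝓥 : BraidedHopfAlgebra k B V} {p : V ⊗[k] U →ₗ[k] k}
  (w : V →ₗ[k] U ⊗[k] V) [h : RLLift 𝓤 𝓥 p w] [Symmetric (k := k) B V V]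
  (θ : V →ₗ[k] V) [hθ : IsAntipodeInverse 𝓥 θ] [hθ' : Fact (IsYDHom B θ)]

local notation "𝓨" => smash 𝓥 (BraidedHopfAlgebra.toAlgStr 𝓤) (hit 𝓤 p)

include h

omit [Symmetric (k := k) B V V] in
lemma op11_lift_op01_one (y : T) : op11 w (op01 𝓥.one y) = op01 (k := k) (𝓨).one y := by
  rw [op01_apply, op11_tmul, lift_one w, op01_apply]

include hθ hθ'

/-- As `w` reverses products, `w(v₁) w(S⁻¹(v₂))` is `w(S⁻¹(v₂) v₁)` up to the braiding. So the
convolution inverse of `w` involves the inverse antipode of `V`, not the antipode. -/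
lemma lift_mul_lift_antipodeInverse (y : V ⊗[k] T) :
    op21 (𝓨).mul (▹(op11 (w ∘ₗ θ)) (op11 w (op12 𝓥.comul y)))
      = op01 (𝓨).one (op10 𝓥.counit y) := by
  have e : op11 (T := T) (w ∘ₗ θ) = op11 w ∘ₗ op11 θ := LinearMap.rTensor_comp ..
  rw [e, LinearMap.lTensor_comp, LinearMap.comp_apply, ← op11_nat, op21_smash_lift,
    op22_braiding_op11_right hθ'.out, antipodeInverse_mul, op11_lift_op01_one]

lemma lift_antipodeInverse_mul_lift (y : V ⊗[k] T) :
    op21 (𝓨).mul (▹(op11 w) (op11 (w ∘ₗ θ) (op12 𝓥.comul y)))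
      = op01 (𝓨).one (op10 𝓥.counit y) := by
  have e (y : V ⊗[k] (V ⊗[k] T)) : op11 (w ∘ₗ θ) y = op11 w (op11 θ y) :=
    LinearMap.congr_fun (LinearMap.rTensor_comp ..) y
  rw [e, op21_smash_lift, op22_braiding_op11_left hθ'.out, mul_antipodeInverse, op11_lift_op01_one]

end

section
variable {R U V T : Type*} [AddCommGroup R] [Module k R] [YDModule k B R]
  [AddCommGroup U] [Module k U] [YDModule k B U] [AddCommGroup V]
  [Module k V] [YDModule k B V]
  {𝓤 : BraidedHopfAlgebra k B U} {𝓥 : BraidedHopfAlgebra k B V}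
  {q : U ⊗[k] V →ₗ[k] k} {X : AlgStr k R}
  (ψ : R →ₗ[k] R ⊗[k] V) [hψ : ComoduleAlgebra 𝓥 X ψ]
  (w : V →ₗ[k] U ⊗[k] V) [h : RLLift 𝓤 𝓥 (q ∘ₗ braiding B V U) w]
  (θ : V →ₗ[k] V) [hθ : IsAntipodeInverse 𝓥 θ] [hθ' : Fact (IsYDHom B θ)]
  [Symmetric (k := k) B V U] [Symmetric (k := k) B U V] [Symmetric (k := k) B V V]
  [BialgebraPairing 𝓤 𝓥 q]

local notation "𝓨" => smash 𝓥 (BraidedHopfAlgebra.toAlgStr 𝓤) (hit 𝓤 (q ∘ₗ braiding B V U))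

include h hψ hθ hθ' in
/-- The duality isomorphism `(R # U) # V ≅ R ⊗ (U # V)`. -/
theorem exists_equiv_smash_smash :
    ∃ Φ : ((R ⊗[k] U) ⊗[k] V) ≃ₗ[k] (R ⊗[k] (U ⊗[k] V)), IsYDHom B Φ.toLinearMap ∧
      Φ (smash 𝓥 (smash 𝓤 X (actionOfCoaction (B := B) q ψ)) (actRight (B := B) R
        (hit 𝓤 (q ∘ₗ braiding B V U)))).one = (X.tensor B 𝓨).one ∧
      ∀ s t, Φ ((smash 𝓥 (smash 𝓤 X (actionOfCoaction (B := B) q ψ)) (actRight (B := B) R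
        (hit 𝓤 (q ∘ₗ braiding B V U)))).mul (s ⊗ₜ t)) = (X.tensor B 𝓨).mul (Φ s ⊗ₜ Φ t) := by
  have hY := fact_isYDAlgebra_smash_hit (𝓤 := 𝓤) w
  have hY' : Fact (𝓨).IsAlgebra := ⟨hY.out.toIsAlgebra⟩
  have hp := h.pairing
  have : ModuleAlgebra 𝓤 X (actionOfCoaction (B := B) q ψ) := ⟨isModuleAlgebra_actionOfCoaction q ψ⟩
  have hl := shear_shear (Y := 𝓨) ψ w (w ∘ₗ θ) (lift_mul_lift_antipodeInverse w θ)
  have hr := shear_shear (Y := 𝓨) ψ (w ∘ₗ θ) w (lift_antipodeInverse_mul_lift w θ)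
  -- The shear by `w` maps the braided product to the twisted one, so the isomorphism goes by its
  -- inverse, the shear by `w ∘ S⁻¹`.
  let Θ : (R ⊗[k] (U ⊗[k] V)) ≃ₗ[k] (R ⊗[k] (U ⊗[k] V)) := LinearEquiv.ofLinearMap _ _ hr hl
  refine ⟨(TensorProduct.assoc k R U V).trans Θ, ?_, ?_, ?_⟩
  · exact (IsYDHom.shear ψ hY.out.mul_hom (h.hom.comp hθ'.out) hψ.out.hom).comp IsYDHom.assoc
  · have h1 := congrArg (shear 𝓨 (w ∘ₗ θ) ψ) (shear_one (Y := 𝓨) ψ w (lift_one w))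
    rw [← LinearMap.comp_apply, hr] at h1
    exact h1.symm
  · intro s t
    have h1 := assoc_smash_smash_mul (𝓤 := 𝓤) (𝓥 := 𝓥) (p := q ∘ₗ braiding B V U) (X := X)
      (α := actionOfCoaction (B := B) q ψ) (s ⊗ₜ t)
    have hs (x) : shear 𝓨 w ψ (shear 𝓨 (w ∘ₗ θ) ψ x) = x := LinearMap.congr_fun hl x
    have h2 := twisted_mul_map (opTwist_op22_shear (T := k) (q := q) ψ w)
      (shear 𝓨 (w ∘ₗ θ) ψ (TensorProduct.assoc k R U V s))
      (shear 𝓨 (w ∘ₗ θ) ψ (TensorProduct.assoc k R U V t))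
    rw [hs, hs] at h2
    rw [LinearEquiv.trans_apply, h1]
    refine (congrArg (shear 𝓨 (w ∘ₗ θ) ψ) h2).trans ?_
    exact LinearMap.congr_fun hr _

end
end

end YD

end

/-! ### The duality theorem -/

theorem corollary2p6 {k B H U V R : Type*} [Field k] [Ring B] [HopfAlgebra k B]
    [FiniteDimensional k B]
    [AddCommGroup H] [Module k H] [YD.YDModule k B H] (𝓗 : YD.BraidedHopfAlgebra k B H)
    (hC : YD.braiding (k := k) B H H ∘ₗ YD.braiding B H H
      = (LinearMap.id : H ⊗[k] H →ₗ[k] H ⊗[k] H))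
    [AddCommGroup U] [Module k U] [YD.YDModule k B U] (𝓤 : YD.BraidedHopfAlgebra k B U)
    (ι : U →ₗ[k] Module.Dual k H) (hU : YD.IsHopfSubalgebraOfFiniteDual 𝓗 𝓤 ι)
    (hSU : Function.Bijective 𝓤.antipode) (hdense : YD.IsDenseInDual ι)
    [AddCommGroup V] [Module k V] [YD.YDModule k B V] (𝓥 : YD.BraidedHopfAlgebra k B V)
    (j : V →ₗ[k] H) (hV : YD.IsHopfSubalgebra 𝓗 𝓥 j)
    (hSV : Function.Bijective 𝓥.antipode)
    (hRL : YD.RLCondition 𝓤 (YD.evalBraidPairing B ι j))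
    [AddCommGroup R] [Module k R] [YD.YDModule k B R] (𝓡 : YD.AlgStr k R)
    (ψ : R →ₗ[k] R ⊗[k] V) (hR : YD.IsComoduleAlgebra 𝓥 𝓡 ψ) :
    -- the pairing `⟨,⟩ = ⟨,⟩_ev C` and the actions of `U` on `R`, of `V` on `U`, of `V` on `R # U`
    let p : V ⊗[k] U →ₗ[k] k := YD.evalBraidPairing B ι j
    let α : U ⊗[k] R →ₗ[k] R := YD.coactionToAction (B := B) p ψ
    let β : V ⊗[k] U →ₗ[k] U := YD.hit 𝓤 p
    let γ : V ⊗[k] (R ⊗[k] U) →ₗ[k] R ⊗[k] U := YD.actRight (B := B) R β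
    -- the algebras `R # U`, `(R # U) # V`, `U # V` and `R ⊗ (U # V)`
    let RU : YD.AlgStr k (R ⊗[k] U) := YD.smash 𝓤 𝓡 α
    let RUV : YD.AlgStr k ((R ⊗[k] U) ⊗[k] V) := YD.smash 𝓥 RU γ
    let UV : YD.AlgStr k (U ⊗[k] V) := YD.smash 𝓥 𝓤.toAlgStr β
    let R_UV : YD.AlgStr k (R ⊗[k] (U ⊗[k] V)) := 𝓡.tensor B UV
    YD.IsModuleAlgebra 𝓤 𝓡 α ∧
    YD.IsModuleAlgebra 𝓥 𝓤.toAlgStr β ∧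
    YD.IsModuleAlgebra 𝓥 RU γ ∧
    RUV.IsYDAlgebra B ∧
    R_UV.IsYDAlgebra B ∧
    ∃ Φ : ((R ⊗[k] U) ⊗[k] V) ≃ₗ[k] (R ⊗[k] (U ⊗[k] V)),
      Φ RUV.one = R_UV.one ∧
      (∀ s t, Φ (RUV.mul (s ⊗ₜ t)) = R_UV.mul (Φ s ⊗ₜ Φ t)) ∧
      ((∀ a b : B, a * b = b * a) → Coalgebra.IsCocomm k B →
        YD.IsYDHom B Φ.toLinearMap) := by
  set q : U ⊗[k] V →ₗ[k] k := TensorProduct.lift ι ∘ₗ j.lTensor U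
  have hι (u : U) (h : ∀ x, TensorProduct.lift ι (u ⊗ₜ x) = 0) : u = 0 :=
    hU.injective (LinearMap.ext fun x => by simpa using h x)
  -- symmetry of the braidings between `U` and `V`
  have sHH : YD.Symmetric (k := k) B H H := ⟨hC⟩
  have sVH : YD.Symmetric (k := k) B V H := .of_injective hV.hom hV.injective sHH
  have sVV : YD.Symmetric (k := k) B V V := .of_injective hV.hom hV.injective sVH.symm
  have sVU : YD.Symmetric (k := k) B V U := .of_pairing hU.isYDHom_lift hι sVH
  have sUV : YD.Symmetric (k := k) B U V := sVU.symm
  have sHU : YD.Symmetric (k := k) B H U := .of_pairing hU.isYDHom_lift hι sHH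
  have sUU : YD.Symmetric (k := k) B U U := .of_pairing hU.isYDHom_lift hι sHU.symm
  -- the two pairings
  have hq : YD.BialgebraPairing 𝓤 𝓥 q := YD.bialgebraPairing_eval hU hV
  have hp : YD.BialgebraPairing 𝓥 𝓤 (q ∘ₗ YD.braiding B V U) := YD.bialgebraPairing_comp_braiding q
  have hn := YD.comp_braiding_nondegenerate hq.hom (YD.pairing_eval_nondegenerate hV hdense)
  -- the lift of `ρ(v # 1)`
  obtain ⟨θ, hθ, hθ'⟩ := YD.exists_isAntipodeInverse 𝓤 hSU
  obtain ⟨η, hη, hη'⟩ := YD.exists_isAntipodeInverse 𝓥 hSV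
  have : Fact (YD.IsYDHom B θ) := ⟨hθ'⟩
  have : Fact (YD.IsYDHom B η) := ⟨hη'⟩
  obtain ⟨w, hw, hlam⟩ := YD.exists_lift_of_RLCondition (q ∘ₗ YD.braiding B V U) θ hn hRL
  have hlift : YD.RLLift 𝓤 𝓥 (q ∘ₗ YD.braiding B V U) w :=
    ⟨hp, hw, YD.eq_zero_of_lam _ θ hn, hlam⟩
  have hψ : YD.ComoduleAlgebra 𝓥 𝓡 ψ := ⟨hR⟩
  intro p α
  -- The two braidings in the definition of `α` cancel, so `U` acts on `R` through the evaluation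
  -- pairing itself.
  have hα : α = YD.actionOfCoaction (B := B) q ψ := by
    refine congrArg (YD.actionOfCoaction (B := B) · ψ)
      (?_ : q ∘ₗ YD.braiding B V U ∘ₗ YD.braiding B U V = q)
    rw [sUV.comp_eq, LinearMap.comp_id]
  clear_value α
  subst hα
  intro β γ RU RUV UV R_UV
  replace hp : YD.BialgebraPairing 𝓥 𝓤 p := hp
  have h1 : YD.ModuleAlgebra 𝓤 𝓡 (YD.actionOfCoaction (B := B) q ψ) := ⟨YD.isModuleAlgebra_actionOfCoaction q ψ⟩
  have h2 : YD.ModuleAlgebra 𝓥 𝓤.toAlgStr β := YD.moduleAlgebra_hit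
  have h3 : YD.ModuleAlgebra 𝓥 RU γ := by
    -- `R # U` is a right `U`-comodule algebra, and the action of `V` is the one dual to its
    -- coaction.
    have := YD.ComoduleAlgebra.mk (YD.isComoduleAlgebra_smash 𝓤 𝓡 (YD.actionOfCoaction (B := B) q ψ))
    refine ⟨?_⟩
    rw [show γ = YD.actionOfCoaction (B := B) p (YD.lTensorComul R 𝓤) from YD.actRight_hit 𝓤 p]
    exact YD.isModuleAlgebra_actionOfCoaction p _
  have h4 : Fact (𝓡.IsYDAlgebra B) := ⟨hR.isYDAlgebra⟩
  have h5 : Fact (UV.IsYDAlgebra B) := ⟨YD.isYDAlgebra_smash 𝓥 β⟩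
  obtain ⟨Φ, hΦ, hone, hmul⟩ := YD.exists_equiv_smash_smash (𝓤 := 𝓤) (q := q) (X := 𝓡) ψ w η
  exact ⟨h1.out, h2.out, h3.out, YD.isYDAlgebra_smash 𝓥 γ, YD.isYDAlgebra_tensor 𝓡 UV, Φ, hone, hmul,
    fun _ _ => hΦ⟩
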